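/- Let $k$ be an algebraically closed field and let $(X,\mathcal{A})$ be a ringed space over $k$, i.e. a topological space $X$ with a sheaf $\mathcal{A}$ of associative $k$-algebras. A sheaf of left $\mathcal{A}$-modules is quasi-coherent if, locally on $X$, it is the cokernel of a morphism of free sheaves of left modules; $\mathsf{QCoh}(\mathcal{A})$ is the category of quasi-coherent sheaves of left $\mathcal{A}$-modules. An open subset $U\subseteq X$ is $\mathcal{A}$-affine if $\Gamma(U,-)$ is an equivalence from $\mathsf{QCoh}(\mathcal{A}|_U)$ to the category of left $\mathcal{A}(U)$-modules and $H^n(U,\mathcal{F})=0$ for all $n\ge 1$ and all $\mathcal{F}\in\mathsf{QCoh}(\mathcal{A}|_U)$. Let $\mathcal{U}$ be an open cover of $X$ which is $\mathcal{A}$-affine (every $U\in\mathcal{U}$ is $\mathcal{A}$-affine) and good (every finite intersection $U_1\cap\dots\cap U_r$, $r\ge 1$, of members of $\mathcal{U}$ is covered by members of $\mathcal{U}$ contained in it). Let $\mathsf{PreSh}(\mathcal{U},\mathcal{A})$ be the category of presheaves of left $\mathcal{A}$-modules on $\mathcal{U}$, ordered by inclusion, and let $\pi:\mathsf{QCoh}(\mathcal{A})\to\mathsf{PreSh}(\mathcal{U},\mathcal{A})$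 be the forgetful functor, through which $\mathsf{QCoh}(\mathcal{A})$ is regarded as a full subcategory of $\mathsf{PreSh}(\mathcal{U},\mathcal{A})$. Let $\mathsf{a}_p$ be the category of $p$-pointed noncommutative Artin rings: Artinian $k$-algebras $R$ with $k$-algebra homomorphisms $k^p\to R\to k^p$ composing to the identity, such that $R$ is separated and complete in the $I$-adic topology for $I=\ker(R\to k^p)$; morphisms are the algebra homomorphisms compatible with these structure maps. For $R\in\mathsf{a}_p$ let $e_1,\dots,e_p\in R$ be the images of the standard idempotents of $k^p$, let $R_{ij}=e_iRe_j$, and let $k_i$ be $k$ regarded as a left $R$-module through the $i$-th component of $R\to k^p$. Let $\mathsf{C}$ be either $\mathsf{PreSh}(\mathcal{U},\mathcal{A})$ or its full subcategory $\mathsf{QCoh}(\mathcal{A})$, and let $\mathcal{G}=\{\mathcal{G}_1,\dots,\mathcal{G}_p\}$ be a finite family of objects of $\mathsf{C}$. A lifting of $\mathcal{G}$ to $R$ is an object $\mathcal{G}_R$ of $\mathsf{C}$ with a $k$-linear right action of $R$ that is $R$-free, i.e. $\mathcal{G}_R(U)\cong\bigoplus_{i,j}\mathcal{G}_i(U)\otimes_k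 R_{ij}$ as right $R$-modules for every $U\in\mathcal{U}$, together with isomorphisms $\eta_i:\mathcal{G}_R\otimes_R k_i\to\mathcal{G}_i$ in $\mathsf{C}$ for $1\le i\le p$ (tensor products being formed in $\mathsf{C}$). Two liftings are equivalent if they are related by an $R$-linear isomorphism compatible with the $\eta_i$. Let $\mathsf{Def}^{\mathsf{C}}_{\mathcal{G}}(R)$ be the set of equivalence classes. Let $\mathcal{F}=\{\mathcal{F}_1,\dots,\mathcal{F}_p\}$ be a finite family in $\mathsf{QCoh}(\mathcal{A})$. Then base change $-\otimes_R S$ along the morphisms $R\to S$ of $\mathsf{a}_p$ exists for liftings of $\mathcal{F}$ in $\mathsf{QCoh}(\mathcal{A})$ and for liftings of $\pi(\mathcal{F})$ in $\mathsf{PreSh}(\mathcal{U},\mathcal{A})$, so that $\mathsf{Def}^{qc}_{\mathcal{F}}=\mathsf{Def}^{\mathsf{QCoh}(\mathcal{A})}_{\mathcal{F}}$ and $\mathsf{Def}^{\mathcal{U}}_{\mathcal{F}}=\mathsf{Def}^{\mathsf{PreSh}(\mathcal{U},\mathcal{A})}_{\pi(\mathcal{F})}$ are functors $\mathsf{a}_p\to\mathsf{Sets}$;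 the functor $\pi$ sends liftings of $\mathcal{F}$ to liftings of $\pi(\mathcal{F})$; and the assignment $[\mathcal{F}_R]\mapsto[\pi(\mathcal{F}_R)]$ is an isomorphism $\mathsf{Def}^{qc}_{\mathcal{F}}\to\mathsf{Def}^{\mathcal{U}}_{\mathcal{F}}$ of functors on $\mathsf{a}_p$. -/

import Mathlib

open CategoryTheory Opposite TopologicalSpace
open scoped TensorProduct

universe v v₁ v₂ u u₁ u₂

noncomputable section

namespace NCDef

/-! ### Pointed noncommutative Artin rings -/

/-- An object of the category `a_p` of `p`-pointed noncommutative Artin rings over `k`: an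
associative `k`-algebra `R` with structural homomorphisms `k ^ p → R → k ^ p` whose composition is
the identity, which is Artinian (on both sides) and separated and complete for the `I`-adic
topology, where `I` is the kernel of `R → k ^ p`. -/
structure PtArt (k : Type u) [Field k] (p : ℕ) : Type (u + 1) where
  carrier : Type u
  [ring : Ring carrier]
  [algebra : Algebra k carrier]
  incl : (Fin p → k) →ₐ[k] carrier
  aug : carrier →ₐ[k] (Fin p → k)
  aug_incl : aug.comp incl = AlgHom.id k (Fin p → k)
  artinian_left : IsArtinian carrier carrier
  artinian_right : IsArtinian carrierᵐᵒᵖ carrier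
  /-- Uniqueness of limits says that the `I`-adic topology is separated, existence of limits that
  it is complete. -/
  complete : ∀ x : ℕ → carrier, (∀ n, x (n + 1) - x n ∈ (RingHom.ker aug) ^ n) →
    ∃! l : carrier, ∀ n, l - x n ∈ (RingHom.ker aug) ^ n

attribute [instance] PtArt.ring PtArt.algebra

namespace PtArt

variable {k : Type u} [Field k] {p : ℕ}

/-- Morphisms in `a_p`: homomorphisms compatible with both structural maps. -/
@[ext]
structure Hom (R S : PtArt k p) where
  toAlgHom : R.carrier →ₐ[k] S.carrier
  comp_incl : toAlgHom.comp R.incl = S.incl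
  aug_comp : S.aug.comp toAlgHom = R.aug

instance : Category (PtArt k p) where
  Hom := Hom
  id R := ⟨AlgHom.id k _, AlgHom.id_comp _, AlgHom.comp_id _⟩
  comp f g := ⟨g.toAlgHom.comp f.toAlgHom,
    by rw [AlgHom.comp_assoc, f.comp_incl, g.comp_incl],
    by rw [← AlgHom.comp_assoc, g.aug_comp, f.aug_comp]⟩

/-- The `i`-th point `R → k ^ p → k`; it makes `k` the simple left `R`-module `k_i`. -/
def point (R : PtArt k p) (i : Fin p) : R.carrier →ₐ[k] k :=
  (Pi.evalAlgHom k (fun _ : Fin p => k) i).comp R.aug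

/-- The idempotent `e_i` of `R`. -/
def idem (R : PtArt k p) (i : Fin p) : R.carrier :=
  R.incl (Pi.single i 1)

/-- The right ideal `e_i R`, that is, the `i`-th row `⨁ j, R_ij` of the matrix ring
`R = (R_ij)`, where `R_ij = e_i R e_j`. -/
def row (R : PtArt k p) (i : Fin p) : Submodule (R.carrier)ᵐᵒᵖ R.carrier :=
  Submodule.span _ {R.idem i}

end PtArt

/-! ### Objects with a right action, and tensor products -/

section RObj

variable {k : Type u} [Field k] {D : Type u₁} [Category.{v₁} D] [Preadditive D] [Linear k D]

variable (D) in
/-- An `R`-object of the `k`-linear category `D`: an object with a `k`-linear right action of `R`.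
(The product of `End X` is `f * g = g ≫ f`.) -/
structure RObj (R : Type u) [Ring R] [Algebra k R] where
  X : D
  act : Rᵐᵒᵖ →ₐ[k] End X

/-- The action of a single element. -/
def RObj.rmul {R : Type u} [Ring R] [Algebra k R] (Y : RObj D (k := k) R) (r : R) : Y.X ⟶ Y.X :=
  Y.act (MulOpposite.op r)

/-- The image of an `R`-object under a `k`-linear functor. -/
def RObj.map {D' : Type u₂} [Category.{v₂} D'] [Preadditive D'] [Linear k D'] (G : D ⥤ D')
    [G.Additive] [G.Linear k] {R : Type u} [Ring R] [Algebra k R] (Y : RObj D (k := k) R) :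
    RObj D' (k := k) R where
  X := G.obj Y.X
  act := AlgHom.ofLinearMap
    { toFun := fun r => G.map (Y.act r)
      map_add' := fun r s => by rw [map_add]; exact G.map_add
      map_smul' := fun c r => by rw [map_smul]; exact G.map_smul _ _ }
    (by change G.map (Y.act 1) = _; rw [map_one]; exact G.map_id _)
    (fun r s => by change G.map (Y.act (r * s)) = _; rw [map_mul]; exact G.map_comp _ _)

/-- `t` exhibits `T` as the tensor product `Y ⊗_R S` in `D`, where `S` is a left `R`-module through
`u`: the object `T` represents the functor sending `Z` to the `R`-linear maps from `S` to the left
`R`-module `Hom (Y, Z)`. If `S` is the cokernel of `R ^ m → R ^ n`, this says that `T` is the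
cokernel of the corresponding morphism `Y ^ m → Y ^ n`. -/
structure IsTensor {R S : Type u} [Ring R] [Algebra k R] [Ring S] [Algebra k S] (u : R →ₐ[k] S)
    (Y : RObj D (k := k) R) {T : D} (t : S →ₗ[k] (Y.X ⟶ T)) : Prop where
  balanced : ∀ (r : R) (s : S), t (u r * s) = Y.rmul r ≫ t s
  universal : ∀ (Z : D) (t' : S →ₗ[k] (Y.X ⟶ Z)),
    (∀ (r : R) (s : S), t' (u r * s) = Y.rmul r ≫ t' s) →
      ∃! h : T ⟶ Z, ∀ s : S, t s ≫ h = t' s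

/-- For a morphism `b : Y ⟶ Y'` to an `S`-object, the map sending `s` to `b` followed by the
action of `s`. -/
def RObj.orbit {Y : D} {S : Type u} [Ring S] [Algebra k S] (Y' : RObj D (k := k) S)
    (b : Y ⟶ Y'.X) : S →ₗ[k] (Y ⟶ Y'.X) where
  toFun s := b ≫ Y'.rmul s
  map_add' s t := by
    have : Y'.rmul (s + t) = Y'.rmul s + Y'.rmul t := by simp [RObj.rmul]
    rw [this, Preadditive.comp_add]
  map_smul' c s := by
    have : Y'.rmul (c • s) = c • Y'.rmul s := by simp [RObj.rmul]
    rw [this, Linear.comp_smul]; rfl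

variable {R S T : Type u} [Ring R] [Algebra k R] [Ring S] [Algebra k S] [Ring T] [Algebra k T]

lemma RObj.rmul_one (Y : RObj D (k := k) R) : Y.rmul 1 = 𝟙 _ := map_one Y.act

lemma RObj.rmul_mul (Y : RObj D (k := k) R) (r s : R) :
    Y.rmul (r * s) = Y.rmul r ≫ Y.rmul s :=
  map_mul Y.act (MulOpposite.op s) (MulOpposite.op r)

lemma RObj.orbit_apply {Y : D} (Y' : RObj D (k := k) S) (b : Y ⟶ Y'.X) (s : S) :
    Y'.orbit b s = b ≫ Y'.rmul s := rfl

lemma IsTensor.equivariant {u : R →ₐ[k] S} {Y : RObj D (k := k) R} {Y' : RObj D (k := k) S}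
    {b : Y.X ⟶ Y'.X} (h : IsTensor u Y (Y'.orbit b)) (r : R) :
    Y.rmul r ≫ b = b ≫ Y'.rmul (u r) := by
  have := h.balanced r 1
  simpa [RObj.orbit_apply, RObj.rmul_one] using this.symm

lemma IsTensor.hom_ext {u : R →ₐ[k] S} {Y : RObj D (k := k) R} {Z W : D}
    {t : S →ₗ[k] (Y.X ⟶ W)} (h : IsTensor u Y t) {f g : W ⟶ Z}
    (hfg : ∀ s, t s ≫ f = t s ≫ g) : f = g := by
  obtain ⟨_, _, hu⟩ := h.universal Z
    { toFun := fun s => t s ≫ g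
      map_add' := fun a b => by rw [map_add, Preadditive.add_comp]
      map_smul' := fun c a => by rw [map_smul, Linear.smul_comp]; rfl }
    (fun r s => by
      change t (u r * s) ≫ g = Y.rmul r ≫ t s ≫ g
      rw [h.balanced, Category.assoc])
  exact (hu f hfg).trans (hu g fun _ => rfl).symm

lemma IsTensor.refl (Y : RObj D (k := k) R) : IsTensor (AlgHom.id k R) Y (Y.orbit (𝟙 Y.X)) where
  balanced r s := by simp [RObj.orbit_apply, RObj.rmul_mul]
  universal Z t' ht' := by
    refine ⟨t' 1, fun s => ?_, fun h hh => ?_⟩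
    · have := ht' s 1
      simpa [RObj.orbit_apply] using this.symm
    · have := hh 1
      simpa [RObj.orbit_apply, RObj.rmul_one] using this

lemma IsTensor.trans {u : R →ₐ[k] S} {w : S →ₐ[k] T} {Y : RObj D (k := k) R}
    {Y' : RObj D (k := k) S} {Y'' : RObj D (k := k) T} {b : Y.X ⟶ Y'.X} {b' : Y'.X ⟶ Y''.X}
    (h : IsTensor u Y (Y'.orbit b)) (h' : IsTensor w Y' (Y''.orbit b')) :
    IsTensor (w.comp u) Y (Y''.orbit (b ≫ b')) where
  balanced r t := by
    simp only [RObj.orbit_apply, AlgHom.comp_apply, RObj.rmul_mul, Category.assoc]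
    rw [← reassoc_of% h'.equivariant (u r), ← reassoc_of% h.equivariant r]
  universal Z t' ht' := by
    have key : ∀ t : T, ∃ f : Y'.X ⟶ Z, ∀ s, Y'.orbit b s ≫ f = t' (w s * t) := fun t =>
      (h.universal Z (t' ∘ₗ LinearMap.mulRight k t ∘ₗ w.toLinearMap)
        (fun r s => by
          have := ht' r (w s * t)
          simpa [mul_assoc] using this)).exists
    choose f hf using key
    have hext : ∀ t (g : Y'.X ⟶ Z), (∀ s, Y'.orbit b s ≫ g = t' (w s * t)) → f t = g :=
      fun t g hg => h.hom_ext fun s => (hf t s).trans (hg s).symm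
    obtain ⟨g, hg, hgu⟩ := h'.universal Z
      { toFun := f
        map_add' := fun x y => hext _ _ fun s => by
          rw [Preadditive.comp_add, hf, hf, mul_add, map_add]
        map_smul' := fun c x => hext _ _ fun s => by
          change _ ≫ (c • f x) = _
          rw [Linear.comp_smul, hf, mul_smul_comm, map_smul] }
      (fun s t => hext _ _ fun s' => by
        change _ ≫ _ ≫ f t = _
        have := hf t (s' * s)
        simpa [RObj.orbit_apply, RObj.rmul_mul, mul_assoc] using this)
    refine ⟨g, fun t => ?_, fun g' hg' => hgu g' fun t => ?_⟩
    · have h1 := hg t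
      have h2 := hf t 1
      simp only [RObj.orbit_apply, RObj.rmul_one, Category.comp_id, map_one, one_mul,
        Category.assoc] at h1 h2 ⊢
      exact (congrArg (b ≫ ·) h1).trans h2
    · refine (hext t _ fun s => ?_).symm
      have h1 := hg' (w s * t)
      simp only [RObj.orbit_apply, RObj.rmul_mul, Category.assoc] at h1 ⊢
      rw [reassoc_of% h'.equivariant s]
      exact h1

end RObj

/-! ### Presheaves and sheaves of modules over a presheaf or sheaf of `k`-algebras -/

section Modules

variable {k : Type u} [Field k]

section Presheaf

variable {C : Type u₁} [Category.{v₁} C]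

/-- The category of presheaves of left modules over a presheaf of associative `k`-algebras. -/
abbrev PreShMod (A : Cᵒᵖ ⥤ AlgCat.{u} k) :=
  PresheafOfModules.{u} (A ⋙ forget₂ (AlgCat.{u} k) RingCat.{u})

variable (A : Cᵒᵖ ⥤ AlgCat.{u} k)

/-- Multiplication by scalars of `k` on the sections of a presheaf of modules. -/
def scalarEnd (a : k) (M : PreShMod A) : M ⟶ M :=
  PresheafOfModules.homMk
    { app := fun c => AddCommGrpCat.ofHom
        (DistribSMul.toAddMonoidHom (M.obj c) (algebraMap k (A.obj c) a))
      naturality := fun c d f => by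
        ext x
        change algebraMap k (A.obj d) a • M.map f x =
          M.map f (algebraMap k (A.obj c) a • (show M.obj c from x))
        rw [PresheafOfModules.map_smul]
        congr 1
        exact ((A.map f).hom.commutes a).symm }
    (fun c r m => by
      change algebraMap k (A.obj c) a • (show A.obj c from r) • (show M.obj c from m) =
        (show A.obj c from r) • algebraMap k (A.obj c) a • (show M.obj c from m)
      rw [← mul_smul, ← mul_smul, Algebra.commutes])

/-- The ring homomorphism from `k` to the centre of the category given by scalar
multiplication. -/
def toCenter : k →+* CatCenter (PreShMod A) where
  toFun a :=
    { app := fun M => scalarEnd A a M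
      naturality := fun M N f => by
        ext c x
        exact ((f.app c).hom.map_smul (algebraMap k (A.obj c) a) x).symm }
  map_one' := by
    ext M c x
    change algebraMap k (A.obj c) 1 • x = x
    rw [map_one, one_smul]
  map_zero' := by
    ext M c x
    change algebraMap k (A.obj c) 0 • x = 0
    rw [map_zero, zero_smul]
  map_add' a b := by
    ext M c x
    change algebraMap k (A.obj c) (a + b) • x =
      algebraMap k (A.obj c) a • x + algebraMap k (A.obj c) b • x
    rw [map_add, add_smul]
  map_mul' a b := by
    ext M c x
    change algebraMap k (A.obj c) (a * b) • x =
      algebraMap k (A.obj c) a • algebraMap k (A.obj c) b • x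
    rw [map_mul, mul_smul]

instance : Linear k (PreShMod A) := Linear.ofRingMorphism (toCenter A)

/-- The forgetful functor `π_c` to `k`-vector spaces, given by sections over `c`. -/
def fiber (c : C) : PreShMod A ⥤ ModuleCat.{u} k :=
  PresheafOfModules.evaluation _ (op c) ⋙
    ModuleCat.restrictScalars (R := k) (S := A.obj (op c)) (algebraMap k (A.obj (op c)))

end Presheaf

section Space

variable {X : TopCat.{u}} (A : TopCat.Sheaf (AlgCat.{u} k) X)

/-- The sheaf of rings underlying a sheaf of `k`-algebras on a topological space. -/
abbrev ringSheaf : TopCat.Sheaf RingCat.{u} X :=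
  (sheafCompose (Opens.grothendieckTopology X) (forget₂ (AlgCat.{u} k) RingCat.{u})).obj A

/-- The category of sheaves of left modules over a sheaf of associative `k`-algebras. -/
abbrev ShMod := SheafOfModules.{u} (ringSheaf A)

/-- A sheaf of modules is in particular a presheaf of modules. -/
def forgetSh : ShMod A ⥤ PreShMod A.obj := SheafOfModules.forget (ringSheaf A)

/-- The ring homomorphism from `k` to the centre of the category given by scalar
multiplication. -/
def toCenterSh : k →+* CatCenter (ShMod A) where
  toFun a :=
    { app := fun M => ⟨scalarEnd A.obj a M.val⟩
      naturality := fun M N f => by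
        ext1
        exact ((toCenter A.obj) a).naturality f.val }
  map_one' := by
    ext M : 2
    exact congrArg (fun z => z.app M.val) (map_one (toCenter A.obj))
  map_zero' := by
    ext M : 2
    exact congrArg (fun z => z.app M.val) (map_zero (toCenter A.obj))
  map_add' a b := by
    ext M : 2
    exact congrArg (fun z => z.app M.val) (map_add (toCenter A.obj) a b)
  map_mul' a b := by
    ext M : 2
    exact congrArg (fun z => z.app M.val) (map_mul (toCenter A.obj) a b)

instance : Linear k (ShMod A) := Linear.ofRingMorphism (toCenterSh A)

instance : (forgetSh A).Additive where
instance : (forgetSh A).Linear k where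

/-- The category of quasi-coherent sheaves of left modules over a sheaf of `k`-algebras on a
topological space, as a full subcategory of the category of sheaves of modules. -/
abbrev QCoh := (SheafOfModules.isQuasicoherent (ringSheaf A)).FullSubcategory

/-- The functor of sections over `U` from quasi-coherent modules on `U` to modules over
`A(U)`. (Sheaves on `U` are sheaves on the site of open subsets of `U`.) -/
def sectionsFunctor (U : Opens X) :
    (SheafOfModules.isQuasicoherent ((ringSheaf A).over U)).FullSubcategory ⥤
      ModuleCat.{u} (((ringSheaf A).over U).obj.obj (op (Over.mk (𝟙 U)))) :=
  (SheafOfModules.isQuasicoherent ((ringSheaf A).over U)).ι ⋙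
    SheafOfModules.evaluation.{u} ((ringSheaf A).over U) (op (Over.mk (𝟙 U)))

/-- An open subset `U` is `A`-affine if taking sections over `U` is an equivalence from
quasi-coherent modules on `U` to `A(U)`-modules, and the higher cohomology of every quasi-coherent
module on `U` vanishes. -/
structure IsAffineOpen (U : Opens X) : Prop where
  isEquivalence : (sectionsFunctor A U).IsEquivalence
  cohomology : ∀ F : SheafOfModules.{u} ((ringSheaf A).over U), F.IsQuasicoherent →
    ∀ n : ℕ, 1 ≤ n →
      Subsingleton (((SheafOfModules.toSheaf ((ringSheaf A).over U)).obj F).H n)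

/-- A family of open subsets is good if every finite intersection of at least one member can be
covered by members contained in it. -/
def IsGood (𝒰 : Set (Opens X)) : Prop :=
  ∀ s : Finset (Opens X), s.Nonempty → (s : Set (Opens X)) ⊆ 𝒰 →
    ∀ x ∈ s.inf id, ∃ W ∈ 𝒰, x ∈ W ∧ W ≤ s.inf id

/-- A family of open subsets, viewed as a full subcategory of the category of all open subsets. -/
abbrev coverCat (𝒰 : Set (Opens X)) := ObjectProperty.FullSubcategory (fun U : Opens X => U ∈ 𝒰)

/-- The restriction of the sheaf of `k`-algebras to a family of open subsets. -/
abbrev resAlg (𝒰 : Set (Opens X)) : (coverCat 𝒰)ᵒᵖ ⥤ AlgCat.{u} k :=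
  (ObjectProperty.ι (fun U : Opens X => U ∈ 𝒰)).op ⋙ A.obj

/-- The restriction of presheaves of modules to a family of open subsets. -/
def resPreSh (𝒰 : Set (Opens X)) : PreShMod A.obj ⥤ PreShMod (resAlg A 𝒰) :=
  PresheafOfModules.pushforward₀ (ObjectProperty.ι (fun U : Opens X => U ∈ 𝒰))
    (A.obj ⋙ forget₂ (AlgCat.{u} k) RingCat.{u})

instance (𝒰 : Set (Opens X)) : (resPreSh A 𝒰).Additive where
instance (𝒰 : Set (Opens X)) : (resPreSh A 𝒰).Linear k where

/-- The forgetful functor `π` from quasi-coherent modules on `X` to presheaves of modules on a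
family of open subsets. -/
def forgetQCoh (𝒰 : Set (Opens X)) : QCoh A ⥤ PreShMod (resAlg A 𝒰) :=
  (SheafOfModules.isQuasicoherent (ringSheaf A)).ι ⋙ forgetSh A ⋙ resPreSh A 𝒰

instance (𝒰 : Set (Opens X)) : (forgetQCoh A 𝒰).Additive := by
  unfold forgetQCoh; infer_instance
instance (𝒰 : Set (Opens X)) : (forgetQCoh A 𝒰).Linear k := by
  unfold forgetQCoh; infer_instance

/-- The family of presheaves of modules on `𝒰` underlying a family of quasi-coherent modules. -/
abbrev resFamily (𝒰 : Set (Opens X)) {p : ℕ} (F : Fin p → QCoh A) :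
    Fin p → PreShMod (resAlg A 𝒰) :=
  fun i => (forgetQCoh A 𝒰).obj (F i)

end Space

end Modules

/-! ### The noncommutative deformation functor -/

section Deformation

variable {k : Type u} [Field k] {p : ℕ} {C : Type u₁} [Category.{v₁} C] {A : Cᵒᵖ ⥤ AlgCat.{u} k}
  {D : Type u₂} [Category.{v₂} D] [Preadditive D] [Linear k D]

/-- Matric freeness of an `R`-object `Y` of a category `D` of presheaves of modules, embedded by
`G`, relative to a family `F` of objects of `D`: for each object `c` of the base category, there is
an isomorphism `Y(c) ≅ ⨁ i j, F_i(c) ⊗ R_ij` of right `R`-modules. Here `⨁ j, R_ij = e_i R`,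
and the factors of the tensor product are written in the opposite order. -/
def IsMatricFree (G : D ⥤ PreShMod A) (F : Fin p → D) (R : PtArt k p)
    (Y : RObj D (k := k) R.carrier) : Prop :=
  ∀ c : C, ∃ e : (G ⋙ fiber A c).obj Y.X ≃+
      (∀ i : Fin p, (R.row i) ⊗[k] ((G ⋙ fiber A c).obj (F i))),
    ∀ (r : R.carrier) (y : (G ⋙ fiber A c).obj Y.X),
      e ((G ⋙ fiber A c).map (Y.rmul r) y) = MulOpposite.op r • e y

/-- A lifting of the family `F` to `R`: a matric free `R`-object `Y` of `D` with isomorphisms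
`Y ⊗_R k_i ≅ F_i` in `D`, which are given by morphisms `q_i : Y ⟶ F_i` exhibiting `F_i` as
this tensor product. -/
structure IsLifting (G : D ⥤ PreShMod A) (F : Fin p → D) (R : PtArt k p)
    (Y : RObj D (k := k) R.carrier) (q : ∀ i, Y.X ⟶ F i) : Prop where
  free : IsMatricFree G F R Y
  fiber : ∀ i, IsTensor (R.point i) Y (LinearMap.toSpanSingleton k (Y.X ⟶ F i) (q i))

/-- The type of liftings of the family `F` to `R`. -/
structure Lifting (G : D ⥤ PreShMod A) (F : Fin p → D) (R : PtArt k p) where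
  Y : RObj D (k := k) R.carrier
  q : ∀ i, Y.X ⟶ F i
  isLifting : IsLifting G F R Y q

variable {G : D ⥤ PreShMod A} {F : Fin p → D}

/-- Equivalence of liftings. -/
def Lifting.Equiv {R : PtArt k p} (L L' : Lifting G F R) : Prop :=
  ∃ τ : L.Y.X ≅ L'.Y.X, (∀ r, L.Y.rmul r ≫ τ.hom = τ.hom ≫ L'.Y.rmul r) ∧
    ∀ i, τ.hom ≫ L'.q i = L.q i

/-- `b` exhibits the lifting `L'` to `S` as the base change `L ⊗_R S` of the lifting `L` to `R`
along `f : R ⟶ S`. -/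
structure IsBaseChangeHom {R S : PtArt k p} (f : R ⟶ S) (L : Lifting G F R) (L' : Lifting G F S)
    (b : L.Y.X ⟶ L'.Y.X) : Prop where
  tensor : IsTensor f.toAlgHom L.Y (L'.Y.orbit b)
  comp_q : ∀ i, b ≫ L'.q i = L.q i

/-- Base change of liftings of `F` exists along every morphism of `a_p`. -/
def HasBaseChange (G : D ⥤ PreShMod A) (F : Fin p → D) : Prop :=
  ∀ ⦃R S : PtArt k p⦄ (f : R ⟶ S) (L : Lifting G F R),
    ∃ (L' : Lifting G F S) (b : L.Y.X ⟶ L'.Y.X), IsBaseChangeHom f L L' b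

lemma Lifting.rmul_q {R : PtArt k p} (L : Lifting G F R) (r : R.carrier) (i : Fin p) :
    L.Y.rmul r ≫ L.q i = R.point i r • L.q i := by
  have := (L.isLifting.fiber i).balanced r 1
  simpa using this.symm

lemma Lifting.Equiv.refl {R : PtArt k p} (L : Lifting G F R) : L.Equiv L :=
  ⟨Iso.refl _, by simp, by simp⟩

lemma Lifting.Equiv.symm {R : PtArt k p} {L L' : Lifting G F R} : L.Equiv L' → L'.Equiv L := by
  rintro ⟨τ, h, hq⟩
  refine ⟨τ.symm, fun r => ?_, fun i => ?_⟩
  · rw [Iso.symm_hom, Iso.eq_inv_comp, ← reassoc_of% h r]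
    simp
  · rw [Iso.symm_hom, Iso.inv_comp_eq, hq]

lemma Lifting.Equiv.trans {R : PtArt k p} {L L' L'' : Lifting G F R} :
    L.Equiv L' → L'.Equiv L'' → L.Equiv L'' := by
  rintro ⟨τ, h, hq⟩ ⟨τ', h', hq'⟩
  refine ⟨τ ≪≫ τ', fun r => ?_, fun i => ?_⟩
  · rw [Iso.trans_hom, reassoc_of% h r, h' r, Category.assoc]
  · rw [Iso.trans_hom, Category.assoc, hq', hq]

instance Lifting.setoid (G : D ⥤ PreShMod A) (F : Fin p → D) (R : PtArt k p) :
    Setoid (Lifting G F R) where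
  r := Lifting.Equiv
  iseqv := ⟨Lifting.Equiv.refl, Lifting.Equiv.symm, Lifting.Equiv.trans⟩

/-- The comparison morphism between base changes of equivalent liftings. -/
lemma IsBaseChangeHom.exists_hom {R S : PtArt k p} {f : R ⟶ S} {L L₁ : Lifting G F R}
    {L' L₁' : Lifting G F S} {b : L.Y.X ⟶ L'.Y.X} {b₁ : L₁.Y.X ⟶ L₁'.Y.X}
    (h : IsBaseChangeHom f L L' b) (h₁ : IsBaseChangeHom f L₁ L₁' b₁)
    (τ : L.Y.X ⟶ L₁.Y.X) (hτ : ∀ r, L.Y.rmul r ≫ τ = τ ≫ L₁.Y.rmul r)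
    (hq : ∀ i, τ ≫ L₁.q i = L.q i) :
    ∃ σ : L'.Y.X ⟶ L₁'.Y.X, b ≫ σ = τ ≫ b₁ ∧
      (∀ s, L'.Y.rmul s ≫ σ = σ ≫ L₁'.Y.rmul s) ∧ ∀ i, σ ≫ L₁'.q i = L'.q i := by
  obtain ⟨σ, hσ, -⟩ := h.tensor.universal _ (L₁'.Y.orbit (τ ≫ b₁)) (fun r s => by
    simp only [RObj.orbit_apply, RObj.rmul_mul, Category.assoc]
    rw [← reassoc_of% h₁.tensor.equivariant r, reassoc_of% hτ r])
  simp only [RObj.orbit_apply, Category.assoc] at hσ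
  refine ⟨σ, ?_, fun s => h.tensor.hom_ext fun s' => ?_, fun i => h.tensor.hom_ext fun s => ?_⟩
  · simpa [RObj.rmul_one] using hσ 1
  · have := hσ (s' * s)
    simp only [RObj.rmul_mul, Category.assoc] at this
    simp only [RObj.orbit_apply, Category.assoc]
    rw [this, reassoc_of% hσ s']
  · simp only [RObj.orbit_apply, Category.assoc]
    rw [reassoc_of% hσ s, L₁'.rmul_q, L'.rmul_q, Linear.comp_smul, Linear.comp_smul,
      Linear.comp_smul, h₁.comp_q, h.comp_q, hq]

/-- Base change is unique up to equivalence. -/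
lemma IsBaseChangeHom.equiv {R S : PtArt k p} {f : R ⟶ S} {L L₁ : Lifting G F R}
    {L' L₁' : Lifting G F S} {b : L.Y.X ⟶ L'.Y.X} {b₁ : L₁.Y.X ⟶ L₁'.Y.X}
    (h : IsBaseChangeHom f L L' b) (h₁ : IsBaseChangeHom f L₁ L₁' b₁) (e : L.Equiv L₁) :
    L'.Equiv L₁' := by
  obtain ⟨τ, hτ, hq⟩ := e
  obtain ⟨τ', hτ', hq'⟩ := Lifting.Equiv.symm ⟨τ, hτ, hq⟩
  obtain ⟨σ, hb, hσ, hσq⟩ := h.exists_hom h₁ τ.hom hτ hq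
  obtain ⟨σ', hb', hσ', -⟩ := h₁.exists_hom h τ.inv
    (fun r => by rw [Iso.eq_inv_comp, ← reassoc_of% hτ r]; simp)
    (fun i => by rw [Iso.inv_comp_eq, hq])
  refine ⟨⟨σ, σ', h.tensor.hom_ext fun s => ?_, h₁.tensor.hom_ext fun s => ?_⟩, hσ, hσq⟩
  · simp only [RObj.orbit_apply, Category.assoc, Category.comp_id]
    rw [reassoc_of% hσ s, hσ' s, reassoc_of% hb, reassoc_of% hb']
    simp
  · simp only [RObj.orbit_apply, Category.assoc, Category.comp_id]
    rw [reassoc_of% hσ' s, hσ s, reassoc_of% hb', reassoc_of% hb]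
    simp

lemma IsBaseChangeHom.refl {R : PtArt k p} (L : Lifting G F R) :
    IsBaseChangeHom (𝟙 R) L L (𝟙 _) where
  tensor := IsTensor.refl L.Y
  comp_q _ := Category.id_comp _

lemma IsBaseChangeHom.trans {R S T : PtArt k p} {f : R ⟶ S} {g : S ⟶ T} {L : Lifting G F R}
    {L' : Lifting G F S} {L'' : Lifting G F T} {b : L.Y.X ⟶ L'.Y.X} {b' : L'.Y.X ⟶ L''.Y.X}
    (h : IsBaseChangeHom f L L' b) (h' : IsBaseChangeHom g L' L'' b') :
    IsBaseChangeHom (f ≫ g) L L'' (b ≫ b') where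
  tensor := h.tensor.trans h'.tensor
  comp_q i := by rw [Category.assoc, h'.comp_q, h.comp_q]

/-- The map on equivalence classes of liftings given by base change along `f`. -/
def baseChange (h : HasBaseChange G F) {R S : PtArt k p} (f : R ⟶ S) :
    Quotient (Lifting.setoid G F R) → Quotient (Lifting.setoid G F S) :=
  Quotient.map (fun L => (h f L).choose) fun L L₁ e =>
    (h f L).choose_spec.choose_spec.equiv (h f L₁).choose_spec.choose_spec e

lemma baseChange_mk (h : HasBaseChange G F) {R S : PtArt k p} {f : R ⟶ S} {L : Lifting G F R}
    {L' : Lifting G F S} {b : L.Y.X ⟶ L'.Y.X} (hb : IsBaseChangeHom f L L' b) :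
    baseChange h f ⟦L⟧ = ⟦L'⟧ :=
  Quotient.sound ((h f L).choose_spec.choose_spec.equiv hb (Lifting.Equiv.refl L))

/-- The noncommutative deformation functor of the family `F` in the category `D` (embedded by `G`
in a category of presheaves of modules): it sends `R` to the set of equivalence classes of liftings
of `F` to `R`, and a morphism of `a_p` to base change along it. -/
def Def (G : D ⥤ PreShMod A) (F : Fin p → D) (h : HasBaseChange G F) :
    PtArt k p ⥤ Type (max u u₂ v₂) where
  obj R := Quotient (Lifting.setoid G F R)
  map f := ↾(baseChange h f)
  map_id R := by
    ext x
    induction x using Quotient.inductionOn with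
    | h L => exact baseChange_mk h (IsBaseChangeHom.refl L)
  map_comp f g := by
    ext x
    induction x using Quotient.inductionOn with
    | h L =>
      obtain ⟨L', b, hb⟩ := h f L
      obtain ⟨L'', b', hb'⟩ := h g L'
      change baseChange h (f ≫ g) ⟦L⟧ = baseChange h g (baseChange h f ⟦L⟧)
      rw [baseChange_mk h (hb.trans hb'), baseChange_mk h hb, baseChange_mk h hb']

/-- The class of a lifting. -/
def Def.mk {h : HasBaseChange G F} {R : PtArt k p} (L : Lifting G F R) : (Def G F h).obj R :=
  Quotient.mk (Lifting.setoid G F R) L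

/-! The two categories of the comparison: quasi-coherent modules, embedded by `π`, and presheaves
of modules on a family of open subsets, embedded by the identity. -/

variable {X : TopCat.{u}} (B : TopCat.Sheaf (AlgCat.{u} k) X) (𝒰 : Set (Opens X))

/-- Liftings of a family of quasi-coherent modules in the category of quasi-coherent modules, as a
full subcategory of the category of presheaves of modules on `𝒰`. -/
abbrev LiftingQC (F : Fin p → QCoh B) (R : PtArt k p) :=
  Lifting (forgetQCoh B 𝒰) F R

/-- Base change exists for liftings of `F` in quasi-coherent modules. -/
abbrev HasBaseChangeQC (F : Fin p → QCoh B) : Prop :=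
  HasBaseChange (forgetQCoh B 𝒰) F

/-- The deformation functor of `F` as a family of quasi-coherent modules. -/
abbrev DefQC (F : Fin p → QCoh B) (h : HasBaseChangeQC B 𝒰 F) :=
  Def (forgetQCoh B 𝒰) F h

/-- Base change exists for liftings of `F` in presheaves of modules on `𝒰`. -/
abbrev HasBaseChangePSh (F : Fin p → QCoh B) : Prop :=
  HasBaseChange (𝟭 (PreShMod (resAlg B 𝒰))) (resFamily B 𝒰 F)

/-- The deformation functor of `F` as a family of presheaves of modules on `𝒰`. -/
abbrev DefPSh (F : Fin p → QCoh B) (h : HasBaseChangePSh B 𝒰 F) :=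
  Def (𝟭 (PreShMod (resAlg B 𝒰))) (resFamily B 𝒰 F) h

/-- The image under `π` of a lifting in quasi-coherent modules is a lifting in presheaves. -/
abbrev IsLiftingPSh {F : Fin p → QCoh B} {R : PtArt k p} (L : LiftingQC B 𝒰 F R) : Prop :=
  IsLifting (𝟭 (PreShMod (resAlg B 𝒰))) (resFamily B 𝒰 F) R (L.Y.map (forgetQCoh B 𝒰))
    (fun i => (forgetQCoh B 𝒰).map (L.q i))

end Deformation

end NCDef

end

noncomputable section

set_option linter.unusedSectionVars false

namespace NCDef

open Limits

/-! The functor `π` identifies `QCoh(A)` with the presheaves on `𝒰` whose restriction maps `Y(U) →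
Y(W)` are extensions of scalars along `A(U) → A(W)` (`IsExtPresheaf`). Once this is known, comparing
deformations amounts to showing that liftings and tensor products in presheaves stay inside this
subcategory.

The identification rests on maps into direct images. If `U` is affine and `H` is the direct image of
a sheaf on `U`, then maps to `H` from a quasi-coherent sheaf, and from an extension-of-scalars
presheaf when `𝒰` is good, are both given by linear maps of sections over `U`
(`IsAffineOpen.existsUnique_hom_direct`, `IsExtPresheaf.existsUnique_hom`). Direct images need not
be quasi-coherent, so the first of these requires maps from a quasi-coherent sheaf to an arbitrary
sheaf to be determined by global sections (`existsUnique_hom_of_isQuasicoherent`). It follows that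
quasi-coherent sheaves give extension-of-scalars presheaves (`isExtPresheaf_toPre`), and that the
left adjoint `gen` of the forgetful functor inverts `π` on them (`gen_restr`,
`isIso_counit_of_isQuasicoherent`).

For a lifting `Y` over `R`, the extension property passes from the fibers to `Y` by dévissage
(`IsLifting.isExtPresheaf`). The augmentation ideal is nilpotent, so any left ideal is reached from
`R` by finitely many steps with simple quotient some `k_i`. Matric freeness supplies the flatness
needed for a five-lemma argument at each step (`IsRelExt.step`). Hence every presheaf lifting comes
from a quasi-coherent one, and full faithfulness gives injectivity on equivalence classes.

Finally `R` is finite dimensional, so `Y ⊗_R S` is the cokernel of a map between finite powers of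
`Y`. In presheaves it exists and is computed sectionwise, which preserves matric freeness. It also
preserves the extension property (`IsTensor.isExtPresheaf`), so tensor products in `QCoh(A)` agree
with those in presheaves. This gives base change on both sides and naturality. -/

lemma exists_linearMap_of_surjective {B M N P : Type*} [Ring B] [AddCommGroup M] [Module B M]
    [AddCommGroup N] [Module B N] [AddCommGroup P] [Module B P] (p : M →ₗ[B] N)
    (hp : Function.Surjective p) (q : M →ₗ[B] P) (h : ∀ y, p y = 0 → q y = 0) :
    ∃ r : N →ₗ[B] P, ∀ y, r (p y) = q y :=
  ⟨(LinearMap.ker p).liftQ q (fun y hy => h y hy) ∘ₗ (p.quotKerEquivOfSurjective hp).symm,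
    fun y => by
      have : (p.quotKerEquivOfSurjective hp).symm (p y) = (LinearMap.ker p).mkQ y := by
        rw [LinearEquiv.symm_apply_eq]; rfl
      rw [LinearMap.comp_apply, LinearEquiv.coe_coe, this]; rfl⟩

/-! ### Maps out of quasi-coherent modules on an affine site. -/

section AffineSite

variable {C : Type u} [Category.{u} C] {J : GrothendieckTopology C} {R : Sheaf J RingCat.{u}}

/-- The section of a sheaf of modules determined by an element over a terminal object. -/
def sectionOf {T : C} (hT : IsTerminal T) (M : SheafOfModules.{u} R) (x : M.val.obj (op T)) :
    M.sections :=
  PresheafOfModules.sectionsMk (fun Y => M.val.map (hT.from Y.unop).op x) fun Y Z f => by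
    rw [← PresheafOfModules.map_comp_apply, ← op_comp_unop,
      hT.hom_ext (f.unop ≫ _) (hT.from Z.unop)]

lemma sectionOf_val {T : C} (hT : IsTerminal T) (M : SheafOfModules.{u} R)
    (x : M.val.obj (op T)) : (sectionOf hT M x).val (op T) = x := by
  change M.val.map (hT.from T).op x = x
  rw [hT.hom_ext (hT.from T) (𝟙 T), op_id, PresheafOfModules.map_id]
  rfl

lemma sections_ext {T : C} (hT : IsTerminal T) {M : SheafOfModules.{u} R} {s t : M.sections}
    (h : s.val (op T) = t.val (op T)) : s = t := by
  refine Subtype.ext (funext fun Y => ?_)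
  rw [← s.property (hT.from Y.unop).op, ← t.property (hT.from Y.unop).op, h]

variable [HasBinaryProducts C]
  [HasSheafify J AddCommGrpCat.{u}] [J.WEqualsLocallyBijective AddCommGrpCat.{u}]
  [∀ Y, HasSheafify (J.over Y) AddCommGrpCat.{u}]
  [∀ Y, (J.over Y).WEqualsLocallyBijective AddCommGrpCat.{u}]

open SheafOfModules

variable (R) in
/-- The standard generators of the sections of a free sheaf of modules. -/
def freeGen (T : C) {I : Type u} (i : I) : (free (R := R) I).val.obj (op T) :=
  (freeSection (R := R) i).val (op T)

lemma exists_freeHom {T : C} (hT : IsTerminal T) {I : Type u} (M : SheafOfModules.{u} R)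
    (x : I → M.val.obj (op T)) :
    ∃ f : free I ⟶ M, ∀ i, f.val.app (op T) (freeGen R T i) = x i :=
  ⟨M.freeHomEquiv.symm fun i => sectionOf hT M (x i), fun i =>
    (congrArg (fun s : M.sections => s.val (op T))
      (sectionsMap_freeHomEquiv_symm_freeSection (fun i => sectionOf hT M (x i)) i)).trans
      (sectionOf_val hT M (x i))⟩

lemma freeHom_ext {T : C} (hT : IsTerminal T) {I : Type u} {M : SheafOfModules.{u} R}
    {f g : free I ⟶ M}
    (h : ∀ i, f.val.app (op T) (freeGen R T i) = g.val.app (op T) (freeGen R T i)) : f = g :=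
  M.freeHomEquiv.injective (funext fun i => sections_ext hT (h i))

lemma isQuasicoherent_cokernel {I I' : Type u} {M : SheafOfModules.{u} R} (f : free I ⟶ free I')
    (g : free I' ⟶ M) (w : f ≫ g = 0) (h : IsColimit (CokernelCofork.ofπ g w)) :
    M.IsQuasicoherent :=
  (presentationOfIsCokernelFree f g w h).isQuasicoherent

variable (R) in
lemma isQuasicoherent_free (I : Type u) : (free (R := R) I).IsQuasicoherent :=
  isQuasicoherent_cokernel (0 : free I ⟶ free I) (𝟙 _) zero_comp
    (CokernelCofork.IsColimit.ofId _ rfl)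

variable (R) in
/-- Sections of quasi-coherent modules over an object. -/
abbrev qcSections (T : C) :
    (isQuasicoherent R).FullSubcategory ⥤ ModuleCat.{u} (R.obj.obj (op T)) :=
  (isQuasicoherent R).ι ⋙ SheafOfModules.evaluation.{u} R (op T)

/-- Sections of an infinite free sheaf are not obviously spanned by the standard generators. Since
`N` is itself the module of sections of a quasi-coherent sheaf, both maps come from sheaf maps out
of the free sheaf, and those are determined on generators. -/
lemma freeSections_hom_ext {T : C} (hT : IsTerminal T) (hE : (qcSections R T).IsEquivalence)
    {I : Type u} {N : ModuleCat.{u} (R.obj.obj (op T))}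
    {a b : (free (R := R) I).val.obj (op T) ⟶ N} (h : ∀ i, a (freeGen R T i) = b (freeGen R T i)) :
    a = b := by
  let e := (qcSections R T).objObjPreimageIso N
  let E : (isQuasicoherent R).FullSubcategory := ⟨free I, isQuasicoherent_free R I⟩
  obtain ⟨f, hf⟩ := (qcSections R T).map_surjective (X := E) (a ≫ e.inv)
  obtain ⟨g, hg⟩ := (qcSections R T).map_surjective (X := E) (b ≫ e.inv)
  have : f = g := by
    ext1
    refine freeHom_ext hT fun i => ?_
    have h1 := ConcreteCategory.congr_hom hf (freeGen R T i)
    have h2 := ConcreteCategory.congr_hom hg (freeGen R T i)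
    refine h1.trans (Eq.trans ?_ h2.symm)
    change e.inv (a _) = e.inv (b _)
    rw [h]
  exact (cancel_mono e.inv).mp (hf.symm.trans ((congrArg _ this).trans hg))

/-- Quasi-coherence is local, but affineness makes the presentation global: all sections over `T`
serve as generators and all elements of the kernel over `T` as relations. The cokernel is
quasi-coherent by construction, so its comparison with `E` can be inverted on sections over `T`. -/
lemma exists_cokernel {T : C} (hT : IsTerminal T) (hE : (qcSections R T).IsEquivalence)
    (E : SheafOfModules.{u} R) (hq : E.IsQuasicoherent) :
    ∃ (I I' : Type u) (f : free I ⟶ free I') (g : free I' ⟶ E) (w : f ≫ g = 0),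
      Nonempty (IsColimit (CokernelCofork.ofπ g w)) ∧
        (∀ x : E.val.obj (op T), ∃ i, g.val.app (op T) (freeGen R T i) = x) ∧
        ∀ (N : ModuleCat.{u} (R.obj.obj (op T))) (a : (free (R := R) I').val.obj (op T) ⟶ N),
          (∀ y, g.val.app (op T) y = 0 → a y = 0) →
            ∀ y, a (f.val.app (op T) y) = 0 := by
  obtain ⟨g, hg⟩ := exists_freeHom hT E (id : E.val.obj (op T) → E.val.obj (op T))
  obtain ⟨f, hf⟩ := exists_freeHom hT (free (R := R) (E.val.obj (op T)))
    (Subtype.val : {y // g.val.app (op T) y = 0} → _)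
  have w : f ≫ g = 0 := freeHom_ext hT fun i => by
    change g.val.app (op T) (f.val.app (op T) _) = 0
    rw [hf]
    exact i.2
  let Q := cokernel f
  have hQ : Q.IsQuasicoherent := isQuasicoherent_cokernel f (cokernel.π f) (cokernel.condition f)
    (cokernelIsCokernel f)
  let c : Q ⟶ E := cokernel.desc f g w
  have hc : IsIso c := by
    have hsurj : Function.Surjective (g.val.app (op T)).hom := fun x => ⟨_, hg x⟩
    -- Over `T` the map `g` is onto and the projection to the cokernel kills its kernel; the induced
    -- map `r` lifts to a sheaf map inverse to `c`.
    obtain ⟨r, hr⟩ := exists_linearMap_of_surjective (g.val.app (op T)).hom hsurj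
      ((cokernel.π f).val.app (op T)).hom fun y hy => by
        have h0 : (f ≫ cokernel.π f).val.app (op T) (freeGen R T ⟨y, hy⟩) = 0 := by
          rw [cokernel.condition]; rfl
        change (cokernel.π f).val.app (op T) (f.val.app (op T) _) = 0 at h0
        rwa [hf] at h0
    obtain ⟨d, hd⟩ := (qcSections R T).map_surjective
      (X := ⟨E, hq⟩) (Y := ⟨Q, hQ⟩) (ModuleCat.ofHom r)
    have hd' : ∀ y, d.hom.val.app (op T) y = r y := fun y => ConcreteCategory.congr_hom hd y
    have hgd : g ≫ d.hom = cokernel.π f := freeHom_ext hT fun i => by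
      change d.hom.val.app (op T) (g.val.app (op T) _) = _
      rw [hd']
      exact hr _
    refine ⟨d.hom, ?_, ?_⟩
    · rw [← cancel_epi (cokernel.π f), cokernel.π_desc_assoc, hgd, Category.comp_id]
    · have h1 : d ≫ (ObjectProperty.homMk c : (⟨Q, hQ⟩ : (isQuasicoherent R).FullSubcategory) ⟶
          ⟨E, hq⟩) = 𝟙 _ := (qcSections R T).map_injective (by
        ext y
        obtain ⟨z, rfl⟩ := hsurj y
        change (g ≫ d.hom ≫ c).val.app (op T) z = g.val.app (op T) z
        rw [reassoc_of% hgd, cokernel.π_desc])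
      exact congrArg (fun z => z.hom) h1
  refine ⟨_, _, f, g, w, ⟨?_⟩, fun x => ⟨x, hg x⟩, fun N a ha => ?_⟩
  · exact IsColimit.ofIsoColimit (cokernelIsCokernel f)
      (Cofork.ext (asIso c) (cokernel.π_desc f g w))
  · suffices h : f.val.app (op T) ≫ a = 0 from fun y => ConcreteCategory.congr_hom h y
    refine freeSections_hom_ext hT hE fun i => ?_
    change a (f.val.app (op T) _) = 0
    rw [hf]
    exact ha _ i.2

/-- If taking sections over a terminal object is an equivalence on quasi-coherent modules, then
morphisms from a quasi-coherent module to an arbitrary sheaf of modules are given by their effect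
on global sections. -/
theorem existsUnique_hom_of_isQuasicoherent {T : C} (hT : IsTerminal T)
    (hE : (qcSections R T).IsEquivalence) (E : SheafOfModules.{u} R) (hq : E.IsQuasicoherent)
    (G : SheafOfModules.{u} R) (φ : E.val.obj (op T) ⟶ G.val.obj (op T)) :
    ∃! f : E ⟶ G, ∀ x, f.val.app (op T) x = φ x := by
  obtain ⟨I, I', f, g, w, ⟨hc⟩, hsurj, hker⟩ := exists_cokernel hT hE E hq
  obtain ⟨h, hh⟩ := exists_freeHom hT (I := I') G
    (fun i => φ (g.val.app (op T) (freeGen R T i)))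
  -- Agreement on generators spreads to all sections over `T`. Hence `h` kills what `g` kills there,
  -- in particular the relations, and so factors through `E`.
  have hφ : g.val.app (op T) ≫ φ = h.val.app (op T) :=
    freeSections_hom_ext hT hE fun i => (hh i).symm
  have hφ' : ∀ y, h.val.app (op T) y = φ (g.val.app (op T) y) := fun y =>
    (ConcreteCategory.congr_hom hφ y).symm
  have hfh : f ≫ h = 0 := freeHom_ext hT fun i =>
    hker _ (h.val.app (op T)) (fun y hy => by rw [hφ', hy, map_zero]) _
  refine ⟨hc.desc (CokernelCofork.ofπ h hfh), fun x => ?_, fun d hd => ?_⟩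
  · obtain ⟨i, rfl⟩ := hsurj x
    refine Eq.trans ?_ (hh i)
    exact congrArg (fun z : _ ⟶ G => z.val.app (op T) (freeGen R T i))
      (hc.fac (CokernelCofork.ofπ h hfh) WalkingParallelPair.one)
  · refine Cofork.IsColimit.hom_ext hc ?_
    refine Eq.trans ?_ (hc.fac (CokernelCofork.ofπ h hfh) WalkingParallelPair.one).symm
    refine freeHom_ext hT fun i => ?_
    change d.val.app (op T) (g.val.app (op T) _) = h.val.app (op T) _
    rw [hd, hh]

end AffineSite

/-! ### Extension of scalars by its universal property. -/

section ExtensionOfScalars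

variable {A B B' : Type u} [Ring A] [Ring B] [Ring B']
  {M M' : Type u} [AddCommGroup M] [Module A M] [AddCommGroup M'] [Module B M']

/-- The semilinear map `m` exhibits `M'` as the extension of scalars of `M`. -/
def IsExt {ρ : A →+* B} (m : M →ₛₗ[ρ] M') : Prop :=
  ∀ (N : Type u) [AddCommGroup N] [Module B N] (φ : M →ₛₗ[ρ] N),
    ∃! ψ : M' →ₗ[B] N, ∀ x, ψ (m x) = φ x

lemma IsExt.hom_ext {ρ : A →+* B} {m : M →ₛₗ[ρ] M'} (h : IsExt m) {N : Type u} [AddCommGroup N]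
    [Module B N] {ψ ψ' : M' →ₗ[B] N} (e : ∀ x, ψ (m x) = ψ' (m x)) : ψ = ψ' :=
  (h N (ψ'.comp m)).unique e fun _ => rfl

/-- Restricting the scalars of `N` along `σ` turns semilinear maps into `B`-linear ones. -/
lemma IsExt.hom_ext' {ρ : A →+* B} {m : M →ₛₗ[ρ] M'} (h : IsExt m) {σ : B →+* B'} {N : Type u}
    [AddCommGroup N] [Module B' N] {ψ ψ' : M' →ₛₗ[σ] N} (e : ∀ x, ψ (m x) = ψ' (m x)) :
    ψ = ψ' := by
  let : Module B N := Module.compHom N σ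
  let f : M' →ₗ[B] N :=
    { toFun := ψ, map_add' := ψ.map_add, map_smul' := fun b y => ψ.map_smulₛₗ b y }
  let f' : M' →ₗ[B] N :=
    { toFun := ψ', map_add' := ψ'.map_add, map_smul' := fun b y => ψ'.map_smulₛₗ b y }
  have : f = f' := h.hom_ext e
  ext y
  exact congrArg (fun g => g y) this

end ExtensionOfScalars

section PresheafExt

variable {C : Type u₁} [Category.{v₁} C] {R : Cᵒᵖ ⥤ RingCat.{u}}

/-- The restriction maps of a presheaf of modules as semilinear maps. -/
def resMap (M : PresheafOfModules.{u} R) {c d : Cᵒᵖ} (f : c ⟶ d) :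
    M.obj c →ₛₗ[(R.map f).hom] M.obj d where
  toFun := M.map f
  map_add' := map_add (M.map f).hom
  map_smul' := M.map_smul f

lemma resMap_apply (M : PresheafOfModules.{u} R) {c d : Cᵒᵖ} (f : c ⟶ d) (x : M.obj c) :
    resMap M f x = M.map f x := rfl

lemma resMap_comp (M : PresheafOfModules.{u} R) {c d e : Cᵒᵖ} (f : c ⟶ d) (g : d ⟶ e)
    (x : M.obj c) : resMap M (f ≫ g) x = resMap M g (resMap M f x) :=
  M.map_comp_apply f g x

lemma resMap_id (M : PresheafOfModules.{u} R) {c : Cᵒᵖ} (x : M.obj c) :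
    resMap M (𝟙 c) x = x := by
  rw [resMap_apply, M.map_id]; rfl

lemma resMap_naturality {M N : PresheafOfModules.{u} R} (φ : M ⟶ N) {c d : Cᵒᵖ} (f : c ⟶ d)
    (x : M.obj c) : φ.app d (resMap M f x) = resMap N f (φ.app c x) :=
  PresheafOfModules.naturality_apply φ f x

lemma bijective_resMap_of_isIso (M : PresheafOfModules.{u} R) {c d : Cᵒᵖ} (f : c ⟶ d) [IsIso f] :
    Function.Bijective (resMap M f) :=
  Function.bijective_iff_has_inverse.mpr ⟨resMap M (inv f),
    fun x => by rw [← resMap_comp, IsIso.hom_inv_id, resMap_id],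
    fun x => by rw [← resMap_comp, IsIso.inv_hom_id, resMap_id]⟩

/-- A presheaf of modules all of whose restriction maps are extensions of scalars. -/
def IsExtPresheaf (M : PresheafOfModules.{u} R) : Prop :=
  ∀ ⦃c d : Cᵒᵖ⦄ (f : c ⟶ d), IsExt (resMap M f)

end PresheafExt

/-! ### Gluing, and maps from presheaves on the cover into direct images. -/

section Glue

variable {k : Type u} [Field k] {X : TopCat.{u}} (A : TopCat.Sheaf (AlgCat.{u} k) X)

/-- The restriction of a sheaf of modules from one open subset to a smaller one. -/
abbrev res (H : ShMod A) {V W : Opens X} (h : W ≤ V) :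
    H.val.obj (op V) →ₛₗ[((ringSheaf A).obj.map (homOfLE h).op).hom] H.val.obj (op W) :=
  resMap H.val (homOfLE h).op

variable {A}

lemma res_res (H : ShMod A) {V W W' : Opens X} (h : W ≤ V) (h' : W' ≤ W)
    (x : H.val.obj (op V)) : res A H h' (res A H h x) = res A H (h'.trans h) x :=
  (resMap_comp H.val _ _ x).symm

/-- A sheaf of modules which is the direct image of a sheaf of modules on the open subset `U`. -/
def IsDirectImage (U : Opens X) (H : ShMod A) : Prop :=
  ∀ V : Opens X, Function.Bijective (res A H (inf_le_left : V ⊓ U ≤ V))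

/-- Overlaps need not belong to the family, so compatibility is only tested on members covering
them; agreement on a whole overlap then follows because sections that agree locally are equal. -/
lemma existsUnique_glue (H : ShMod A) {ι : Type u} (V : Opens X) (W : ι → Opens X)
    (hW : ∀ i, W i ≤ V) (hcov : ∀ x ∈ V, ∃ i, x ∈ W i) (t : ∀ i, H.val.obj (op (W i)))
    (ht : ∀ i j, ∀ x ∈ W i ⊓ W j, ∃ (l : ι) (hi : W l ≤ W i) (hj : W l ≤ W j), x ∈ W l ∧
      res A H hi (t i) = t l ∧ res A H hj (t j) = t l) :
    ∃! s : H.val.obj (op V), ∀ i, res A H (hW i) s = t i := by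
  let F : TopCat.Sheaf AddCommGrpCat.{u} X := ⟨H.val.presheaf, H.isSheaf⟩
  refine F.existsUnique_gluing' W V (fun i => homOfLE (hW i))
    (fun x hx => by simpa using hcov x hx) t fun i j => ?_
  let K := {l : ι // W l ≤ W i ∧ W l ≤ W j ∧ ∀ (hi : W l ≤ W i) (hj : W l ≤ W j),
    res A H hi (t i) = t l ∧ res A H hj (t j) = t l}
  refine F.eq_of_locally_eq' (fun l : K => W l.1) (W i ⊓ W j)
    (fun l => homOfLE (le_inf l.2.1 l.2.2.1)) (fun x hx => ?_) _ _ fun l => ?_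
  · obtain ⟨l, hi, hj, hxl, h1, h2⟩ := ht i j x hx
    exact Opens.mem_iSup.mpr ⟨⟨l, hi, hj, fun _ _ => ⟨h1, h2⟩⟩, hxl⟩
  · have h1 := res_res H (inf_le_left : W i ⊓ W j ≤ W i) (le_inf l.2.1 l.2.2.1) (t i)
    have h2 := res_res H (inf_le_right : W i ⊓ W j ≤ W j) (le_inf l.2.1 l.2.2.1) (t j)
    obtain ⟨h3, h4⟩ := l.2.2.2 l.2.1 l.2.2.1
    exact (h1.trans h3).trans (h2.trans h4).symm

variable {𝒰 : Set (Opens X)}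

lemma IsGood.exists_mem (hgood : IsGood 𝒰) {U V : Opens X} (hU : U ∈ 𝒰) (hV : V ∈ 𝒰) {x : X}
    (hx : x ∈ U ⊓ V) : ∃ W ∈ 𝒰, x ∈ W ∧ W ≤ U ∧ W ≤ V := by
  classical
  obtain ⟨W, hW, hxW, hle⟩ := hgood {U, V} (by simp) (by
    intro Z; simp only [Finset.coe_insert, Finset.coe_singleton, Set.mem_insert_iff,
      Set.mem_singleton_iff]; rintro (rfl | rfl) <;> assumption) x (by simpa using hx)
  simp only [Finset.inf_insert, Finset.inf_singleton, id, le_inf_iff] at hle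
  exact ⟨W, hW, hxW, hle⟩

/-- Sections over `V ∈ 𝒰` of a direct image from `U ∈ 𝒰` are glued from sections over the members
of `𝒰` contained in both. -/
lemma IsDirectImage.existsUnique_glue (hgood : IsGood 𝒰) {U V : Opens X} (hU : U ∈ 𝒰) (hV : V ∈ 𝒰)
    {H : ShMod A} (hH : IsDirectImage U H) (t : ∀ W ∈ 𝒰, W ≤ U → W ≤ V → H.val.obj (op W))
    (ht : ∀ W W' (hW : W ∈ 𝒰) (hW' : W' ∈ 𝒰) (hU : W ≤ U) (hV : W ≤ V) (h : W' ≤ W),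
      res A H h (t W hW hU hV) = t W' hW' (h.trans hU) (h.trans hV)) :
    ∃! s : H.val.obj (op V), ∀ W (hW : W ∈ 𝒰) (hU : W ≤ U) (hV : W ≤ V),
      res A H hV s = t W hW hU hV := by
  let ι := {W : Opens X // W ∈ 𝒰 ∧ W ≤ U ∧ W ≤ V}
  obtain ⟨s, hs, hsu⟩ := NCDef.existsUnique_glue H (V ⊓ U) (fun i : ι => i.1)
    (fun i => le_inf i.2.2.2 i.2.2.1)
    (fun x hx => by
      obtain ⟨W, hW, hxW, h1, h2⟩ := hgood.exists_mem hV hU hx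
      exact ⟨⟨W, hW, h2, h1⟩, hxW⟩)
    (fun i => t i.1 i.2.1 i.2.2.1 i.2.2.2)
    (fun i j x hx => by
      obtain ⟨W, hW, hxW, h1, h2⟩ := hgood.exists_mem i.2.1 j.2.1 hx
      exact ⟨⟨W, hW, h1.trans i.2.2.1, h1.trans i.2.2.2⟩, h1, h2, hxW, ht _ _ _ _ _ _ _,
        ht _ _ _ _ _ _ _⟩)
  obtain ⟨s', rfl⟩ := (hH V).2 s
  refine ⟨s', fun W hW hU hV => ?_, fun s'' hs'' => (hH V).1 (hsu _ fun i => ?_)⟩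
  · rw [← hs ⟨W, hW, hU, hV⟩, res_res]
  · rw [res_res]
    exact hs'' _ i.2.1 i.2.2.1 i.2.2.2

variable (A 𝒰) in
/-- The functor from sheaves of modules to presheaves of modules on a family of open subsets. -/
abbrev toPre : ShMod A ⥤ PreShMod (resAlg A 𝒰) := forgetSh A ⋙ resPreSh A 𝒰

/-- An object of the category attached to a family of open subsets. -/
abbrev mem {U : Opens X} (hU : U ∈ 𝒰) : (coverCat 𝒰)ᵒᵖ := op ⟨U, hU⟩

/-- The morphism between members of a family of open subsets given by an inclusion. -/
abbrev incl {U W : Opens X} (hU : U ∈ 𝒰) (hW : W ∈ 𝒰) (h : W ≤ U) :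
    (mem hU : (coverCat 𝒰)ᵒᵖ) ⟶ mem hW := (ObjectProperty.homMk (homOfLE h)).op

/-- Maps from an extension-of-scalars presheaf to a direct image from `U` are determined by their
effect over `U`. -/
theorem IsExtPresheaf.existsUnique_hom (hgood : IsGood 𝒰) {Y : PreShMod (resAlg A 𝒰)}
    (hY : IsExtPresheaf Y) {U : Opens X} (hU : U ∈ 𝒰) {H : ShMod A} (hH : IsDirectImage U H)
    (φ : Y.obj (mem hU) →ₗ[(resAlg A 𝒰 ⋙ forget₂ (AlgCat.{u} k) RingCat.{u}).obj (mem hU)]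
      ((toPre A 𝒰).obj H).obj (mem hU)) :
    ∃! f : Y ⟶ (toPre A 𝒰).obj H, ∀ x, f.app (mem hU) x = φ x := by
  let PH := (toPre A 𝒰).obj H
  -- Below `U` the component is forced: `Y(W)` is the extension of scalars of `Y(U)`.
  have key : ∀ W (hW : W ∈ 𝒰) (h : W ≤ U), ∃! ψ : Y.obj (mem hW) →ₗ[_] PH.obj (mem hW),
      ∀ x, ψ (resMap Y (incl hU hW h) x) = resMap PH (incl hU hW h) (φ x) := fun W hW h =>
    hY (incl hU hW h) _ ((resMap PH (incl hU hW h)).comp φ)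
  choose ψ hψ hψu using key
  have hψres : ∀ W W' (hW : W ∈ 𝒰) (hW' : W' ∈ 𝒰) (hU : W ≤ U) (h : W' ≤ W) (y : Y.obj (mem hW)),
      resMap PH (incl hW hW' h) (ψ W hW hU y) =
        ψ W' hW' (h.trans hU) (resMap Y (incl hW hW' h) y) := by
    intro W W' hW hW' hWU h y
    have := (hY (incl hU hW hWU)).hom_ext'
      (ψ := (resMap PH (incl hW hW' h)).comp (ψ W hW hWU))
      (ψ' := (ψ W' hW' (h.trans hWU)).comp (resMap Y (incl hW hW' h))) fun x => by
        change resMap PH (incl hW hW' h) (ψ W hW hWU (resMap Y _ x)) =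
          ψ W' hW' (h.trans hWU) (resMap Y (incl hW hW' h) (resMap Y _ x))
        rw [hψ, ← resMap_comp, ← resMap_comp]
        exact (hψ W' hW' (h.trans hWU) x).symm
    exact congrArg (fun g => g y) this
  -- Over a general `V` the target is `H(V ⊓ U)`, whose sections are glued from members of `𝒰` below
  -- both `U` and `V`; this is where goodness enters.
  have glue : ∀ V (hV : V ∈ 𝒰) (y : Y.obj (mem hV)), ∃! s : PH.obj (mem hV),
      ∀ W (hW : W ∈ 𝒰) (hU : W ≤ U) (hV' : W ≤ V),
        resMap PH (incl hV hW hV') s = ψ W hW hU (resMap Y (incl hV hW hV') y) := by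
    intro V hV y
    refine hH.existsUnique_glue hgood hU hV
      (fun W hW hU hV' => ψ W hW hU (resMap Y (incl hV hW hV') y)) ?_
    intro W W' hW hW' hU hV' h
    refine (hψres W W' hW hW' hU h _).trans ?_
    rw [← resMap_comp]
    rfl
  choose g hg hgu using glue
  have gU : ∀ y, g U hU y = φ y := fun y => (hgu U hU y _ fun W hW h _ => (hψ W hW h y).symm).symm
  let f : Y ⟶ PH :=
    { app := fun c => ModuleCat.ofHom
        { toFun := fun y => g c.unop.1 c.unop.2 y
          map_add' := fun y y' => by
            refine (hgu _ c.unop.2 (y + y') _ fun W hW h h' => ?_).symm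
            refine ((resMap PH (incl c.unop.2 hW h')).map_add _ _).trans ?_
            refine Eq.trans ?_ (congrArg (ψ W hW h)
              ((resMap Y (incl c.unop.2 hW h')).map_add y y')).symm
            refine Eq.trans ?_ ((ψ W hW h).map_add _ _).symm
            exact congrArg₂ (· + ·) (hg _ _ _ _ _ _ _) (hg _ _ _ _ _ _ _)
          map_smul' := fun a y => by
            refine (hgu _ c.unop.2 (a • y) _ fun W hW h h' => ?_).symm
            refine ((resMap PH (incl c.unop.2 hW h')).map_smulₛₗ a _).trans ?_
            refine Eq.trans ?_ (congrArg (ψ W hW h)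
              ((resMap Y (incl c.unop.2 hW h')).map_smulₛₗ a y)).symm
            refine Eq.trans ?_ ((ψ W hW h).map_smul _ _).symm
            exact congrArg (_ • ·) (hg _ _ _ _ _ _ _) }
      naturality := fun {c d} i => by
        ext y
        refine (hgu _ d.unop.2 (resMap Y i y) (resMap PH i (g c.unop.1 c.unop.2 y))
          fun W hW h h' => ?_).symm
        rw [← resMap_comp, ← resMap_comp]
        exact hg _ _ _ _ _ _ _ }
  refine ⟨f, gU, fun f' hf' => ?_⟩
  ext c y
  refine hgu c.unop.1 c.unop.2 y _ fun W hW h h' => ?_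
  have := hψu W hW h (f'.app (mem hW)).hom fun x => by
    refine (resMap_naturality f' (incl hU hW h) x).trans ?_
    exact congrArg _ (hf' x)
  rw [← this]
  exact (resMap_naturality f' (incl c.unop.2 hW h') y).symm

end Glue

lemma isIso_of_bijective {C : Type u₁} [Category.{v₁} C] {J : GrothendieckTopology C}
    {R : Sheaf J RingCat.{u}} {F G : SheafOfModules.{u} R} (f : F ⟶ G)
    (h : ∀ c, Function.Bijective (f.val.app c)) : IsIso f := by
  have : IsIso ((PresheafOfModules.toPresheaf _).map f.val) := by
    rw [NatTrans.isIso_iff_isIso_app]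
    intro c
    rw [ConcreteCategory.isIso_iff_bijective]
    exact h c
  have : IsIso ((SheafOfModules.forget R).map f) :=
    isIso_of_reflects_iso f.val (PresheafOfModules.toPresheaf _)
  exact isIso_of_reflects_iso f (SheafOfModules.forget R)

lemma bijective_of_isIso {C : Type u₁} [Category.{v₁} C] {R : Cᵒᵖ ⥤ RingCat.{u}}
    {F G : PresheafOfModules.{u} R} (f : F ⟶ G) [IsIso f] (c : Cᵒᵖ) :
    Function.Bijective (f.app c) :=
  (ConcreteCategory.isIso_iff_bijective ((PresheafOfModules.evaluation R c).map f)).mp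
    inferInstance

/-! ### Direct images from an open subset and their adjunction with restriction. -/

section DirectImage

variable {k : Type u} [Field k] {X : TopCat.{u}} {A : TopCat.Sheaf (AlgCat.{u} k) X}

/-- Sheaves of modules on an open subset. -/
abbrev ShOn (A : TopCat.Sheaf (AlgCat.{u} k) X) (U : Opens X) :=
  SheafOfModules.{u} ((ringSheaf A).over U)

variable (A) in
/-- Restriction of sheaves of modules to an open subset. -/
abbrev restr (U : Opens X) : ShMod A ⥤ ShOn A U := SheafOfModules.overFunctor (ringSheaf A) U

variable (A) in
/-- Direct image of sheaves of modules from an open subset. -/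
abbrev direct (U : Opens X) : ShOn A U ⥤ ShMod A :=
  SheafOfModules.pushforward (SheafOfModules.pushforwardOver U)

variable (A) in
/-- Restriction is left adjoint to direct image. -/
def restrAdj (U : Opens X) : restr A U ⊣ direct A U := SheafOfModules.overPushforwardOverAdj U

/-- The open subset `U` as a terminal object of its site of open subsets. -/
abbrev topOver (U : Opens X) : (Over U)ᵒᵖ := op (Over.mk (𝟙 U))

lemma over_hom_ext {U : Opens X} {Y Z : Over U} (f g : Y ⟶ Z) : f = g :=
  Over.OverMorphism.ext (Subsingleton.elim _ _)

lemma over_isIso {U : Opens X} {Y Z : Over U} (f : Y ⟶ Z) (g : Z ⟶ Y) : IsIso f :=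
  ⟨g, over_hom_ext _ _, over_hom_ext _ _⟩

lemma star_left_le (U V : Opens X) : ((Over.star U).obj V).left ≤ V :=
  leOfHom ((Over.forgetAdjStar U).counit.app V)

/-- The sections over `V` are those of `G` over `(Over.star U).obj V`, and this object does not
change, up to isomorphism, when `V` is replaced by `V ⊓ U`. -/
lemma isDirectImage_direct (U : Opens X) (G : ShOn A U) : IsDirectImage U ((direct A U).obj G) := by
  intro V
  have : IsIso ((Over.star U).map (homOfLE (inf_le_left : V ⊓ U ≤ V))) :=
    over_isIso _ ((Over.forgetAdjStar U).homEquiv _ _ (homOfLE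
      (le_inf (star_left_le U V) (leOfHom ((Over.star U).obj V).hom))))
  exact bijective_resMap_of_isIso G.val ((Over.star U).map (homOfLE inf_le_left)).op

/-- The comparison between the sections over `U` of the direct image of `G` from `U` and of `G`. -/
def directTop (U : Opens X) (G : ShOn A U) :
    ((restr A U).obj ((direct A U).obj G)).val.obj (topOver U) ⟶ G.val.obj (topOver U) :=
  ((restrAdj A U).counit.app G).val.app (topOver U)

lemma bijective_directTop (U : Opens X) (G : ShOn A U) : Function.Bijective (directTop U G) := by
  have : IsIso ((Over.forgetAdjStar U).unit.app (Over.mk (𝟙 U))) :=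
    over_isIso _ (Over.homMk ((Over.star U).obj U).hom)
  exact bijective_resMap_of_isIso G.val ((Over.forgetAdjStar U).unit.app (Over.mk (𝟙 U))).op

/-- Over `V` the unit is restriction along the counit of `Over.forgetAdjStar U`, which is the
inclusion `V ⊓ U ≤ V` up to isomorphism. -/
lemma IsDirectImage.isIso_unit {U : Opens X} {H : ShMod A} (hH : IsDirectImage U H) :
    IsIso ((restrAdj A U).unit.app H) := by
  refine isIso_of_bijective _ fun V => ?_
  let e : V.unop ⊓ U ⟶ ((Over.star U).obj V.unop).left := homOfLE <| leOfHom
    ((Over.forgetAdjStar U).homEquiv (Over.mk (homOfLE (inf_le_right : V.unop ⊓ U ≤ U))) V.unop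
      (homOfLE inf_le_left)).left
  have he : IsIso e := ⟨homOfLE (le_inf (star_left_le U V.unop)
    (leOfHom ((Over.star U).obj V.unop).hom)), Subsingleton.elim _ _, Subsingleton.elim _ _⟩
  have h1 := hH V.unop
  have h2 : ∀ x, res A H (inf_le_left : V.unop ⊓ U ≤ V.unop) x =
      resMap H.val e.op (resMap H.val ((Over.forgetAdjStar U).counit.app V.unop).op x) := fun x =>
    resMap_comp H.val _ _ x
  have h3 := bijective_resMap_of_isIso H.val e.op
  have h4 : Function.Bijective (resMap H.val ((Over.forgetAdjStar U).counit.app V.unop).op) := by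
    refine (Function.Bijective.of_comp_iff' h3 _).mp ?_
    have h5 : ⇑(resMap H.val e.op) ∘ ⇑(resMap H.val ((Over.forgetAdjStar U).counit.app V.unop).op) =
        res A H (inf_le_left : V.unop ⊓ U ≤ V.unop) := (funext h2).symm
    rw [h5]
    exact h1
  exact h4

/-- Since `H` is the direct image of its restriction, this is the adjunction bijection composed with
the invertible unit. -/
lemma IsDirectImage.bijective_map {U : Opens X} {H : ShMod A} (hH : IsDirectImage U H)
    (F : ShMod A) : Function.Bijective ((restr A U).map : (F ⟶ H) → _) := by
  have := hH.isIso_unit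
  have h : ∀ f : F ⟶ H, (restr A U).map f =
      ((restrAdj A U).homEquiv _ _).symm (f ≫ (restrAdj A U).unit.app H) := fun f => by
    refine ((Equiv.symm_apply_eq _).mpr ?_).symm
    rw [Adjunction.homEquiv_unit]
    exact (restrAdj A U).unit.naturality f
  rw [funext h]
  refine ((restrAdj A U).homEquiv _ _).symm.bijective.comp ⟨fun f g hfg => ?_, fun g => ?_⟩
  · exact (cancel_mono _).mp hfg
  · exact ⟨g ≫ inv ((restrAdj A U).unit.app H), by simp⟩

lemma IsDirectImage.of_le {U W : Opens X} (h : W ≤ U) {H : ShMod A} (hH : IsDirectImage W H) :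
    IsDirectImage U H := by
  intro V
  have h1 := hH V
  have h2 := hH (V ⊓ U)
  have hle : V ⊓ U ⊓ W = V ⊓ W := by rw [inf_assoc, inf_eq_right.mpr h]
  let e : V ⊓ U ⊓ W ⟶ V ⊓ W := eqToHom hle
  have h3 := bijective_resMap_of_isIso H.val e.op
  have h4 : (res A H (inf_le_left : V ⊓ U ⊓ W ≤ V ⊓ U)) ∘ (res A H (inf_le_left : V ⊓ U ≤ V)) =
      resMap H.val e.op ∘ (res A H (inf_le_left : V ⊓ W ≤ V)) := by
    funext x
    exact (res_res H _ _ x).trans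
      (resMap_comp H.val (homOfLE (inf_le_left : V ⊓ W ≤ V)).op e.op x)
  refine (Function.Bijective.of_comp_iff' h2 _).mp ?_
  rw [h4]
  exact h3.comp h1

lemma IsDirectImage.bijective_res {U W : Opens X} (h : W ≤ U) {H : ShMod A}
    (hH : IsDirectImage W H) : Function.Bijective (res A H h) := by
  let e : U ⊓ W ⟶ W := homOfLE inf_le_right
  have he : IsIso e := ⟨homOfLE (le_inf h le_rfl), Subsingleton.elim _ _, Subsingleton.elim _ _⟩
  refine (Function.Bijective.of_comp_iff' (bijective_resMap_of_isIso H.val e.op) _).mp ?_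
  convert hH U using 1
  funext x
  exact (resMap_comp H.val _ _ x).symm

end DirectImage

lemma exists_linearMap_lift {A B : Type u} [Ring A] [Ring B] {ρ : A →+* B} {M P N : Type u}
    [AddCommGroup M] [Module A M] [AddCommGroup P] [Module A P] [AddCommGroup N] [Module B N]
    (θ : P →ₛₗ[ρ] N) (hθ : Function.Bijective θ) (φ : M →ₛₗ[ρ] N) :
    ∃ φ' : M →ₗ[A] P, ∀ x, θ (φ' x) = φ x := by
  choose g hg using fun x => hθ.2 (φ x)
  refine ⟨{ toFun := g, map_add' := fun x y => hθ.1 ?_, map_smul' := fun a x => hθ.1 ?_ }, hg⟩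
  · rw [map_add, hg, hg, hg, map_add]
  · rw [RingHom.id_apply, map_smulₛₗ, hg, hg, map_smulₛₗ]

lemma bijective_iso_hom {B : Type u} [Ring B] {M N : ModuleCat.{u} B} (e : M ≅ N) :
    Function.Bijective e.hom :=
  (ConcreteCategory.isIso_iff_bijective e.hom).mp inferInstance

/-! ### Quasi-coherent modules and extension of scalars on an affine family. -/

section QuasiCoherent

variable {k : Type u} [Field k] {X : TopCat.{u}} {A : TopCat.Sheaf (AlgCat.{u} k) X}

lemma IsAffineOpen.existsUnique_hom {U : Opens X} (hU : IsAffineOpen A U) (E : ShOn A U)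
    (hE : E.IsQuasicoherent) (G : ShOn A U)
    (φ : E.val.obj (topOver U) →ₗ[((ringSheaf A).over U).obj.obj (topOver U)]
      G.val.obj (topOver U)) :
    ∃! f : E ⟶ G, ∀ x, f.val.app (topOver U) x = φ x :=
  existsUnique_hom_of_isQuasicoherent Over.mkIdTerminal hU.isEquivalence E hE G
    (ModuleCat.ofHom φ)

lemma IsAffineOpen.exists_module {U : Opens X} (hU : IsAffineOpen A U)
    (N : ModuleCat.{u} (((ringSheaf A).over U).obj.obj (topOver U))) :
    ∃ (G : ShOn A U), G.IsQuasicoherent ∧ Nonempty (G.val.obj (topOver U) ≅ N) := by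
  have := hU.isEquivalence
  exact ⟨((sectionsFunctor A U).objPreimage N).obj, ((sectionsFunctor A U).objPreimage N).property,
    ⟨(sectionsFunctor A U).objObjPreimageIso N⟩⟩

lemma isQuasicoherent_restr (F : ShMod A) (hF : F.IsQuasicoherent) (U : Opens X) :
    ((restr A U).obj F).IsQuasicoherent :=
  SheafOfModules.isQuasicoherent_over F U

/-- Maps from a quasi-coherent module to a direct image from an affine open subset `U` are
determined by their effect over `U`. -/
lemma IsAffineOpen.existsUnique_hom_direct {U : Opens X} (hU : IsAffineOpen A U) (F : ShMod A)
    (hF : F.IsQuasicoherent) {H : ShMod A} (hH : IsDirectImage U H)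
    (φ : F.val.obj (op U) →ₗ[(ringSheaf A).obj.obj (op U)] H.val.obj (op U)) :
    ∃! f : F ⟶ H, ∀ x, f.val.app (op U) x = φ x := by
  let φ' : ((restr A U).obj F).val.obj (topOver U) →ₗ[((ringSheaf A).over U).obj.obj (topOver U)]
      ((restr A U).obj H).val.obj (topOver U) :=
    { toFun := φ, map_add' := φ.map_add, map_smul' := fun a x => φ.map_smul a x }
  obtain ⟨g, hg, hgu⟩ := hU.existsUnique_hom ((restr A U).obj F) (isQuasicoherent_restr F hF U)
    ((restr A U).obj H) φ'
  obtain ⟨f, rfl⟩ := (hH.bijective_map F).2 g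
  exact ⟨f, hg, fun f' hf' => (hH.bijective_map F).1 (hgu _ hf')⟩

variable {𝒰 : Set (Opens X)}

lemma exists_directTop_comp {U : Opens X} {G : ShOn A U}
    {N : ModuleCat.{u} (((ringSheaf A).over U).obj.obj (topOver U))}
    (e : G.val.obj (topOver U) ≅ N) :
    ∃ θ : ((direct A U).obj G).val.obj (op U) →+ N, Function.Bijective θ ∧
      ∀ (a : (ringSheaf A).obj.obj (op U)) x,
        θ (a • x) = (show ((ringSheaf A).over U).obj.obj (topOver U) from a) • θ x :=
  ⟨(directTop U G ≫ e.hom).hom.toAddMonoidHom,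
    (bijective_iso_hom e).comp (bijective_directTop U G),
    fun a x => (directTop U G ≫ e.hom).hom.map_smul a x⟩

/-- The presheaf of modules on an affine family underlying a quasi-coherent module is compatible
with extension of scalars. -/
theorem isExtPresheaf_toPre (haffine : ∀ U ∈ 𝒰, IsAffineOpen A U) (F : ShMod A)
    (hF : F.IsQuasicoherent) : IsExtPresheaf ((toPre A 𝒰).obj F) := by
  rintro ⟨U, hU⟩ ⟨W, hW⟩ i N _ iN φ
  let : Module ((ringSheaf A).obj.obj (op W)) N := iN
  have hWU : W ≤ U := leOfHom i.unop.hom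
  -- Realise `N` as the sections over `W` of a sheaf `G` and let `H` be its direct image to `X`.
  -- Then `H(U) = H(W) = N`, and maps `F → H` compute both the `A(U)`-linear maps `F(U) → N` and the
  -- `A(W)`-linear maps `F(W) → N`.
  obtain ⟨G, -, ⟨e⟩⟩ := (haffine W hW).exists_module
    (@ModuleCat.of (((ringSheaf A).over W).obj.obj (topOver W)) _ N _ iN)
  obtain ⟨θ₀, hθ, hθ₀⟩ := exists_directTop_comp e
  let H := (direct A W).obj G
  have hH : IsDirectImage W H := isDirectImage_direct W G
  let θ : H.val.obj (op W) →ₗ[(ringSheaf A).obj.obj (op W)] N :=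
    { toFun := θ₀, map_add' := θ₀.map_add, map_smul' := hθ₀ }
  let ρ : (ringSheaf A).obj.obj (op U) →+* (ringSheaf A).obj.obj (op W) :=
    ((ringSheaf A).obj.map (homOfLE hWU).op).hom
  let θU : H.val.obj (op U) →ₛₗ[ρ] N := θ.comp (res A H hWU)
  have hθU : Function.Bijective θU := hθ.comp (hH.bijective_res hWU)
  let φ₁ : F.val.obj (op U) →ₛₗ[ρ] N := φ
  obtain ⟨φ', hφ'⟩ := exists_linearMap_lift θU hθU φ₁
  -- A direct image from `W` is also one from the larger `U`, so affineness of `U` applies to the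
  -- same `H`.
  obtain ⟨f, hf, hfu⟩ := (haffine U hU).existsUnique_hom_direct F hF (hH.of_le hWU) φ'
  let fW : F.val.obj (op W) →ₗ[(ringSheaf A).obj.obj (op W)] H.val.obj (op W) :=
    (f.val.app (op W)).hom
  let ψ₀ : F.val.obj (op W) →ₗ[(ringSheaf A).obj.obj (op W)] N := θ.comp fW
  refine ⟨ψ₀, fun x => ?_, fun ψ hψ => ?_⟩
  · refine Eq.trans ?_ (hφ' x)
    refine congrArg θ ?_
    refine (resMap_naturality f.val (homOfLE hWU).op x).trans ?_
    exact congrArg (res A H hWU) (hf x)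
  · let ψ₁ : F.val.obj (op W) →ₗ[(ringSheaf A).obj.obj (op W)] N := ψ
    obtain ⟨ψ', hψ'⟩ := exists_linearMap_lift θ hθ ψ₁
    obtain ⟨g, hg, -⟩ := (haffine W hW).existsUnique_hom_direct F hF hH ψ'
    have : g = f := hfu g fun x => hθU.1 (by
      rw [hφ']
      refine Eq.trans ?_ (hψ x)
      refine (congrArg θ (resMap_naturality g.val (homOfLE hWU).op x).symm).trans ?_
      refine (congrArg θ (hg _)).trans (hψ' _))
    subst this
    refine LinearMap.ext fun x => ?_
    exact ((hψ' x).symm.trans (congrArg θ (hg x).symm))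

instance : (resPreSh A 𝒰).IsRightAdjoint :=
  Functor.isRightAdjoint_of_iso
    (F := PresheafOfModules.pushforward (F := ObjectProperty.ι (fun U : Opens X => U ∈ 𝒰))
      (R := A.obj ⋙ forget₂ (AlgCat.{u} k) RingCat.{u})
      (𝟙 (resAlg A 𝒰 ⋙ forget₂ (AlgCat.{u} k) RingCat.{u}))) (Iso.refl _)

instance : (forgetSh A).IsRightAdjoint :=
  have : (SheafOfModules.forget (ringSheaf A) ⋙
      PresheafOfModules.restrictScalars (𝟙 (ringSheaf A).obj)).IsRightAdjoint :=
    (PresheafOfModules.sheafificationAdjunction (𝟙 (ringSheaf A).obj)).isRightAdjoint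
  Functor.isRightAdjoint_of_iso (F := SheafOfModules.forget (ringSheaf A) ⋙
    PresheafOfModules.restrictScalars (𝟙 (ringSheaf A).obj)) (Iso.refl _)

variable (A 𝒰) in
/-- The sheaf of modules generated by a presheaf of modules on a family of open subsets. -/
def gen : PreShMod (resAlg A 𝒰) ⥤ ShMod A := (toPre A 𝒰).leftAdjoint

variable (A 𝒰) in
/-- The adjunction between `gen` and `toPre`. -/
def genAdj : gen A 𝒰 ⊣ toPre A 𝒰 := Adjunction.ofIsRightAdjoint (toPre A 𝒰)

lemma directTop_homEquiv_symm {U : Opens X} (F : ShMod A) (G : ShOn A U)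
    (f : F ⟶ (direct A U).obj G) (x : F.val.obj (op U)) :
    (((restrAdj A U).homEquiv F G).symm f).val.app (topOver U) x =
      directTop U G (f.val.app (op U) x) := by
  rw [Adjunction.homEquiv_counit]
  rfl

lemma directTop_genAdj {U : Opens X} (hU : U ∈ 𝒰) (Y : PreShMod (resAlg A 𝒰)) (G : ShOn A U)
    (g : (restr A U).obj ((gen A 𝒰).obj Y) ⟶ G) (y : Y.obj (mem hU)) :
    directTop U G (((genAdj A 𝒰).homEquiv _ _ ((restrAdj A U).homEquiv _ _ g)).app (mem hU) y) =
      g.val.app (topOver U) (((genAdj A 𝒰).unit.app Y).app (mem hU) y) := by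
  have h1 := directTop_homEquiv_symm _ G ((restrAdj A U).homEquiv _ _ g)
    (((genAdj A 𝒰).unit.app Y).app (mem hU) y)
  rw [Equiv.symm_apply_apply] at h1
  refine Eq.trans ?_ h1.symm
  rw [Adjunction.homEquiv_unit]
  rfl

/-- Let `E` be the quasi-coherent module on `U` with sections `Y(U)`. For every `G` on `U`, maps
from `gen Y` restricted to `U` into `G` are maps from `Y` into the direct image of `G`, hence linear
maps `Y(U) → G(U)`, hence maps `E → G`. So the restriction is `E` by Yoneda; `r` and `s` are the
resulting inverse isomorphisms. -/
lemma gen_restr (hgood : IsGood 𝒰) (haffine : ∀ U ∈ 𝒰, IsAffineOpen A U)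
    {Y : PreShMod (resAlg A 𝒰)} (hY : IsExtPresheaf Y) {U : Opens X} (hU : U ∈ 𝒰) :
    ((restr A U).obj ((gen A 𝒰).obj Y)).IsQuasicoherent ∧
      Function.Bijective (((genAdj A 𝒰).unit.app Y).app (mem hU)) := by
  obtain ⟨E, hE, ⟨e⟩⟩ := (haffine U hU).exists_module
    (@ModuleCat.of (((ringSheaf A).over U).obj.obj (topOver U)) _ (Y.obj (mem hU)) _
      (inferInstanceAs (Module ((resAlg A 𝒰 ⋙ forget₂ (AlgCat.{u} k) RingCat.{u}).obj (mem hU))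
        (Y.obj (mem hU)))))
  let H := (direct A U).obj E
  let θ : ((toPre A 𝒰).obj H).obj (mem hU)
      →ₗ[(resAlg A 𝒰 ⋙ forget₂ (AlgCat.{u} k) RingCat.{u}).obj (mem hU)]
      Y.obj (mem hU) :=
    { toFun := fun x => e.hom (directTop U E x)
      map_add' := fun x y => map_add (directTop U E ≫ e.hom).hom x y
      map_smul' := fun a x => (directTop U E ≫ e.hom).hom.map_smul a x }
  have hθ : Function.Bijective θ := by
    exact (bijective_iso_hom e).comp
      (bijective_directTop U E)
  obtain ⟨φ', hφ'⟩ := exists_linearMap_lift θ hθ LinearMap.id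
  obtain ⟨f₀, hf₀, -⟩ := hY.existsUnique_hom hgood hU (isDirectImage_direct U E)
    φ'
  let η := (genAdj A 𝒰).unit.app Y
  let f₁ : (gen A 𝒰).obj Y ⟶ H := ((genAdj A 𝒰).homEquiv Y H).symm f₀
  have hf₁ : ∀ y, f₁.val.app (op U) (η.app (mem hU) y) = φ' y := fun y => by
    have h1 : η ≫ (toPre A 𝒰).map f₁ = f₀ :=
      ((genAdj A 𝒰).homEquiv_unit (f := f₁)).symm.trans (Equiv.apply_symm_apply _ _)
    exact (congrArg (fun g : Y ⟶ (toPre A 𝒰).obj H => g.app (mem hU) y) h1).trans (hf₀ y)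
  let r := ((restrAdj A U).homEquiv ((gen A 𝒰).obj Y) E).symm f₁
  have hr : ∀ y : Y.obj (mem hU), e.hom (r.val.app (topOver U) (η.app (mem hU) y)) = y := by
    intro y
    refine (congrArg e.hom (directTop_homEquiv_symm _ E f₁ _)).trans ?_
    exact (congrArg (fun z => e.hom (directTop U E z)) (hf₁ y)).trans (hφ' y)
  have he : ∀ x y, e.hom x = e.hom y → x = y :=
    (bijective_iso_hom e).1
  obtain ⟨s, hs, -⟩ := (haffine U hU).existsUnique_hom E hE ((restr A U).obj ((gen A 𝒰).obj Y))
    { toFun := fun x => η.app (mem hU) (e.hom x)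
      map_add' := fun x y => (congrArg (η.app (mem hU)) (map_add e.hom.hom x y)).trans
        ((η.app (mem hU)).hom.map_add _ _)
      map_smul' := fun a x => (congrArg (η.app (mem hU)) (e.hom.hom.map_smul a x)).trans
        ((η.app (mem hU)).hom.map_smul a _) }
  have hsr : s ≫ r = 𝟙 E :=
    ((haffine U hU).existsUnique_hom E hE E LinearMap.id).unique
      (fun x => he _ _ (by
        change e.hom (r.val.app (topOver U) (s.val.app (topOver U) x)) = e.hom x
        rw [hs]
        exact hr _)) fun x => rfl
  -- Through both adjunctions the two endomorphisms become maps from `Y` to a direct image, which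
  -- need only be compared over `U`.
  have hrs : r ≫ s = 𝟙 _ := by
    refine ((restrAdj A U).homEquiv _ _).injective (((genAdj A 𝒰).homEquiv _ _).injective ?_)
    have huniq := hY.existsUnique_hom hgood hU
      (isDirectImage_direct U ((restr A U).obj ((gen A 𝒰).obj Y)))
    refine (huniq _).unique (fun _ => rfl) fun y => ?_
    refine (bijective_directTop U ((restr A U).obj ((gen A 𝒰).obj Y))).1 ?_
    refine (directTop_genAdj hU _ _ _ _).trans (Eq.trans ?_ (directTop_genAdj hU _ _ _ _).symm)
    change η.app (mem hU) y = s.val.app (topOver U) (r.val.app (topOver U) (η.app (mem hU) y))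
    rw [hs]
    exact (congrArg (η.app (mem hU)) (hr y)).symm
  let iso : E ≅ (restr A U).obj ((gen A 𝒰).obj Y) := ⟨s, r, hsr, hrs⟩
  refine ⟨(SheafOfModules.isQuasicoherent ((ringSheaf A).over U)).prop_of_iso iso hE, ?_⟩
  have : IsIso r.val := 
    ((SheafOfModules.forget ((ringSheaf A).over U)).mapIso iso).isIso_inv
  -- This bijection is a left inverse of the unit over `U` by `hr`, so the unit is bijective there.
  have hb : Function.Bijective fun x => e.hom (r.val.app (topOver U) x) :=
    (bijective_iso_hom e).comp
      (bijective_of_isIso r.val (topOver U))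
  refine ⟨fun y y' h => ?_, fun x => ⟨e.hom (r.val.app (topOver U) x), hb.1 (hr _)⟩⟩
  rw [← hr y, ← hr y']
  exact congrArg (fun x => e.hom (r.val.app (topOver U) x)) h

end QuasiCoherent

lemma isIso_of_bijective_app {C : Type u₁} [Category.{v₁} C] {R : Cᵒᵖ ⥤ RingCat.{u}}
    {F G : PresheafOfModules.{u} R} (f : F ⟶ G) (h : ∀ c, Function.Bijective (f.app c)) :
    IsIso f := by
  have : IsIso ((PresheafOfModules.toPresheaf _).map f) := by
    rw [NatTrans.isIso_iff_isIso_app]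
    intro c
    rw [ConcreteCategory.isIso_iff_bijective]
    exact h c
  exact isIso_of_reflects_iso f (PresheafOfModules.toPresheaf _)

/-! ### The essential image and full faithfulness of `π`. -/

section Comparison

variable {k : Type u} [Field k] {X : TopCat.{u}} {A : TopCat.Sheaf (AlgCat.{u} k) X}
  {𝒰 : Set (Opens X)}

lemma coversTop_of_cover (hcover : ∀ x : X, ∃ U ∈ 𝒰, x ∈ U) :
    (Opens.grothendieckTopology X).CoversTop (fun U : 𝒰 => U.1) := by
  intro W x hx
  obtain ⟨U, hU, hxU⟩ := hcover x
  exact ⟨W ⊓ U, homOfLE inf_le_left, ⟨⟨U, hU⟩, ⟨homOfLE inf_le_right⟩⟩, hx, hxU⟩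

variable (hcover : ∀ x : X, ∃ U ∈ 𝒰, x ∈ U) (hgood : IsGood 𝒰)
  (haffine : ∀ U ∈ 𝒰, IsAffineOpen A U)

include hcover hgood haffine

lemma isQuasicoherent_gen {Y : PreShMod (resAlg A 𝒰)} (hY : IsExtPresheaf Y) :
    ((gen A 𝒰).obj Y).IsQuasicoherent := by
  have : ∀ U : 𝒰, (((gen A 𝒰).obj Y).over U.1).IsQuasicoherent := fun U =>
    (gen_restr hgood haffine hY U.2).1
  exact SheafOfModules.IsQuasicoherent.of_coversTop ((gen A 𝒰).obj Y) (fun U : 𝒰 => U.1)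
    (coversTop_of_cover hcover)

omit hcover in
lemma isIso_unit_of_isExtPresheaf {Y : PreShMod (resAlg A 𝒰)} (hY : IsExtPresheaf Y) :
    IsIso ((genAdj A 𝒰).unit.app Y) :=
  isIso_of_bijective_app _ fun c => (gen_restr hgood haffine hY c.unop.2).2

/-- A triangle identity makes the counit bijective over each member of `𝒰`. On an affine member both
sides are quasi-coherent, so bijectivity on sections already gives an isomorphism, and being an
isomorphism is local. -/
lemma isIso_counit_of_isQuasicoherent (F : ShMod A) (hF : F.IsQuasicoherent) :
    IsIso ((genAdj A 𝒰).counit.app F) := by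
  let ε := (genAdj A 𝒰).counit.app F
  have hY := isExtPresheaf_toPre haffine F hF
  have hunit := isIso_unit_of_isExtPresheaf hgood haffine hY
  have htri := (genAdj A 𝒰).right_triangle_components F
  have hε : IsIso ((toPre A 𝒰).map ε) := by
    have : (toPre A 𝒰).map ε = inv ((genAdj A 𝒰).unit.app ((toPre A 𝒰).obj F)) :=
      IsIso.eq_inv_of_hom_inv_id htri
    rw [this]
    infer_instance
  have hloc : ∀ U ∈ 𝒰, IsIso ((restr A U).map ε) := by
    intro U hU
    have hq := (gen_restr hgood haffine hY hU).1
    have hq' := isQuasicoherent_restr F hF U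
    have hb : Function.Bijective (ε.val.app (op U)) :=
      bijective_of_isIso ((toPre A 𝒰).map ε) (mem hU)
    let l : ((restr A U).obj ((gen A 𝒰).obj ((toPre A 𝒰).obj F))).val.obj (topOver U)
        →ₗ[((ringSheaf A).over U).obj.obj (topOver U)]
        ((restr A U).obj F).val.obj (topOver U) := (((restr A U).map ε).val.app (topOver U)).hom
    let e := LinearEquiv.ofBijective l hb
    obtain ⟨t, ht, -⟩ := (haffine U hU).existsUnique_hom _ hq' _ e.symm.toLinearMap
    refine ⟨t, ?_, ?_⟩
    · refine ((haffine U hU).existsUnique_hom _ hq _ LinearMap.id).unique (fun x => ?_) fun _ => rfl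
      change t.val.app (topOver U) (l x) = x
      rw [ht]
      exact e.symm_apply_apply x
    · refine ((haffine U hU).existsUnique_hom _ hq' _ LinearMap.id).unique (fun x => ?_)
        fun _ => rfl
      change l (t.val.app (topOver U) x) = x
      rw [ht]
      exact e.apply_symm_apply x
  have : IsIso ((SheafOfModules.toSheaf (ringSheaf A)).map ε) := by
    refine Sheaf.isIso_of_coversTop (coversTop_of_cover hcover) fun U => ?_
    have := hloc U.1 U.2
    exact ((SheafOfModules.toSheaf _).mapIso (asIso ((restr A U.1).map ε))).isIso_hom
  exact isIso_of_reflects_iso ε (SheafOfModules.toSheaf (ringSheaf A))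

/-- Taking the underlying presheaf of modules on a good affine family is fully faithful on
quasi-coherent modules. -/
lemma bijective_forgetQCoh_map (F G : QCoh A) :
    Function.Bijective ((forgetQCoh A 𝒰).map : (F ⟶ G) → _) := by
  have := isIso_counit_of_isQuasicoherent hcover hgood haffine F.obj F.property
  have h : ∀ f : F ⟶ G, (forgetQCoh A 𝒰).map f =
      (genAdj A 𝒰).homEquiv _ _ ((genAdj A 𝒰).counit.app F.obj ≫ f.hom) := fun f => by
    refine (Equiv.symm_apply_eq _).mp ?_
    refine ((genAdj A 𝒰).homEquiv_counit (g := (toPre A 𝒰).map f.hom)).trans ?_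
    exact (genAdj A 𝒰).counit.naturality f.hom
  rw [funext h]
  refine ((genAdj A 𝒰).homEquiv _ _).bijective.comp ⟨fun f g hfg => ?_, fun g => ?_⟩
  · exact ObjectProperty.hom_ext _ ((cancel_epi _).mp hfg)
  · exact ⟨ObjectProperty.homMk (inv ((genAdj A 𝒰).counit.app F.obj) ≫ g), by simp⟩

lemma full_forgetQCoh : (forgetQCoh A 𝒰).Full where
  map_surjective := (bijective_forgetQCoh_map hcover hgood haffine _ _).2

lemma faithful_forgetQCoh : (forgetQCoh A 𝒰).Faithful where
  map_injective h := (bijective_forgetQCoh_map hcover hgood haffine _ _).1 h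

/-- Presheaves of modules on a good affine family which are compatible with extension of scalars
come from quasi-coherent modules. -/
lemma exists_forgetQCoh_iso {Y : PreShMod (resAlg A 𝒰)} (hY : IsExtPresheaf Y) :
    ∃ F : QCoh A, Nonempty ((forgetQCoh A 𝒰).obj F ≅ Y) :=
  have := isIso_unit_of_isExtPresheaf hgood haffine hY
  ⟨⟨(gen A 𝒰).obj Y, isQuasicoherent_gen hcover hgood haffine hY⟩,
    ⟨(asIso ((genAdj A 𝒰).unit.app Y)).symm⟩⟩

omit hcover hgood in
lemma isExtPresheaf_forgetQCoh (F : QCoh A) : IsExtPresheaf ((forgetQCoh A 𝒰).obj F) :=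
  isExtPresheaf_toPre haffine F.obj F.property

end Comparison

/-! ### Nilpotence, dévissage and finite dimensionality of pointed Artin rings. -/

namespace PtArt

variable {k : Type u} [Field k] {p : ℕ} (R : PtArt k p)

/-- The powers stabilise by the Artinian condition, and their intersection is zero: an element of it
and `0` are both limits of the zero sequence. -/
lemma aug_pow_eq_bot : ∃ n : ℕ, (RingHom.ker R.aug) ^ n = ⊥ := by
  have := R.artinian_left
  obtain ⟨n, hn⟩ := IsArtinian.monotone_stabilizes (R := R.carrier) (M := R.carrier)
    ⟨fun n => OrderDual.toDual ((RingHom.ker R.aug) ^ n), fun a b h => Ideal.pow_le_pow_right h⟩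
  have hle : ∀ m, (RingHom.ker R.aug) ^ n ≤ (RingHom.ker R.aug) ^ m := fun m => by
    rcases le_total n m with h | h
    · exact (show (RingHom.ker R.aug) ^ n = (RingHom.ker R.aug) ^ m from hn m h).le
    · exact Ideal.pow_le_pow_right h
  refine ⟨n, (Submodule.eq_bot_iff _).mpr fun x hx => ?_⟩
  obtain ⟨l, -, hl⟩ := R.complete (fun _ => 0) fun m => by simp
  rw [hl x fun m => by simpa using hle m hx, hl 0 fun m => by simp]

lemma sum_idem : ∑ i, R.idem i = 1 := by
  unfold idem
  rw [← map_sum, Finset.univ_sum_single (fun _ : Fin p => (1 : k))]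
  exact map_one R.incl

lemma idem_mul_idem (i : Fin p) : R.idem i * R.idem i = R.idem i := by
  unfold idem
  rw [← map_mul, ← Pi.single_mul, mul_one]

lemma aug_idem (i : Fin p) : R.aug (R.idem i) = Pi.single i 1 :=
  DFunLike.congr_fun R.aug_incl (Pi.single i 1)

lemma point_apply (i : Fin p) (r : R.carrier) : R.point i r = R.aug r i := rfl

/-- The left ideal of a point of `R`. -/
def pointIdeal (i : Fin p) : Submodule R.carrier R.carrier := RingHom.ker (R.point i)

lemma mem_pointIdeal {i : Fin p} {r : R.carrier} : r ∈ R.pointIdeal i ↔ R.point i r = 0 := Iff.rfl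

lemma mul_idem_mem {i : Fin p} {r : R.carrier} (h : R.point i r = 0) :
    r * R.idem i ∈ RingHom.ker R.aug := by
  rw [RingHom.mem_ker]
  change R.aug _ = 0
  rw [map_mul, aug_idem]
  funext j
  rcases eq_or_ne j i with rfl | hj
  · simpa [point_apply] using h
  · simp [hj]

/-- The quotient of `R` by a proper left ideal has a simple submodule `k_i`. -/
lemma exists_simple (J : Submodule R.carrier R.carrier) (hJ : J ≠ ⊤) :
    ∃ (x : R.carrier) (i : Fin p), x ∉ J ∧ ∀ r ∈ R.pointIdeal i, r * x ∈ J := by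
  classical
  -- Choose `x` in the last power of the augmentation ideal not contained in `J`; the augmentation
  -- ideal then sends `x` into `J`, and some component `e_i x` stays outside `J`.
  have hex : ∃ n : ℕ, (RingHom.ker R.aug) ^ n ≤ J := by
    obtain ⟨n, hn⟩ := R.aug_pow_eq_bot
    exact ⟨n, hn ▸ bot_le⟩
  have h0 : Nat.find hex ≠ 0 := fun h => by
    have := Nat.find_spec hex
    rw [h, Submodule.pow_zero, Ideal.one_eq_top] at this
    exact hJ (top_le_iff.mp this)
  obtain ⟨m, hm⟩ := Nat.exists_eq_succ_of_ne_zero h0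
  have h1 : ¬ (RingHom.ker R.aug) ^ m ≤ J := Nat.find_min hex (by omega)
  have h2 : (RingHom.ker R.aug) ^ (m + 1) ≤ J := by
    have := Nat.find_spec hex
    rwa [hm] at this
  obtain ⟨x, hx, hxJ⟩ := SetLike.not_le_iff_exists.mp h1
  have h3 : ∀ r ∈ RingHom.ker R.aug, r * x ∈ J := fun r hr => h2 (by
    rw [Ideal.IsTwoSided.pow_succ]
    exact Ideal.mul_mem_mul hr hx)
  have h4 : ∃ i, R.idem i * x ∉ J := by
    by_contra! h
    refine hxJ ?_
    rw [← one_mul x, ← R.sum_idem, Finset.sum_mul]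
    exact sum_mem fun i _ => h i
  obtain ⟨i, hi⟩ := h4
  exact ⟨_, i, hi, fun r hr => by rw [← mul_assoc]; exact h3 _ (R.mul_idem_mem hr)⟩

/-- Dévissage of left ideals. -/
theorem devissage (Q : Submodule R.carrier R.carrier → Prop) (htop : Q ⊤)
    (hstep : ∀ (J : Submodule R.carrier R.carrier) (x : R.carrier) (i : Fin p), x ∉ J →
      (∀ r ∈ R.pointIdeal i, r * x ∈ J) → Q (J ⊔ Submodule.span R.carrier {x}) → Q J)
    (J : Submodule R.carrier R.carrier) : Q J := by
  have : IsArtinianRing R.carrier := R.artinian_left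
  have hN : IsNoetherian R.carrier R.carrier := inferInstanceAs (IsNoetherianRing R.carrier)
  induction J using (wellFounded_gt (α := Submodule R.carrier R.carrier)).induction with
  | _ J ih =>
    by_cases hJ : J = ⊤
    · rwa [hJ]
    · obtain ⟨x, i, hx, h⟩ := R.exists_simple J hJ
      refine hstep J x i hx h (ih _ ?_)
      refine lt_of_le_of_ne le_sup_left fun e => hx ?_
      rw [e]
      exact Submodule.mem_sup_right (Submodule.mem_span_singleton_self x)

/-- Each dévissage step costs one dimension over `k`: modulo `J`, multiplication of `x` by `r` is
the scalar `R.point i r`. -/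
instance finite : Module.Finite k R.carrier := by
  have key : ∀ J : Submodule R.carrier R.carrier, ∃ V : Submodule k R.carrier,
      V.FG ∧ V ⊔ J.restrictScalars k = ⊤ := by
    refine R.devissage _ ⟨⊥, Submodule.fg_bot, by simp⟩ ?_
    rintro J x i - h ⟨V, hV, hVJ⟩
    refine ⟨V ⊔ Submodule.span k {x}, hV.sup (Submodule.fg_span_singleton x), top_le_iff.mp ?_⟩
    rw [← hVJ]
    refine sup_le (le_sup_left.trans le_sup_left) fun y hy => ?_
    obtain ⟨a, ha, b, hb, rfl⟩ := Submodule.mem_sup.mp (show y ∈ J ⊔ Submodule.span _ {x} from hy)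
    obtain ⟨r, rfl⟩ := Submodule.mem_span_singleton.mp hb
    refine add_mem (Submodule.mem_sup_right ha) ?_
    have h1 : (r - algebraMap k _ (R.point i r)) * x ∈ J := h _ (by
      rw [mem_pointIdeal, map_sub, AlgHom.commutes]
      exact sub_self _)
    have h2 : r • x = (r - algebraMap k _ (R.point i r)) * x + R.point i r • x := by
      rw [sub_mul, Algebra.smul_def, smul_eq_mul, sub_add_cancel]
    rw [h2]
    exact add_mem (Submodule.mem_sup_right h1) (Submodule.mem_sup_left (Submodule.mem_sup_right
      (Submodule.smul_mem _ _ (Submodule.mem_span_singleton_self x))))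
  obtain ⟨V, hV, h⟩ := key ⊥
  refine ⟨?_⟩
  have : V = ⊤ := by
    rw [← h]
    refine (sup_eq_left.mpr ?_).symm
    intro y hy
    rw [show y = 0 from hy]
    exact zero_mem _
  exact this ▸ hV

lemma mem_row {i : Fin p} {x : R.carrier} : x ∈ R.row i ↔ R.idem i * x = x := by
  refine ⟨fun h => ?_, fun h => ?_⟩
  · obtain ⟨r, rfl⟩ := Submodule.mem_span_singleton.mp h
    change R.idem i * (R.idem i * r.unop) = R.idem i * r.unop
    rw [← mul_assoc, idem_mul_idem]
  · rw [← h]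
    exact Submodule.mem_span_singleton.mpr ⟨MulOpposite.op x, rfl⟩

end PtArt

/-! ### Extension of scalars modulo a left ideal of `R`. -/

section ActSpan

variable {R B M' : Type u} [Ring R] [Ring B] [AddCommGroup M'] [Module B M']

/-- The submodule `M' · J` generated by the products with the elements of a left ideal. -/
def actSpan (a : Rᵐᵒᵖ →+* Module.End B M') (J : Submodule R R) : Submodule B M' :=
  ⨆ r : J, LinearMap.range (a (MulOpposite.op r.1))

lemma act_mem_actSpan (a : Rᵐᵒᵖ →+* Module.End B M') {J : Submodule R R} {r : R} (hr : r ∈ J)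
    (y : M') : a (MulOpposite.op r) y ∈ actSpan a J :=
  le_iSup (fun r : J => LinearMap.range (a (MulOpposite.op r.1))) ⟨r, hr⟩ ⟨y, rfl⟩

lemma map_eq_zero_of_mem_actSpan {N : Type*} [AddCommGroup N] [Module B N]
    {a : Rᵐᵒᵖ →+* Module.End B M'} {J : Submodule R R} {φ : M' →ₗ[B] N}
    (h : ∀ r ∈ J, ∀ y, φ (a (MulOpposite.op r) y) = 0) {z : M'} (hz : z ∈ actSpan a J) :
    φ z = 0 := by
  have : actSpan a J ≤ LinearMap.ker φ := iSup_le fun r => by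
    rintro _ ⟨y, rfl⟩
    exact h r.1 r.2 y
  exact this hz

end ActSpan

section RelativeExtension

variable {R A B M M' : Type u} [Ring R] [Ring A] [Ring B] [AddCommGroup M] [Module A M]
  [AddCommGroup M'] [Module B M'] {ρ : A →+* B} (m : M →ₛₗ[ρ] M')
  (a : Rᵐᵒᵖ →+* Module.End A M) (a' : Rᵐᵒᵖ →+* Module.End B M')

/-- `m` exhibits `M' / M' J` as the extension of scalars of `M / M J`. -/
def IsRelExt (J : Submodule R R) : Prop :=
  ∀ (N : Type u) [AddCommGroup N] [Module B N] (φ : M →ₛₗ[ρ] N),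
    (∀ r ∈ J, ∀ x, φ (a (MulOpposite.op r) x) = 0) →
      ∃! ψ : M' →ₗ[B] N, (∀ r ∈ J, ∀ y, ψ (a' (MulOpposite.op r) y) = 0) ∧ ∀ x, ψ (m x) = φ x

variable {m a a'}

lemma IsRelExt.eq_zero {J : Submodule R R} (h : IsRelExt m a a' J) {N : Type u} [AddCommGroup N]
    [Module B N] {ψ : M' →ₗ[B] N} (hψ : ∀ r ∈ J, ∀ y, ψ (a' (MulOpposite.op r) y) = 0)
    (h0 : ∀ x, ψ (m x) = 0) (z : M') : ψ z = 0 := by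
  have := (h N 0 fun _ _ _ => rfl).unique (y₁ := ψ) (y₂ := 0) ⟨hψ, h0⟩
    ⟨fun _ _ _ => rfl, fun _ => rfl⟩
  rw [this]; rfl

lemma isRelExt_top : IsRelExt m a a' ⊤ := fun N _ _ φ h => by
  have h1 : ∀ x, φ x = 0 := fun x => by simpa using h 1 trivial x
  refine ⟨0, ⟨fun _ _ _ => rfl, fun x => (h1 x).symm⟩, fun ψ hψ => ?_⟩
  ext y
  simpa using hψ.1 1 trivial y

lemma IsRelExt.isExt (h : IsRelExt m a a' ⊥) : IsExt m := fun N _ _ φ => by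
  obtain ⟨ψ, hψ, hu⟩ := h N φ (by rintro r rfl x; simp)
  exact ⟨ψ, hψ.2, fun ψ' h' => hu ψ' ⟨by rintro r rfl x; simp, h'⟩⟩

variable (hm : ∀ r x, m (a r x) = a' r (m x))
include hm

/-- Right multiplication by `x` gives an exact sequence `R/I → R/J' → R/(J' + Rx) → 0`. Tensoring it
with `M` and then extending scalars keeps it right exact, while `hflat` makes `M'/M'I → M'/M'J'`
injective. The five lemma gives the claim for `J'` from those for `I` and `J' + Rx`; the proof
carries this out by universal properties, with a pushout in place of tensor products. -/
lemma IsRelExt.step {J' I : Submodule R R} {x : R} (hx : ∀ r ∈ I, r * x ∈ J')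
    (hflat : ∀ z, a' (MulOpposite.op x) z ∈ actSpan a' J' → z ∈ actSpan a' I)
    (hI : IsRelExt m a a' I) (hJ : IsRelExt m a a' (J' ⊔ Submodule.span R {x})) :
    IsRelExt m a a' J' := by
  have hmul : ∀ (r : R) y, a (MulOpposite.op x) (a (MulOpposite.op r) y) =
      a (MulOpposite.op (r * x)) y := fun r y => by rw [MulOpposite.op_mul, map_mul]; rfl
  have hmul' : ∀ (r : R) y, a' (MulOpposite.op x) (a' (MulOpposite.op r) y) =
      a' (MulOpposite.op (r * x)) y := fun r y => by rw [MulOpposite.op_mul, map_mul]; rfl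
  have hle : J' ≤ J' ⊔ Submodule.span R {x} := le_sup_left
  have hker : ∀ {N : Type u} [AddCommGroup N] [Module B N] (ψ : M' →ₗ[B] N),
      (∀ r ∈ J', ∀ y, ψ (a' (MulOpposite.op r) y) = 0) →
      (∀ y, ψ (a' (MulOpposite.op x) y) = 0) →
      ∀ r ∈ J' ⊔ Submodule.span R {x}, ∀ y, ψ (a' (MulOpposite.op r) y) = 0 := by
    intro N _ _ ψ h1 h2 r hr y
    obtain ⟨b, hb, c, hc, rfl⟩ := Submodule.mem_sup.mp hr
    obtain ⟨s, rfl⟩ := Submodule.mem_span_singleton.mp hc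
    rw [MulOpposite.op_add, map_add, LinearMap.add_apply, map_add, h1 b hb, zero_add, smul_eq_mul,
      ← hmul', h2]
  -- Such a `δ` vanishes on `M' x` by uniqueness for `I`, hence everywhere by uniqueness for `J' +
  -- Rx`.
  have huniq : ∀ {N : Type u} [AddCommGroup N] [Module B N] (δ : M' →ₗ[B] N),
      (∀ r ∈ J', ∀ y, δ (a' (MulOpposite.op r) y) = 0) → (∀ y, δ (m y) = 0) → δ = 0 := by
    intro N _ _ δ h1 h2
    have h3 : ∀ z, δ (a' (MulOpposite.op x) z) = 0 :=
      hI.eq_zero (ψ := δ ∘ₗ a' (MulOpposite.op x))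
        (fun r hr y => by rw [LinearMap.comp_apply, hmul']; exact h1 _ (hx r hr) y)
        (fun y => by rw [LinearMap.comp_apply, ← hm]; exact h2 _)
    ext z
    exact hJ.eq_zero (hker δ h1 h3) h2 z
  intro N _ _ φ hφ
  obtain ⟨ψ₁, ⟨hψ₁I, hψ₁⟩, -⟩ := hI N (φ.comp (a (MulOpposite.op x))) fun r hr y => by
    rw [LinearMap.comp_apply, hmul]; exact hφ _ (hx r hr) y
  -- The quotient by `K` is the pushout of `N` and `M'/M'J'` along `ψ₁` and multiplication by `x`,
  -- both defined on `M'/M'I`.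
  let K : Submodule B (N × M') := LinearMap.range (ψ₁.prod (-(a' (MulOpposite.op x)))) ⊔
    (actSpan a' J').map (LinearMap.inr B N M')
  have hK₁ : ∀ z, (ψ₁ z, -(a' (MulOpposite.op x) z)) ∈ K := fun z =>
    Submodule.mem_sup_left ⟨z, rfl⟩
  have hK₂ : ∀ r ∈ J', ∀ y, ((0 : N), a' (MulOpposite.op r) y) ∈ K := fun r hr y =>
    Submodule.mem_sup_right ⟨_, act_mem_actSpan a' hr y, rfl⟩
  -- Flatness makes `N` embed in the pushout: if `z x` lies in `M'J'` then `z` lies in `M'I`, which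
  -- `ψ₁` kills.
  have hKinj : ∀ n : N, (n, (0 : M')) ∈ K → n = 0 := by
    intro n hn
    obtain ⟨_, ⟨z, rfl⟩, _, ⟨w, hw, rfl⟩, h⟩ := Submodule.mem_sup.mp hn
    have h1 : ψ₁ z + 0 = n := congrArg Prod.fst h
    have h2 : -(a' (MulOpposite.op x) z) + w = 0 := congrArg Prod.snd h
    rw [← h1, add_zero]
    refine map_eq_zero_of_mem_actSpan hψ₁I (hflat z ?_)
    rwa [neg_add_eq_zero.mp h2]
  -- The difference of `m` and `φ` in the pushout kills both `M J'` and `M x`, so it extends to `s`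
  -- on `M'`.
  let s₀ : M →ₛₗ[ρ] (N × M') ⧸ K :=
    { toFun := fun y => K.mkQ (-φ y, m y)
      map_add' := fun y z => by
        rw [← map_add]; congr 1; ext <;> simp [add_comm]
      map_smul' := fun c y => by
        rw [← map_smul]; congr 1; ext <;> simp }
  have hs₀J : ∀ r ∈ J', ∀ y, s₀ (a (MulOpposite.op r) y) = 0 := fun r hr y => by
    refine (Submodule.Quotient.mk_eq_zero _).mpr ?_
    rw [hφ r hr, hm, neg_zero]
    exact hK₂ r hr _
  have hs₀x : ∀ y, s₀ (a (MulOpposite.op x) y) = 0 := fun y => by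
    refine (Submodule.Quotient.mk_eq_zero _).mpr ?_
    have := K.neg_mem (hK₁ (m y))
    rw [hψ₁] at this
    simpa [hm] using this
  obtain ⟨s, ⟨hsJ, hs⟩, -⟩ := hJ _ s₀ fun r hr y => by
    obtain ⟨b, hb, c, hc, rfl⟩ := Submodule.mem_sup.mp hr
    obtain ⟨t, rfl⟩ := Submodule.mem_span_singleton.mp hc
    rw [MulOpposite.op_add, map_add, LinearMap.add_apply, map_add, hs₀J b hb, zero_add,
      smul_eq_mul, ← hmul, hs₀x]
  let ι : N →ₗ[B] (N × M') ⧸ K := K.mkQ ∘ₗ LinearMap.inl B N M'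
  have hι : Function.Injective ι := (injective_iff_map_eq_zero ι).mpr fun n hn =>
    hKinj n ((Submodule.Quotient.mk_eq_zero _).mp hn)
  -- Subtracting `s` from the inclusion of `M'` leaves a map that restricts to `φ` on `M`. Modulo
  -- `N` it vanishes on `M'(J' + Rx)` and on the image of `M`, hence vanishes, so it lands in `N`
  -- and is the wanted extension.
  let d : M' →ₗ[B] (N × M') ⧸ K := K.mkQ ∘ₗ LinearMap.inr B N M' - s
  have hdm : ∀ y, d (m y) = ι (φ y) := fun y => by
    change K.mkQ ((0 : N), m y) - s (m y) = K.mkQ (φ y, (0 : M'))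
    rw [hs]
    change _ - K.mkQ (-φ y, m y) = _
    rw [← map_sub]; congr 1; ext <;> simp
  have hdJ : ∀ r ∈ J', ∀ y, d (a' (MulOpposite.op r) y) = 0 := fun r hr y => by
    change K.mkQ ((0 : N), a' (MulOpposite.op r) y) - s _ = 0
    rw [hsJ r (hle hr), sub_zero]
    exact (Submodule.Quotient.mk_eq_zero _).mpr (hK₂ r hr y)
  have hdx : ∀ y, d (a' (MulOpposite.op x) y) = ι (ψ₁ y) := fun y => by
    change K.mkQ ((0 : N), a' (MulOpposite.op x) y) - s _ = K.mkQ (ψ₁ y, (0 : M'))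
    rw [hsJ x (Submodule.mem_sup_right (Submodule.mem_span_singleton_self x)), sub_zero,
      ← sub_eq_zero, ← map_sub]
    refine (Submodule.Quotient.mk_eq_zero _).mpr ?_
    have := K.neg_mem (hK₁ y)
    simpa using this
  have hd : ∀ z, d z ∈ LinearMap.range ι := fun z => by
    refine (Submodule.Quotient.mk_eq_zero _).mp ?_
    refine hJ.eq_zero (ψ := (LinearMap.range ι).mkQ ∘ₗ d) (hker _ (fun r hr y => ?_) fun y => ?_)
      (fun y => ?_) z
    · rw [LinearMap.comp_apply, hdJ r hr, map_zero]
    · rw [LinearMap.comp_apply, hdx]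
      exact (Submodule.Quotient.mk_eq_zero _).mpr ⟨_, rfl⟩
    · rw [LinearMap.comp_apply, hdm]
      exact (Submodule.Quotient.mk_eq_zero _).mpr ⟨_, rfl⟩
  let ψ : M' →ₗ[B] N := (LinearEquiv.ofInjective ι hι).symm.toLinearMap ∘ₗ d.codRestrict _ hd
  have hψ : ∀ z, ι (ψ z) = d z := fun z =>
    congrArg Subtype.val ((LinearEquiv.ofInjective ι hι).apply_symm_apply ⟨d z, hd z⟩)
  refine ⟨ψ, ⟨fun r hr y => hι ?_, fun y => hι ?_⟩, fun ψ' hψ' => ?_⟩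
  · rw [hψ, hdJ r hr, map_zero]
  · rw [hψ, hdm]
  · refine sub_eq_zero.mp (huniq (ψ' - ψ) (fun r hr y => ?_) fun y => ?_)
    · rw [LinearMap.sub_apply, hψ'.1 r hr, zero_sub, neg_eq_zero]
      exact hι (by rw [hψ, hdJ r hr, map_zero])
    · rw [LinearMap.sub_apply, hψ'.2, sub_eq_zero]
      exact hι (by rw [hψ, hdm])

omit hm in
/-- Relative extension of scalars when the quotients `M / M I` and `M' / M' I` are known. -/
lemma isRelExt_of_isExt {I : Submodule R R} {V V' : Type u} [AddCommGroup V] [Module A V]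
    [AddCommGroup V'] [Module B V'] {n : V →ₛₗ[ρ] V'} (hn : IsExt n) (q : M →ₗ[A] V)
    (q' : M' →ₗ[B] V') (hq : Function.Surjective q) (hq' : Function.Surjective q')
    (hqn : ∀ x, q' (m x) = n (q x)) (hker : ∀ x, q x = 0 → x ∈ actSpan a I)
    (hker' : ∀ x, q' x = 0 ↔ x ∈ actSpan a' I) : IsRelExt m a a' I := by
  intro N _ _ φ hφ
  obtain ⟨φ', hφ'⟩ : ∃ φ' : V →ₛₗ[ρ] N, ∀ x, φ' (q x) = φ x := by
    let : Module A N := Module.compHom N ρ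
    let φ₀ : M →ₗ[A] N :=
      { toFun := φ, map_add' := φ.map_add, map_smul' := fun b y => φ.map_smulₛₗ b y }
    obtain ⟨r, hr⟩ := exists_linearMap_of_surjective q hq φ₀ fun y hy =>
      map_eq_zero_of_mem_actSpan (φ := φ₀) hφ (hker y hy)
    exact ⟨{ toFun := r, map_add' := r.map_add, map_smul' := fun b y => r.map_smul b y }, hr⟩
  obtain ⟨ψ, hψ, hu⟩ := hn N φ'
  refine ⟨ψ.comp q', ⟨fun r hr y => ?_, fun x => ?_⟩, fun ψ' ⟨h1, h2⟩ => ?_⟩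
  · rw [LinearMap.comp_apply, (hker' _).mpr (act_mem_actSpan a' hr y), map_zero]
  · rw [LinearMap.comp_apply, hqn, hψ, hφ']
  · obtain ⟨r, hr⟩ := exists_linearMap_of_surjective q' hq' ψ' fun y hy =>
      map_eq_zero_of_mem_actSpan h1 ((hker' y).mp hy)
    have : r = ψ := hu r fun v => by
      obtain ⟨x, rfl⟩ := hq v
      rw [← hqn, hr, h2, hφ']
    ext y
    rw [← hr, this]
    rfl

end RelativeExtension

/-! ### Flatness of matric free modules and the dévissage of extension of scalars. -/

namespace PtArt

variable {k : Type u} [Field k] {p : ℕ} (R : PtArt k p)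

/-- A matric free module is flat: it can be tested on simple subquotients of `R`. -/
lemma mem_actSpan_of_mul_mem {B M' : Type u} [Ring B] [AddCommGroup M'] [Module B M']
    (a' : R.carrierᵐᵒᵖ →+* Module.End B M') {V : Fin p → Type u} [∀ i, AddCommGroup (V i)]
    [∀ i, Module k (V i)] (e : M' ≃+ ∀ i, R.row i ⊗[k] V i)
    (he : ∀ r y, e (a' (MulOpposite.op r) y) = MulOpposite.op r • e y)
    {J' : Submodule R.carrier R.carrier} {x : R.carrier} {i : Fin p} (hxJ : x ∉ J')
    (hx : ∀ r ∈ R.pointIdeal i, r * x ∈ J') {z : M'}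
    (hz : a' (MulOpposite.op x) z ∈ actSpan a' J') : z ∈ actSpan a' (R.pointIdeal i) := by
  classical
  let b := fun j => Module.Basis.ofVectorSpace k (V j)
  -- Coordinates with respect to a basis of `V j`, taking values in the row `e_j R`.
  let w := fun (j : Fin p) (y : M') =>
    TensorProduct.equivFinsuppOfBasisRight (M := R.row j) (b j) (e y j)
  have hwr : ∀ (j) (r : R.carrier) (y : M') l,
      (w j (a' (MulOpposite.op r) y) l).1 = (w j y l).1 * r := by
    intro j r y l
    simp only [w, he, Pi.smul_apply]
    generalize e y j = t
    induction t with
    | zero => simp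
    | add s t hs ht =>
      rw [smul_add, map_add, map_add, Finsupp.add_apply, Finsupp.add_apply]
      change (_ : R.carrier) + _ = (_ + _) * r
      rw [add_mul]
      exact congrArg₂ _ hs ht
    | tmul s v =>
      rw [TensorProduct.smul_tmul', TensorProduct.equivFinsuppOfBasisRight_apply_tmul_apply,
        TensorProduct.equivFinsuppOfBasisRight_apply_tmul_apply]
      change _ • (s.1 * r) = (_ • s.1) * r
      rw [smul_mul_assoc]
  have hadd : ∀ j y y' l, (w j (y + y') l).1 = (w j y l).1 + (w j y' l).1 := by
    intro j y y' l
    simp only [w, map_add, Pi.add_apply, Finsupp.add_apply]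
    rfl
  have hzero : ∀ j l, (w j 0 l).1 = 0 := by
    intro j l
    simp [w]
  have hJ : ∀ y ∈ actSpan a' J', ∀ j l, (w j y l).1 ∈ J' := by
    intro y hy j l
    refine Submodule.iSup_induction (fun r : J' => LinearMap.range (a' (MulOpposite.op r.1)))
      (motive := fun y => (w j y l).1 ∈ J') hy ?_ ?_ ?_
    · rintro r _ ⟨y, rfl⟩
      rw [hwr]
      exact J'.smul_mem _ r.2
    · rw [hzero]; exact zero_mem _
    · intro y y' h h'
      rw [hadd]; exact add_mem h h'
  -- Modulo `J'` the product `r * x` is a scalar multiple of `x`, and `x ∉ J'` forces the scalar to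
  -- vanish.
  have hI : ∀ r, r * x ∈ J' → r ∈ R.pointIdeal i := by
    intro r hr
    by_contra h
    have h1 := J'.sub_mem hr (hx (r - algebraMap k _ (R.point i r)) (by
      rw [mem_pointIdeal, map_sub, AlgHom.commutes]
      exact sub_self _))
    rw [← sub_mul, sub_sub_cancel] at h1
    refine hxJ ?_
    have h2 := J'.smul_mem (algebraMap k _ (R.point i r)⁻¹) h1
    rwa [smul_eq_mul, ← mul_assoc, ← map_mul, inv_mul_cancel₀ h, map_one, one_mul] at h2
  have hwI : ∀ j l, (w j z l).1 ∈ R.pointIdeal i := fun j l =>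
    hI _ (by rw [← hwr]; exact hJ _ hz j l)
  have hsum : ∀ j, e z j = (w j z).sum fun l c => c ⊗ₜ b j l := fun j => by
    rw [← TensorProduct.equivFinsuppOfBasisRight_symm_apply]
    exact (LinearEquiv.symm_apply_apply _ _).symm
  have hz' : z = ∑ j, e.symm (Pi.single j (e z j)) := by
    rw [← map_sum, Finset.univ_sum_single, AddEquiv.symm_apply_apply]
  rw [hz']
  refine sum_mem fun j _ => ?_
  rw [hsum j, Finsupp.sum]
  have : Pi.single j (∑ l ∈ (w j z).support, w j z l ⊗ₜ[k] b j l) =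
      ∑ l ∈ (w j z).support, Pi.single (M := fun j => R.row j ⊗[k] V j) j (w j z l ⊗ₜ[k] b j l) :=
    map_sum (AddMonoidHom.single (fun j => R.row j ⊗[k] V j) j) _ _
  rw [this, map_sum]
  refine sum_mem fun l _ => ?_
  -- A coordinate `c` in `e_j R` equals `e_j c`, so each summand of `z` is an element `e_j ⊗ b`
  -- acted on by `c` in the point ideal.
  let g : R.row j := ⟨R.idem j, R.mem_row.mpr (R.idem_mul_idem j)⟩
  have h1 : w j z l = MulOpposite.op (w j z l).1 • g := Subtype.ext (R.mem_row.mp (w j z l).2).symm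
  have h2 : e.symm (Pi.single j (w j z l ⊗ₜ[k] b j l)) =
      a' (MulOpposite.op (w j z l).1) (e.symm (Pi.single j (g ⊗ₜ[k] b j l))) := by
    refine e.injective ?_
    rw [he, AddEquiv.apply_symm_apply, AddEquiv.apply_symm_apply, ← Pi.single_smul,
      TensorProduct.smul_tmul', ← h1]
  rw [h2]
  exact act_mem_actSpan a' (hwI j l) _

/-- Extension of scalars for matric free modules follows from extension of scalars for the
fibers. -/
theorem isExt_of_fibers {A B M M' : Type u} [Ring A] [Ring B] [AddCommGroup M] [Module A M]
    [AddCommGroup M'] [Module B M'] {ρ : A →+* B} {m : M →ₛₗ[ρ] M'}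
    (a : R.carrierᵐᵒᵖ →+* Module.End A M) (a' : R.carrierᵐᵒᵖ →+* Module.End B M')
    (hm : ∀ r x, m (a r x) = a' r (m x))
    {V : Fin p → Type u} [∀ i, AddCommGroup (V i)] [∀ i, Module k (V i)]
    (e : M' ≃+ ∀ i, R.row i ⊗[k] V i)
    (he : ∀ r y, e (a' (MulOpposite.op r) y) = MulOpposite.op r • e y)
    (h : ∀ i, IsRelExt m a a' (R.pointIdeal i)) : IsExt m :=
  -- At `⊤` the quotients are zero; at `⊥` the relative statement is the absolute one.
  IsRelExt.isExt <| R.devissage (IsRelExt m a a') isRelExt_top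
    (fun _ _ i hxJ hx hJ => IsRelExt.step hm hx
      (fun _ hz => R.mem_actSpan_of_mul_mem a' e he hxJ hx hz) (h i) hJ) ⊥

end PtArt

/-! ### Tensor products as cokernels between finite powers. -/

section Power

variable {k : Type u} [Field k] {D : Type u₁} [Category.{v₁} D] [Preadditive D] [Linear k D]

/-- A finite power of an object of a preadditive category. -/
structure Power (J : Type) [Fintype J] [DecidableEq J] (Y : D) where
  X : D
  ι : J → (Y ⟶ X)
  pr : J → (X ⟶ Y)
  ι_pr : ∀ i j, ι i ≫ pr j = if i = j then 𝟙 Y else 0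
  total : ∑ j, pr j ≫ ι j = 𝟙 X

namespace Power

variable {J : Type} [Fintype J] [DecidableEq J] {Y : D}

lemma nonempty (J : Type) [Fintype J] [DecidableEq J] [Limits.HasFiniteBiproducts D] (Y : D) :
    Nonempty (Power J Y) :=
  ⟨{ X := Limits.biproduct fun _ : J => Y
     ι := Limits.biproduct.ι _
     pr := Limits.biproduct.π _
     ι_pr := fun i j => by simp [Limits.biproduct.ι_π]
     total := Limits.biproduct.total }⟩

/-- The image of a finite power under an additive functor. -/
def map {D' : Type u₂} [Category.{v₂} D'] [Preadditive D'] (P : Power J Y) (G : D ⥤ D')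
    [G.Additive] : Power J (G.obj Y) where
  X := G.obj P.X
  ι j := G.map (P.ι j)
  pr j := G.map (P.pr j)
  ι_pr i j := by
    rw [← G.map_comp, P.ι_pr]
    split_ifs
    · exact G.map_id _
    · exact G.map_zero _ _
  total := by
    rw [← G.map_id, ← P.total, G.map_sum]
    exact Finset.sum_congr rfl fun _ _ => (G.map_comp _ _).symm

variable (P : Power J Y)

/-- The morphism from a power given by its components. -/
def desc {Z : D} (f : J → (Y ⟶ Z)) : P.X ⟶ Z := ∑ j, P.pr j ≫ f j

@[simp]
lemma ι_desc {Z : D} (f : J → (Y ⟶ Z)) (j : J) : P.ι j ≫ P.desc f = f j := by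
  simp [desc, Preadditive.comp_sum, ← Category.assoc, ι_pr, ite_comp]

lemma hom_ext {Z : D} {f g : P.X ⟶ Z} (h : ∀ j, P.ι j ≫ f = P.ι j ≫ g) : f = g := by
  rw [← Category.id_comp f, ← Category.id_comp g, ← P.total]
  simp only [Preadditive.sum_comp, Category.assoc, h]

lemma map_desc {D' : Type u₂} [Category.{v₂} D'] [Preadditive D'] (G : D ⥤ D')
    [G.Additive] {Z : D} (f : J → (Y ⟶ Z)) :
    G.map (P.desc f) = (P.map G).desc fun j => G.map (f j) := by
  simp only [desc, map, G.map_sum, G.map_comp]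
  rfl

end Power

end Power

section Tensor

open Limits

variable {k : Type u} [Field k] {D : Type u₁} [Category.{v₁} D] [Preadditive D] [Linear k D]
  {R S T : Type u} [Ring R] [Algebra k R] [Ring S] [Algebra k S] [Ring T] [Algebra k T]

lemma RObj.rmul_add (Y : RObj D (k := k) R) (r s : R) : Y.rmul (r + s) = Y.rmul r + Y.rmul s :=
  map_add Y.act (MulOpposite.op r) (MulOpposite.op s)

lemma RObj.rmul_smul (Y : RObj D (k := k) R) (c : k) (s : R) : Y.rmul (c • s) = c • Y.rmul s :=
  map_smul Y.act c (MulOpposite.op s)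

variable {I J : Type} [Fintype I] [Fintype J] [DecidableEq I] [DecidableEq J]
  (bR : Module.Basis I k R) (bS : Module.Basis J k S) (u : R →ₐ[k] S) (Y : RObj D (k := k) R)

/-- The morphism between powers of `Y` whose cokernel is the tensor product `Y ⊗_R S`. -/
def tensorRel (P : Power J Y.X) (Q : Power (I × J) Y.X) : Q.X ⟶ P.X :=
  Q.desc fun a => (∑ j, bS.repr (u (bR a.1) * bS a.2) j • P.ι j) - Y.rmul (bR a.1) ≫ P.ι a.2

variable {bR bS u Y}

/-- Both sides of the balancing condition are bilinear in `r` and `s`, so it suffices to test it on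
the two bases. -/
lemma tensorRel_comp_eq_zero_iff (P : Power J Y.X) (Q : Power (I × J) Y.X) {Z : D} (g : P.X ⟶ Z)
    (t : S →ₗ[k] (Y.X ⟶ Z)) (ht : ∀ j, t (bS j) = P.ι j ≫ g) :
    tensorRel bR bS u Y P Q ≫ g = 0 ↔ ∀ (r : R) (s : S), t (u r * s) = Y.rmul r ≫ t s := by
  have key : ∀ i j, Q.ι (i, j) ≫ tensorRel bR bS u Y P Q ≫ g =
      t (u (bR i) * bS j) - Y.rmul (bR i) ≫ t (bS j) := fun i j => by
    rw [← Category.assoc, tensorRel, Q.ι_desc, Preadditive.sub_comp, Category.assoc, ht,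
      Preadditive.sum_comp]
    congr 1
    conv_rhs => rw [← bS.sum_repr (u (bR i) * bS j), map_sum]
    refine Finset.sum_congr rfl fun l _ => ?_
    rw [map_smul, ht, Linear.smul_comp]
  refine ⟨fun h r s => ?_, fun h => Q.hom_ext fun a => ?_⟩
  · let l₁ : R →ₗ[k] S →ₗ[k] (Y.X ⟶ Z) := LinearMap.mk₂ k (fun r s => t (u r * s))
      (fun a b c => by rw [map_add, add_mul, map_add])
      (fun a b c => by rw [map_smul, smul_mul_assoc, map_smul])
      (fun a b c => by rw [mul_add, map_add])
      (fun a b c => by rw [mul_smul_comm, map_smul])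
    let l₂ : R →ₗ[k] S →ₗ[k] (Y.X ⟶ Z) := LinearMap.mk₂ k (fun r s => Y.rmul r ≫ t s)
      (fun a b c => by rw [RObj.rmul_add, Preadditive.add_comp])
      (fun a b c => by rw [RObj.rmul_smul, Linear.smul_comp])
      (fun a b c => by rw [map_add, Preadditive.comp_add])
      (fun a b c => by rw [map_smul, Linear.comp_smul])
    have : l₁ = l₂ := bR.ext fun i => bS.ext fun j => by
      have := key i j
      rw [h, comp_zero] at this
      exact (sub_eq_zero.mp this.symm)
    exact congrArg (fun l => l r s) this
  · rw [key a.1 a.2, h, sub_self, comp_zero]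

/-- Rewriting the universal property as a cokernel gives existence of tensor products and their
preservation by right exact functors. -/
lemma isTensor_iff_isColimit (P : Power J Y.X) (Q : Power (I × J) Y.X) {T : D} (π : P.X ⟶ T)
    (t : S →ₗ[k] (Y.X ⟶ T)) (ht : ∀ j, t (bS j) = P.ι j ≫ π) :
    IsTensor u Y t ↔ ∃ w : tensorRel bR bS u Y P Q ≫ π = 0,
      Nonempty (IsColimit (CokernelCofork.ofπ π w)) := by
  have hext : ∀ {Z : D} (t' t'' : S →ₗ[k] (Y.X ⟶ Z)), (∀ j, t' (bS j) = t'' (bS j)) →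
      ∀ s, t' s = t'' s := fun t' t'' h s => congrArg (fun l => l s) (bS.ext (f₁ := t') h)
  have hfac : ∀ {Z : D} (t' : S →ₗ[k] (Y.X ⟶ Z)) (g : P.X ⟶ Z) (_ : ∀ j, t' (bS j) = P.ι j ≫ g)
      (h : T ⟶ Z), (∀ s, t s ≫ h = t' s) ↔ π ≫ h = g := fun t' g hg h => by
    refine ⟨fun H => P.hom_ext fun j => ?_, fun H => ?_⟩
    · rw [← Category.assoc, ← ht, H, hg]
    · refine hext ((Linear.rightComp k _ h) ∘ₗ t) t' fun j => ?_
      change t (bS j) ≫ h = _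
      rw [ht, hg, Category.assoc, H]
  constructor
  · intro h
    have w := (tensorRel_comp_eq_zero_iff (bR := bR) P Q π t ht).mpr h.balanced
    have key : ∀ {Z : D} (g : P.X ⟶ Z), tensorRel bR bS u Y P Q ≫ g = 0 →
        ∃! l : T ⟶ Z, π ≫ l = g := fun {Z} g hg => by
      have hc : ∀ j, bS.constr k (fun j => P.ι j ≫ g) (bS j) = P.ι j ≫ g := fun j =>
        bS.constr_basis _ _ _
      have := h.universal Z _ ((tensorRel_comp_eq_zero_iff (bR := bR) P Q g _ hc).mp hg)
      simpa only [hfac _ g hc] using this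
    exact ⟨w, ⟨CokernelCofork.IsColimit.ofπ π w (fun g hg => (key g hg).choose)
      (fun g hg => (key g hg).choose_spec.1) (fun g hg l hl => (key g hg).choose_spec.2 l hl)⟩⟩
  · rintro ⟨w, ⟨hc⟩⟩
    refine ⟨(tensorRel_comp_eq_zero_iff (bR := bR) P Q π t ht).mp w, fun Z t' ht' => ?_⟩
    have hg : ∀ j, t' (bS j) = P.ι j ≫ P.desc fun j => t' (bS j) := fun j => by rw [P.ι_desc]
    have h0 := (tensorRel_comp_eq_zero_iff (bR := bR) P Q _ t' hg).mpr ht'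
    simp only [hfac _ _ hg]
    exact ⟨hc.desc (CokernelCofork.ofπ _ h0), hc.fac _ WalkingParallelPair.one,
      fun l hl => Cofork.IsColimit.hom_ext hc (hl.trans (hc.fac (CokernelCofork.ofπ _ h0)
        WalkingParallelPair.one).symm)⟩

variable (u Y) in
lemma exists_isTensor [Module.Finite k R] [Module.Finite k S] [HasFiniteBiproducts D]
    [HasCokernels D] : ∃ (T : D) (t : S →ₗ[k] (Y.X ⟶ T)), IsTensor u Y t := by
  classical
  let bR := Module.finBasis k R
  let bS := Module.finBasis k S
  obtain ⟨P⟩ := Power.nonempty (Fin (Module.finrank k S)) Y.X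
  obtain ⟨Q⟩ := Power.nonempty (Fin (Module.finrank k R) × Fin (Module.finrank k S)) Y.X
  let f := tensorRel bR bS u Y P Q
  exact ⟨cokernel f, bS.constr k fun j => P.ι j ≫ cokernel.π f,
    (isTensor_iff_isColimit P Q (cokernel.π f) _ fun j => bS.constr_basis _ _ _).mpr
      ⟨cokernel.condition f, ⟨cokernelIsCokernel f⟩⟩⟩

/-- Right exact functors preserve tensor products with finite dimensional algebras. -/
lemma IsTensor.map [Module.Finite k R] [Module.Finite k S] [HasFiniteBiproducts D]
    {D' : Type u₂} [Category.{v₂} D'] [Preadditive D'] [Linear k D'] (G : D ⥤ D')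
    [G.Additive] [G.Linear k] [PreservesFiniteColimits G] {T : D} {t : S →ₗ[k] (Y.X ⟶ T)}
    (h : IsTensor u Y t) : IsTensor u (Y.map G) ((G.mapLinearMap k) ∘ₗ t) := by
  classical
  let bR := Module.finBasis k R
  let bS := Module.finBasis k S
  obtain ⟨P⟩ := Power.nonempty (Fin (Module.finrank k S)) Y.X
  obtain ⟨Q⟩ := Power.nonempty (Fin (Module.finrank k R) × Fin (Module.finrank k S)) Y.X
  have hπ : ∀ j, t (bS j) = P.ι j ≫ P.desc fun j => t (bS j) := fun j => by rw [P.ι_desc]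
  obtain ⟨w, ⟨hc⟩⟩ := (isTensor_iff_isColimit (bR := bR) P Q _ t hπ).mp h
  have hrel : G.map (tensorRel bR bS u Y P Q) =
      tensorRel bR bS u (Y.map G) (P.map G) (Q.map G) := by
    refine (Power.map_desc Q G _).trans (congrArg (Q.map G).desc (funext fun a => ?_))
    rw [G.map_sub, G.map_sum, G.map_comp]
    congr 1
    exact Finset.sum_congr rfl fun j _ => G.map_smul _ _
  have hc' := isColimitCoforkMapOfIsColimit' G w hc
  refine (isTensor_iff_isColimit (bR := bR) (bS := bS) (P.map G) (Q.map G)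
    (G.map (P.desc fun j => t (bS j))) _ fun j => ?_).mpr ?_
  · change G.map (t (bS j)) = G.map _ ≫ G.map _
    rw [← G.map_comp, ← hπ]
  · have key : ∀ f', G.map (tensorRel bR bS u Y P Q) = f' →
        ∃ w : f' ≫ G.map (P.desc fun j => t (bS j)) = 0,
          Nonempty (IsColimit (CokernelCofork.ofπ _ w)) := by
      rintro _ rfl
      exact ⟨_, ⟨hc'⟩⟩
    exact key _ hrel

/-- A tensor product with `S` carries an action of `S`. -/
lemma IsTensor.exists_orbit {T : D} {t : S →ₗ[k] (Y.X ⟶ T)} (h : IsTensor u Y t) :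
    ∃ (Y' : RObj D (k := k) S) (b : Y.X ⟶ Y'.X), IsTensor u Y (Y'.orbit b) := by
  have key : ∀ s : S, ∃! f : T ⟶ T, ∀ s', t s' ≫ f = t (s' * s) := fun s =>
    h.universal T (t ∘ₗ LinearMap.mulRight k s) fun r s' => by
      have := h.balanced r (s' * s)
      simpa [mul_assoc] using this
  choose f hf _ using key
  let act : Sᵐᵒᵖ →ₐ[k] End T := AlgHom.ofLinearMap
    { toFun := fun s => f s.unop
      map_add' := fun a b => h.hom_ext fun s => by
        change _ = t s ≫ (f a.unop + f b.unop)
        rw [Preadditive.comp_add, hf, hf, hf, MulOpposite.unop_add, mul_add, map_add]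
      map_smul' := fun c a => h.hom_ext fun s => by
        change _ = t s ≫ (c • f a.unop)
        rw [Linear.comp_smul, hf, hf, MulOpposite.unop_smul, mul_smul_comm, map_smul] }
    (h.hom_ext fun s => by
      change t s ≫ f 1 = t s ≫ 𝟙 T
      rw [hf, mul_one, Category.comp_id])
    (fun a b => h.hom_ext fun s => by
      change t s ≫ f (b.unop * a.unop) = t s ≫ f b.unop ≫ f a.unop
      rw [hf, ← Category.assoc, hf, hf, mul_assoc])
  let Y' : RObj D (k := k) S := ⟨T, act⟩
  have hb : Y'.orbit (t 1) = t := LinearMap.ext fun s => by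
    change t 1 ≫ f s = _
    rw [hf, one_mul]
  exact ⟨Y', t 1, by rw [hb]; exact h⟩

/-- This is transitivity `Y ⊗_R T = (Y ⊗_R S) ⊗_S T` read backwards; with `T = k` it identifies the
fibers of a base change. -/
lemma IsTensor.cancel {w : S →ₐ[k] T} {Y' : RObj D (k := k) S} {b : Y.X ⟶ Y'.X} {W : D}
    {t : T →ₗ[k] (Y'.X ⟶ W)} {t' : T →ₗ[k] (Y.X ⟶ W)} (h : IsTensor u Y (Y'.orbit b))
    (ht : ∀ s x, t (w s * x) = Y'.rmul s ≫ t x) (ht' : ∀ x, b ≫ t x = t' x)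
    (h' : IsTensor (w.comp u) Y t') : IsTensor w Y' t where
  balanced := ht
  universal Z t'' ht'' := by
    obtain ⟨g, hg, hu⟩ := h'.universal Z (Linear.leftComp k Z b ∘ₗ t'') fun r s => by
      change b ≫ t'' (w (u r) * s) = Y.rmul r ≫ b ≫ t'' s
      rw [ht'', ← Category.assoc, ← Category.assoc, h.equivariant]
    have hg' : ∀ x, b ≫ t x ≫ g = b ≫ t'' x := fun x => by
      rw [← Category.assoc, ht']; exact hg x
    refine ⟨g, fun x => h.hom_ext fun s => ?_, fun g' hg'' => hu g' fun x => ?_⟩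
    · rw [RObj.orbit_apply, Category.assoc, Category.assoc, ← ht'', ← Category.assoc (Y'.rmul s),
        ← ht, hg']
    · change _ = b ≫ t'' x
      rw [← ht', Category.assoc, hg'']

lemma IsTensor.exists_iso {T T' : D} {t : S →ₗ[k] (Y.X ⟶ T)} {t' : S →ₗ[k] (Y.X ⟶ T')}
    (h : IsTensor u Y t) (h' : IsTensor u Y t') : ∃ τ : T ≅ T', ∀ s, t s ≫ τ.hom = t' s := by
  obtain ⟨σ, hσ, -⟩ := h.universal T' t' h'.balanced
  obtain ⟨σ', hσ', -⟩ := h'.universal T t h.balanced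
  exact ⟨⟨σ, σ', h.hom_ext fun s => by rw [← Category.assoc, hσ, hσ', Category.comp_id],
    h'.hom_ext fun s => by rw [← Category.assoc, hσ', hσ, Category.comp_id]⟩, hσ⟩

lemma IsTensor.of_iso {T T' : D} {t : S →ₗ[k] (Y.X ⟶ T)} {t' : S →ₗ[k] (Y.X ⟶ T')}
    (h : IsTensor u Y t) (τ : T ≅ T') (hτ : ∀ s, t s ≫ τ.hom = t' s) : IsTensor u Y t' where
  balanced r s := by rw [← hτ, ← hτ, h.balanced, Category.assoc]
  universal Z t'' ht'' := by
    obtain ⟨g, hg, hu⟩ := h.universal Z t'' ht''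
    refine ⟨τ.inv ≫ g, fun s => ?_, fun g' hg' => ?_⟩
    · rw [← hτ, Category.assoc, Iso.hom_inv_id_assoc, hg]
    · rw [Iso.eq_inv_comp]
      refine hu _ fun s => ?_
      rw [← Category.assoc, hτ, hg']

/-- Fully faithful functors reflect tensor products. -/
lemma IsTensor.of_map {D' : Type u₂} [Category.{v₂} D'] [Preadditive D'] [Linear k D'] (G : D ⥤ D')
    [G.Additive] [G.Linear k] [G.Full] [G.Faithful] {T : D} {t : S →ₗ[k] (Y.X ⟶ T)}
    (h : IsTensor u (Y.map G) ((G.mapLinearMap k) ∘ₗ t)) : IsTensor u Y t where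
  balanced r s := G.map_injective <| (h.balanced r s).trans (G.map_comp _ _).symm
  universal Z t' ht' := by
    obtain ⟨g, hg, hu⟩ := h.universal (G.obj Z) ((G.mapLinearMap k) ∘ₗ t') fun r s =>
      (congrArg G.map (ht' r s)).trans (G.map_comp _ _)
    obtain ⟨g, rfl⟩ := G.map_surjective g
    refine ⟨g, fun s => G.map_injective <| (G.map_comp _ _).trans (hg s), fun g' hg' =>
      G.map_injective <| hu _ fun s => (G.map_comp _ _).symm.trans (congrArg G.map (hg' s))⟩

end Tensor

open Limits

/-! ### Sections and fibers of liftings of presheaves. -/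

section Fiber

variable {k : Type u} [Field k] {C : Type u₁} [Category.{v₁} C] (A : Cᵒᵖ ⥤ AlgCat.{u} k)

instance (c : C) : (fiber A c).Additive := by unfold fiber; infer_instance

instance (c : C) : (fiber A c).Linear k where
  map_smul f a := by
    ext x
    exact (f.app (op c)).hom.map_smul (algebraMap k (A.obj (op c)) a) x

instance (c : C) : PreservesFiniteColimits (fiber A c) := by
  unfold fiber
  exact comp_preservesFiniteColimits _ _

instance : HasFiniteBiproducts (PreShMod A) := HasFiniteBiproducts.of_hasFiniteProducts

variable {A}

/-- The action on the sections over an object. -/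
def actAt {R : Type u} [Ring R] [Algebra k R] (Y : RObj (PreShMod A) (k := k) R) (c : Cᵒᵖ) :
    Rᵐᵒᵖ →+* Module.End ((A ⋙ forget₂ (AlgCat.{u} k) RingCat.{u}).obj c) (Y.X.obj c) where
  toFun r := ((Y.act r).app c).hom
  map_one' := by rw [map_one]; rfl
  map_mul' r s := by rw [map_mul]; rfl
  map_zero' := by rw [map_zero]; rfl
  map_add' r s := by rw [map_add]; rfl

lemma actAt_resMap {R : Type u} [Ring R] [Algebra k R] (Y : RObj (PreShMod A) (k := k) R)
    {c d : Cᵒᵖ} (f : c ⟶ d) (r : Rᵐᵒᵖ) (x : Y.X.obj c) :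
    resMap Y.X f (actAt Y c r x) = actAt Y d r (resMap Y.X f x) :=
  (resMap_naturality (Y.act r) f x).symm

end Fiber

section Point

variable {k : Type u} [Field k] {R : Type u} [Ring R] [Algebra k R] {χ : R →ₐ[k] k}

lemma IsTensor.surjective_of_point {Y : RObj (ModuleCat.{u} k) (k := k) R} {V : ModuleCat.{u} k}
    {q : Y.X ⟶ V} (h : IsTensor χ Y (LinearMap.toSpanSingleton k (Y.X ⟶ V) q)) :
    Function.Surjective q := by
  refine (ModuleCat.epi_iff_surjective q).mp ⟨fun f g e => h.hom_ext fun s => ?_⟩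
  simp [e]

/-- As `r - χ r` lies in the kernel of `χ`, killing the kernel already makes `g` balanced; so the
fiber is the quotient of `Y` by the action of this kernel. -/
lemma IsTensor.exists_factor_of_point {Y : RObj (ModuleCat.{u} k) (k := k) R}
    {V Z : ModuleCat.{u} k}
    {q : Y.X ⟶ V} (h : IsTensor χ Y (LinearMap.toSpanSingleton k (Y.X ⟶ V) q))
    (g : Y.X ⟶ Z) (hg : ∀ r, χ r = 0 → Y.rmul r ≫ g = 0) : ∃ l : V ⟶ Z, q ≫ l = g := by
  have hg' : ∀ r, Y.rmul r ≫ g = χ r • g := fun r => by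
    have h1 := hg (r - algebraMap k R (χ r)) (by rw [map_sub, AlgHom.commutes]; exact sub_self _)
    have h2 : Y.rmul (algebraMap k R (χ r)) = χ r • 𝟙 _ := by
      rw [Algebra.algebraMap_eq_smul_one, RObj.rmul_smul, RObj.rmul_one]
    have h3 : Y.rmul r = Y.rmul (r - algebraMap k R (χ r)) + χ r • 𝟙 _ := by
      rw [← h2, ← RObj.rmul_add, sub_add_cancel]
    rw [h3, Preadditive.add_comp, h1, zero_add, Linear.smul_comp, Category.id_comp]
  obtain ⟨l, hl, -⟩ := h.universal Z (LinearMap.toSpanSingleton k (Y.X ⟶ Z) g) fun r s => by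
    simp [hg', mul_smul, smul_comm s]
  exact ⟨l, by simpa using hl 1⟩

end Point

section Extension

variable {k : Type u} [Field k] {C : Type u₁} [Category.{v₁} C] {A : Cᵒᵖ ⥤ AlgCat.{u} k}

/-- Linear maps from the sections over an object as morphisms of vector spaces. -/
def fiberHom {c : C} (M : PreShMod A) {N : Type u} [AddCommGroup N]
    [Module ((A ⋙ forget₂ (AlgCat.{u} k) RingCat.{u}).obj (op c)) N]
    (φ : M.obj (op c) →ₗ[(A ⋙ forget₂ (AlgCat.{u} k) RingCat.{u}).obj (op c)] N) :
    (fiber A c).obj M ⟶ (ModuleCat.restrictScalars (algebraMap k (A.obj (op c)))).obj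
      (show ModuleCat (A.obj (op c)) from
        ModuleCat.of ((A ⋙ forget₂ (AlgCat.{u} k) RingCat.{u}).obj (op c)) N) :=
  (ModuleCat.restrictScalars (algebraMap k (A.obj (op c)))).map
    (X := show ModuleCat (A.obj (op c)) from M.obj (op c)) (ModuleCat.ofHom φ)

variable {p : ℕ} {R : PtArt k p} {Y : RObj (PreShMod A) (k := k) R.carrier}

section

variable {V : PreShMod A} {i : Fin p} {q : Y.X ⟶ V}
  (h : IsTensor (R.point i) Y (LinearMap.toSpanSingleton k (Y.X ⟶ V) q))
include h

lemma IsTensor.fiber_point (c : C) : IsTensor (R.point i) (Y.map (fiber A c))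
    (LinearMap.toSpanSingleton k _ ((fiber A c).map q)) := by
  have h1 := h.map (fiber A c)
  have h2 : ((fiber A c).mapLinearMap k) ∘ₗ LinearMap.toSpanSingleton k (Y.X ⟶ V) q =
      LinearMap.toSpanSingleton k _ ((fiber A c).map q) := by
    ext; simp
  exact (congrArg (IsTensor (R.point i) (Y.map (fiber A c))) h2).mp h1

lemma IsTensor.point_surjective (c : C) : Function.Surjective (q.app (op c)) :=
  (h.fiber_point c).surjective_of_point

lemma IsTensor.point_eq_zero_iff (c : C) (x : Y.X.obj (op c)) :
    q.app (op c) x = 0 ↔ x ∈ actSpan (actAt Y (op c)) (R.pointIdeal i) := by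
  constructor
  · intro hx
    let S := actSpan (actAt Y (op c)) (R.pointIdeal i)
    obtain ⟨l, hl⟩ := (h.fiber_point c).exists_factor_of_point (fiberHom Y.X S.mkQ) fun r hr => by
      ext y
      exact (Submodule.Quotient.mk_eq_zero _).mpr (act_mem_actSpan (actAt Y (op c))
        (R.mem_pointIdeal.mpr hr) y)
    have h1 : l (q.app (op c) x) = S.mkQ x := congrArg (fun g => g.hom x) hl
    exact (Submodule.Quotient.mk_eq_zero _).mp
      (h1.symm.trans ((congrArg l.hom hx).trans (map_zero l.hom)))
  · refine map_eq_zero_of_mem_actSpan (φ := (q.app (op c)).hom) fun r hr y => ?_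
    have h1 : Y.rmul r ≫ q = 0 := by
      have := h.balanced r 1
      rw [show R.point i r = 0 from hr, zero_mul, map_zero] at this
      simpa using this.symm
    exact congrArg (fun g => (g.app (op c)).hom y) h1

end

/-- A lifting of a family of presheaves of modules all of whose restriction maps are extensions of
scalars has the same property. -/
lemma IsLifting.isExtPresheaf {F : Fin p → PreShMod A} {q : ∀ i, Y.X ⟶ F i}
    (h : IsLifting (𝟭 (PreShMod A)) F R Y q) (hF : ∀ i, IsExtPresheaf (F i)) :
    IsExtPresheaf Y.X := by
  rintro ⟨c⟩ ⟨d⟩ f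
  obtain ⟨e, he⟩ := h.free d
  exact R.isExt_of_fibers (actAt Y (op c)) (actAt Y (op d)) (actAt_resMap Y f)
    (V := fun i => (NCDef.fiber A d).obj (F i)) e he fun i =>
      isRelExt_of_isExt (hF i f) ((q i).app (op c)).hom ((q i).app (op d)).hom
        ((h.fiber i).point_surjective c) ((h.fiber i).point_surjective d)
        (fun x => resMap_naturality (q i) f x)
        (fun x hx => ((h.fiber i).point_eq_zero_iff c x).mp hx) ((h.fiber i).point_eq_zero_iff d)

end Extension

section Induction

variable {k : Type u} [Field k] {R S : Type u} [Ring R] [Algebra k R] [Ring S] [Algebra k S]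
  {u : R →ₐ[k] S}

/-- A tensor product of modules is generated by pure tensors. -/
lemma IsTensor.induction {Y : RObj (ModuleCat.{u} k) (k := k) R} {T : ModuleCat.{u} k}
    {t : S →ₗ[k] (Y.X ⟶ T)} (h : IsTensor u Y t) {P : T → Prop}
    (mem : ∀ s y, P ((t s).hom y)) (add : ∀ z z', P z → P z' → P (z + z')) (z : T) : P z := by
  -- Sums of pure tensors already form a subspace, because scalars can be moved into `y`; the
  -- quotient by it vanishes by uniqueness of maps out of a tensor product.
  let G : AddSubmonoid T := AddSubmonoid.closure {z | ∃ s y, (t s).hom y = z}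
  let W : Submodule k T :=
    { carrier := G
      add_mem' := G.add_mem
      zero_mem' := G.zero_mem
      smul_mem' := fun c z (hz : z ∈ G) => by
        change c • z ∈ G
        induction hz using AddSubmonoid.closure_induction with
        | mem z hz =>
          obtain ⟨s, y, rfl⟩ := hz
          exact AddSubmonoid.subset_closure ⟨s, c • y, map_smul (t s).hom c y⟩
        | zero => rw [smul_zero]; exact zero_mem _
        | add a b _ _ ha hb => rw [smul_add]; exact add_mem ha hb }
  have h0 : ModuleCat.ofHom W.mkQ = 0 := h.hom_ext fun s => by
    ext y
    exact (Submodule.Quotient.mk_eq_zero _).mpr (AddSubmonoid.subset_closure ⟨s, y, rfl⟩)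
  have hz : z ∈ G := (Submodule.Quotient.mk_eq_zero W).mp (congrArg (fun g => g.hom z) h0)
  induction hz using AddSubmonoid.closure_induction with
  | mem z hz =>
    obtain ⟨s, y, rfl⟩ := hz
    exact mem s y
  | zero =>
    have := mem 0 0
    rwa [map_zero] at this
  | add a b _ _ ha hb => exact add a b ha hb

end Induction

/-! ### Base change of matric free modules. -/

section RowTensor

variable {k : Type u} [Field k] {p : ℕ} {R S : PtArt k p} (f : R ⟶ S)

lemma PtArt.Hom.map_idem (i : Fin p) : f.toAlgHom (R.idem i) = S.idem i :=
  DFunLike.congr_fun f.comp_incl (Pi.single i 1)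

/-- The element `e_i` of `e_i R`. -/
def PtArt.rowGen (R : PtArt k p) (i : Fin p) : R.row i :=
  ⟨R.idem i, R.mem_row.mpr (R.idem_mul_idem i)⟩

lemma PtArt.op_smul_rowGen {i : Fin p} (x : R.row i) : MulOpposite.op x.1 • R.rowGen i = x :=
  Subtype.ext (R.mem_row.mp x.2)

/-- The map `r ↦ f r * s` from `e_i R` to `e_i S`. -/
def PtArt.Hom.rowMap (i : Fin p) : S.carrier →ₗ[k] R.row i →ₗ[k] S.row i :=
  LinearMap.mk₂ k (fun s r => ⟨f.toAlgHom r.1 * s, S.mem_row.mpr (by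
      rw [← mul_assoc, ← f.map_idem, ← map_mul, R.mem_row.mp r.2])⟩)
    (fun a b c => Subtype.ext (mul_add _ _ _))
    (fun a b c => Subtype.ext (mul_smul_comm _ _ _))
    (fun a b c => Subtype.ext (by
      change f.toAlgHom (b.1 + c.1) * a = f.toAlgHom b.1 * a + f.toAlgHom c.1 * a
      rw [map_add, add_mul]))
    (fun a b c => Subtype.ext (by
      change f.toAlgHom (a • c.1) * b = a • (f.toAlgHom c.1 * b)
      rw [map_smul, smul_mul_assoc]))

variable {V : Fin p → Type u} [∀ i, AddCommGroup (V i)] [∀ i, Module k (V i)]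

variable (R V) in
/-- The module `⨁ i, e_i R ⊗ V_i`. -/
def rowModule : RObj (ModuleCat.{u} k) (k := k) R.carrier where
  X := ModuleCat.of k (∀ i, R.row i ⊗[k] V i)
  act := AlgHom.ofLinearMap
    { toFun := fun r => ModuleCat.ofHom
        { toFun := fun y => r • y
          map_add' := smul_add r
          map_smul' := fun c y => smul_comm r c y }
      map_add' := fun r s => ModuleCat.hom_ext (LinearMap.ext fun y => add_smul r s y)
      map_smul' := fun c r => ModuleCat.hom_ext (LinearMap.ext fun y => smul_assoc c r y) }
    (ModuleCat.hom_ext (LinearMap.ext fun y => one_smul _ y))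
    (fun r s => ModuleCat.hom_ext (LinearMap.ext fun y => mul_smul r s y))

/-- Base change of `⨁ i, e_i R ⊗ V_i`. -/
def rowOrbit : S.carrier →ₗ[k] ((rowModule R V).X ⟶ (rowModule S V).X) where
  toFun s := ModuleCat.ofHom (LinearMap.pi fun i =>
    ((f.rowMap i s).rTensor (V i)) ∘ₗ LinearMap.proj i)
  map_add' s s' := by
    refine ModuleCat.hom_ext (LinearMap.ext fun y => funext fun i => ?_)
    change ((f.rowMap i (s + s')).rTensor (V i)) (y i) = _
    rw [map_add, LinearMap.rTensor_add]; rfl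
  map_smul' c s := by
    refine ModuleCat.hom_ext (LinearMap.ext fun y => funext fun i => ?_)
    change ((f.rowMap i (c • s)).rTensor (V i)) (y i) = _
    rw [map_smul, LinearMap.rTensor_smul]; rfl

lemma rowOrbit_single (s : S.carrier) (i : Fin p) (r : R.row i) (v : V i) :
    (rowOrbit f s).hom (Pi.single i (r ⊗ₜ[k] v)) =
      Pi.single (M := fun i => S.row i ⊗[k] V i) i (f.rowMap i s r ⊗ₜ[k] v) := by
  classical
  funext j
  change ((f.rowMap j s).rTensor (V j)) (Pi.single (M := fun i => R.row i ⊗[k] V i) i _ j) = _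
  rcases eq_or_ne j i with rfl | h
  · rw [Pi.single_eq_same, Pi.single_eq_same, LinearMap.rTensor_tmul]
  · rw [Pi.single_eq_of_ne h, Pi.single_eq_of_ne h, map_zero]

lemma PtArt.Hom.rowMap_rowGen (i : Fin p) (s : S.row i) : f.rowMap i s.1 (R.rowGen i) = s :=
  Subtype.ext (by
    change f.toAlgHom (R.idem i) * s.1 = s.1
    rw [f.map_idem, S.mem_row.mp s.2])

lemma rowModule_hom_ext {Z : ModuleCat.{u} k} {g h : (rowModule R V).X ⟶ Z}
    (H : ∀ i (r : R.row i) (v : V i), g.hom (Pi.single i (r ⊗ₜ[k] v)) =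
      h.hom (Pi.single i (r ⊗ₜ[k] v))) : g = h := by
  classical
  refine ModuleCat.hom_ext (LinearMap.pi_ext' fun i => TensorProduct.ext' fun r v => ?_)
  exact H i r v

lemma rowModule_rmul_single (i : Fin p) (r : R.row i) (v : V i) :
    ((rowModule R V).rmul r.1).hom (Pi.single i (R.rowGen i ⊗ₜ[k] v)) =
      Pi.single (M := fun i => R.row i ⊗[k] V i) i (r ⊗ₜ[k] v) := by
  classical
  change MulOpposite.op r.1 • (Pi.single i (R.rowGen i ⊗ₜ[k] v) : ∀ i, R.row i ⊗[k] V i) = _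
  rw [← Pi.single_smul, TensorProduct.smul_tmul', R.op_smul_rowGen]

/-- Since `f` preserves the idempotents, `e_i R ⊗_R S = e_i S`. A balanced family is determined by
its values on `e_i ⊗ v`, from which `h` is built. -/
lemma isTensor_rowOrbit :
    IsTensor f.toAlgHom (rowModule R V) (rowOrbit (V := V) f) where
  balanced r s := rowModule_hom_ext fun i x v => by
    rw [rowOrbit_single]
    change _ = (rowOrbit f s).hom
      (MulOpposite.op r • (Pi.single i (x ⊗ₜ[k] v) : ∀ i, R.row i ⊗[k] V i))
    rw [← Pi.single_smul, TensorProduct.smul_tmul', rowOrbit_single]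
    congr 2
    refine Subtype.ext ?_
    change f.toAlgHom x.1 * (f.toAlgHom r * s) = f.toAlgHom (x.1 * r) * s
    rw [map_mul, mul_assoc]
  universal Z t' ht' := by
    let h : (rowModule S V).X ⟶ Z := ModuleCat.ofHom <|
      LinearMap.lsum k (fun i => S.row i ⊗[k] V i) k
      fun i => TensorProduct.lift <| LinearMap.mk₂ k
        (fun s v => (t' s.1).hom (Pi.single i (R.rowGen i ⊗ₜ[k] v)))
        (fun a b v => by
          change (t' (a.1 + b.1)).hom _ = _
          rw [map_add]; rfl)
        (fun c a v => by
          change (t' (c • a.1)).hom _ = _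
          rw [map_smul]; rfl)
        (fun a v w => by
          rw [TensorProduct.tmul_add, Pi.single_add]
          exact map_add (t' a.1).hom _ _)
        (fun c a v => by
          rw [TensorProduct.tmul_smul, Pi.single_smul]
          exact map_smul (t' a.1).hom _ _)
    have hh : ∀ i (s : S.row i) (v : V i), h.hom (Pi.single i (s ⊗ₜ[k] v)) =
        (t' s.1).hom (Pi.single i (R.rowGen i ⊗ₜ[k] v)) := fun i s v => by
      refine (LinearMap.lsum_piSingle k _ k _ i _).trans ?_
      rw [TensorProduct.lift.tmul]
      rfl
    refine ⟨h, fun s => rowModule_hom_ext fun i r v => ?_, fun h' hh' =>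
      rowModule_hom_ext fun i s v => ?_⟩
    · change h.hom ((rowOrbit f s).hom _) = _
      rw [rowOrbit_single, hh]
      change (t' (f.toAlgHom r.1 * s)).hom _ = _
      rw [ht']
      change (t' s).hom (((rowModule R V).rmul r.1).hom _) = _
      rw [rowModule_rmul_single]
    · rw [hh, ← hh']
      change _ = h'.hom ((rowOrbit f s.1).hom _)
      rw [rowOrbit_single, f.rowMap_rowGen]

lemma IsTensor.of_iso_left {D : Type u₁} [Category.{v₁} D] [Preadditive D] [Linear k D]
    {R S : Type u} [Ring R] [Algebra k R] [Ring S] [Algebra k S] {u : R →ₐ[k] S}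
    {Y Y' : RObj D (k := k) R} {T : D} {t : S →ₗ[k] (Y'.X ⟶ T)} (h : IsTensor u Y' t)
    (τ : Y.X ≅ Y'.X) (hτ : ∀ r, Y.rmul r ≫ τ.hom = τ.hom ≫ Y'.rmul r) :
    IsTensor u Y (Linear.leftComp k T τ.hom ∘ₗ t) where
  balanced r s := by
    change τ.hom ≫ t _ = Y.rmul r ≫ τ.hom ≫ t s
    rw [h.balanced, ← Category.assoc, ← Category.assoc, hτ]
  universal Z t' ht' := by
    obtain ⟨g, hg, hu⟩ := h.universal Z (Linear.leftComp k Z τ.inv ∘ₗ t') fun r s => by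
      change τ.inv ≫ t' _ = Y'.rmul r ≫ τ.inv ≫ t' s
      rw [ht', ← Category.assoc, ← Category.assoc]
      congr 1
      rw [Iso.inv_comp_eq, ← Category.assoc, ← hτ, Category.assoc, Iso.hom_inv_id,
        Category.comp_id]
    refine ⟨g, fun s => ?_, fun g' hg' => hu g' fun s => ?_⟩
    · change (τ.hom ≫ t s) ≫ g = t' s
      rw [Category.assoc, hg]
      exact τ.hom_inv_id_assoc _
    · change _ = τ.inv ≫ t' s
      rw [← hg' s]
      change _ = τ.inv ≫ (τ.hom ≫ t s) ≫ g'
      rw [Category.assoc, Iso.inv_hom_id_assoc]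

/-- Matric freeness is preserved by base change. -/
lemma exists_row_equiv {Y : RObj (ModuleCat.{u} k) (k := k) R.carrier}
    {Y' : RObj (ModuleCat.{u} k) (k := k) S.carrier} {b : Y.X ⟶ Y'.X}
    (h : IsTensor f.toAlgHom Y (Y'.orbit b)) (e : Y.X ≃+ ∀ i, R.row i ⊗[k] V i)
    (he : ∀ r y, e ((Y.rmul r).hom y) = MulOpposite.op r • e y) :
    ∃ e' : Y'.X ≃+ ∀ i, S.row i ⊗[k] V i,
      ∀ s y, e' ((Y'.rmul s).hom y) = MulOpposite.op s • e' y := by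
  let eL : Y.X ≃ₗ[k] (rowModule R V).X :=
    { e with
      -- A scalar of `k` acts as an element of `R`, so the additive `R`-linear map `e` is
      -- `k`-linear.
      map_smul' := fun c y => by
        have h1 : (Y.rmul (c • 1)).hom y = c • y := by
          rw [Y.rmul_smul, Y.rmul_one]; rfl
        change e (c • y) = c • e y
        rw [← h1, he, MulOpposite.op_smul, MulOpposite.op_one, smul_assoc, one_smul] }
  have ht := (isTensor_rowOrbit (V := V) f).of_iso_left (Y := Y) eL.toModuleIso fun r =>
    ModuleCat.hom_ext (LinearMap.ext fun y => he r y)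
  obtain ⟨τ, hτ⟩ := h.exists_iso ht
  -- The comparison of tensor products respects `S`, because on both sides `S` acts through right
  -- multiplication on the parameter `s'`.
  have hcomm : ∀ s, Y'.rmul s ≫ τ.hom = τ.hom ≫ (rowModule S V).rmul s := fun s =>
    h.hom_ext fun s' => by
      have h1 : Y'.orbit b s' ≫ Y'.rmul s = Y'.orbit b (s' * s) := by
        rw [RObj.orbit_apply, RObj.orbit_apply, RObj.rmul_mul, Category.assoc]
      rw [← Category.assoc, h1, hτ, ← Category.assoc, hτ]
      change eL.toModuleIso.hom ≫ _ = (eL.toModuleIso.hom ≫ _) ≫ _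
      rw [Category.assoc]
      congr 1
      refine rowModule_hom_ext fun i r v => ?_
      rw [rowOrbit_single]
      refine Eq.trans ?_ (congrArg (fun z : ∀ i, S.row i ⊗[k] V i => MulOpposite.op s • z)
        (rowOrbit_single f s' i r v).symm)
      rw [← Pi.single_smul, TensorProduct.smul_tmul']
      congr 2
      refine Subtype.ext ?_
      exact (mul_assoc _ _ _).symm
  exact ⟨τ.toLinearEquiv.toAddEquiv, fun s y => congrArg (fun g => g.hom y) (hcomm s)⟩

end RowTensor

open Limits

section PresheafBaseChange

variable {k : Type u} [Field k] {p : ℕ} {C : Type u₁} [Category.{v₁} C] {A : Cᵒᵖ ⥤ AlgCat.{u} k}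

lemma IsMatricFree.of_isTensor {F : Fin p → PreShMod A} {R S : PtArt k p} (f : R ⟶ S)
    {Y : RObj (PreShMod A) (k := k) R.carrier} {Y' : RObj (PreShMod A) (k := k) S.carrier}
    {b : Y.X ⟶ Y'.X} (h : IsTensor f.toAlgHom Y (Y'.orbit b))
    (hY : IsMatricFree (𝟭 (PreShMod A)) F R Y) : IsMatricFree (𝟭 (PreShMod A)) F S Y' := by
  intro c
  obtain ⟨e, he⟩ := hY c
  have h1 := h.map (fiber A c)
  have h2 : ((fiber A c).mapLinearMap k) ∘ₗ Y'.orbit b =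
      (Y'.map (fiber A c)).orbit ((fiber A c).map b) :=
    LinearMap.ext fun s => (fiber A c).map_comp _ _
  exact exists_row_equiv f (Y := Y.map (fiber A c)) (Y' := Y'.map (fiber A c))
    (V := fun i => (fiber A c).obj (F i))
    ((congrArg (IsTensor f.toAlgHom (Y.map (fiber A c))) h2).mp h1) e he

/-- Base change exists for liftings in categories of presheaves of modules. -/
theorem hasBaseChange_presheaf (F : Fin p → PreShMod A) :
    HasBaseChange (𝟭 (PreShMod A)) F := by
  intro R S f L
  obtain ⟨T, t, ht⟩ := exists_isTensor f.toAlgHom L.Y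
  obtain ⟨Y', b, hb⟩ := ht.exists_orbit
  -- The structure map to `F i` must send `y ⊗ s` to `S.point i s` times `L.q i y`; this is balanced
  -- because `f` respects augmentations.
  have hq : ∀ i, ∃ q : Y'.X ⟶ F i, ∀ s, Y'.orbit b s ≫ q = S.point i s • L.q i := fun i =>
    (hb.universal (F i) ((LinearMap.toSpanSingleton k _ (L.q i)) ∘ₗ (S.point i).toLinearMap)
      fun r s => by
        change S.point i (f.toAlgHom r * s) • L.q i = L.Y.rmul r ≫ (S.point i s • L.q i)
        rw [Linear.comp_smul, L.rmul_q, smul_smul, mul_comm, map_mul]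
        congr 2
        exact congrFun (DFunLike.congr_fun f.aug_comp r) i).exists
  choose q hq using hq
  have hbq : ∀ i, b ≫ q i = L.q i := fun i => by
    have := hq i 1
    rwa [RObj.orbit_apply, RObj.rmul_one, Category.comp_id, map_one, one_smul] at this
  have hsq : ∀ i s, Y'.rmul s ≫ q i = S.point i s • q i := fun i s => hb.hom_ext fun s' => by
    rw [Linear.comp_smul, hq, RObj.orbit_apply, Category.assoc, ← Category.assoc (Y'.rmul s'),
      ← RObj.rmul_mul, ← Category.assoc, ← RObj.orbit_apply, hq, map_mul, mul_comm, smul_smul]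
  refine ⟨⟨Y', q, ⟨L.isLifting.free.of_isTensor f hb, fun i => ?_⟩⟩, b, ⟨hb, hbq⟩⟩
  have hpt : (S.point i).comp f.toAlgHom = R.point i :=
    AlgHom.ext fun r => congrFun (DFunLike.congr_fun f.aug_comp r) i
  refine hb.cancel (fun s x => ?_) (fun x => ?_) (hpt ▸ L.isLifting.fiber i)
  · simp [hsq, mul_smul, smul_comm x]
  · simp [hbq]

end PresheafBaseChange

/-! ### Tensor products preserve the extension property. -/

section TensorExtension

variable {k : Type u} [Field k] {C : Type u₁} [Category.{v₁} C] {A : Cᵒᵖ ⥤ AlgCat.{u} k}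
  {R S : Type u} [Ring R] [Algebra k R] [Ring S] [Algebra k S] [Module.Finite k R]
  [Module.Finite k S] {u : R →ₐ[k] S} {Y : RObj (PreShMod A) (k := k) R} {T : PreShMod A}
  {t : S →ₗ[k] (Y.X ⟶ T)}

lemma IsTensor.fiber_induction (h : IsTensor u Y t) (c : Cᵒᵖ) {P : T.obj c → Prop}
    (mem : ∀ s y, P ((t s).app c y)) (add : ∀ z z', P z → P z' → P (z + z')) (z : T.obj c) :
    P z :=
  (h.map (fiber A c.unop)).induction mem add z

lemma actAt_smul (c : Cᵒᵖ) (a : k) (y : Y.X.obj c) :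
    actAt Y c (MulOpposite.op (algebraMap k R a)) y =
      (show (A ⋙ forget₂ (AlgCat.{u} k) RingCat.{u}).obj c from algebraMap k (A.obj c) a) • y := by
  have h1 : Y.rmul (algebraMap k R a) = a • 𝟙 _ := by
    rw [Algebra.algebraMap_eq_smul_one, RObj.rmul_smul, RObj.rmul_one]
  exact congrArg (fun g => (g.app c).hom y) h1

/-- The tensor product of presheaves of modules whose restriction maps are extensions of scalars
has the same property. -/
lemma IsTensor.isExtPresheaf (h : IsTensor u Y t) (hY : IsExtPresheaf Y.X) :
    IsExtPresheaf T := by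
  rintro c ⟨d⟩ f N _ _ φ
  -- For each fixed `s` extend `y ↦ φ (y ⊗ s)` from sections over `c` to sections over `d`;
  -- uniqueness makes the family of extensions linear and balanced in `s`.
  have hχ : ∀ s, ∃! χ : Y.X.obj (op d) →ₗ[_] N, ∀ y, χ (resMap Y.X f y) = φ ((t s).app c y) :=
    fun s => hY f N (φ.comp ((t s).app c).hom)
  choose χ hχ hχu using hχ
  have hbal : ∀ r s y, χ (u r * s) y = χ s (actAt Y (op d) (MulOpposite.op r) y) := by
    intro r s y
    refine LinearMap.congr_fun (hχu (u r * s) ((χ s).comp (actAt Y (op d) (MulOpposite.op r)))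
      fun y => ?_).symm y
    rw [LinearMap.comp_apply, ← actAt_resMap, hχ, h.balanced]
    rfl
  have hadd : ∀ s s' y, χ (s + s') y = χ s y + χ s' y := by
    intro s s' y
    refine LinearMap.congr_fun (hχu (s + s') (χ s + χ s') fun y => ?_).symm y
    rw [LinearMap.add_apply, hχ, hχ, map_add, ← map_add]
    rfl
  have hsmul : ∀ (a : k) s y, χ (a • s) y =
      (show (A ⋙ forget₂ (AlgCat.{u} k) RingCat.{u}).obj (op d) from
        algebraMap k (A.obj (op d)) a) • χ s y := fun a s y => by
    rw [Algebra.smul_def, ← AlgHom.commutes u, hbal, actAt_smul, map_smul]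
  let t' : S →ₗ[k] ((Y.map (fiber A d)).X ⟶ _) :=
    { toFun := fun s => fiberHom Y.X (χ s)
      map_add' := fun s s' => ModuleCat.hom_ext (LinearMap.ext fun y => hadd s s' y)
      map_smul' := fun a s => ModuleCat.hom_ext (LinearMap.ext fun y => hsmul a s y) }
  obtain ⟨g, hg, -⟩ := (h.map (fiber A d)).universal _ t' fun r s =>
    ModuleCat.hom_ext (LinearMap.ext fun y => hbal r s y)
  have hg' : ∀ s y, g.hom ((t s).app (op d) y) = χ s y := fun s y =>
    congrArg (fun l => l.hom y) (hg s)
  let ψ : T.obj (op d) →ₗ[(A ⋙ forget₂ (AlgCat.{u} k) RingCat.{u}).obj (op d)] N :=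
    { toFun := fun z => g.hom z
      map_add' := fun z z' => map_add g.hom z z'
      map_smul' := fun a z => by
        -- The universal property on fibers only provides a `k`-linear map; linearity over `A(d)` is
        -- tested on pure tensors.
        refine h.fiber_induction (op d) (P := fun z => g.hom (a • z) = a • g.hom z)
          (fun s y => ?_) (fun z z' hz hz' => ?_) z
        · refine (congrArg g.hom (((t s).app (op d)).hom.map_smul a y).symm).trans ?_
          exact (hg' s (a • y)).trans (((χ s).map_smul a y).trans
            (congrArg (a • ·) (hg' s y).symm))
        · refine (congrArg g.hom (smul_add a z z')).trans ((map_add g.hom _ _).trans ?_)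
          refine (congrArg₂ (· + ·) hz hz').trans ?_
          exact ((congrArg (a • ·) (map_add g.hom z z')).trans (smul_add a _ _)).symm }
  have hψ : ∀ s y, ψ ((t s).app (op d) y) = χ s y := hg'
  refine ⟨ψ, fun z => ?_, fun ψ' hψ' => ?_⟩
  · refine h.fiber_induction c (P := fun z => ψ (resMap T f z) = φ z) (fun s y => ?_)
      (fun z z' hz hz' => ?_) z
    · rw [← resMap_naturality, hψ, hχ]
    · rw [map_add, map_add, map_add, hz, hz']
  · have h1 : ∀ s, ψ'.comp ((t s).app (op d)).hom = χ s := fun s => hχu s _ fun y => by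
      change ψ' ((t s).app (op d) (resMap Y.X f y)) = _
      rw [resMap_naturality, hψ']
    ext z
    refine h.fiber_induction (op d) (P := fun z => ψ' z = ψ z) (fun s y => ?_)
      (fun z z' hz hz' => ?_) z
    · rw [hψ, ← h1]; rfl
    · rw [map_add, map_add, hz, hz']

end TensorExtension

open Limits

/-! ### Transfer of tensor products and liftings along a fully faithful functor. -/

section FullyFaithful

variable {k : Type u} [Field k] {D : Type u₁} [Category.{v₁} D] [Preadditive D] [Linear k D]
  {D' : Type u₂} [Category.{v₂} D'] [Preadditive D'] [Linear k D'] (G : D ⥤ D')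
  [G.Additive] [G.Linear k]
  {R S : Type u} [Ring R] [Algebra k R] [Ring S] [Algebra k S]

lemma IsTensor.congr {u : R →ₐ[k] S} {Y : RObj D (k := k) R} {T : D} {t t' : S →ₗ[k] (Y.X ⟶ T)}
    (h : IsTensor u Y t) (e : ∀ s, t s = t' s) : IsTensor u Y t' := by
  obtain rfl : t = t' := LinearMap.ext e
  exact h

variable [G.Full] [G.Faithful]

lemma exists_mapLinearMap_comp_eq {X Q : D} (t : S →ₗ[k] (G.obj X ⟶ G.obj Q)) :
    ∃ t' : S →ₗ[k] (X ⟶ Q), (G.mapLinearMap k) ∘ₗ t' = t :=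
  ⟨{ toFun := fun s => G.preimage (t s)
     map_add' := fun a b => G.map_injective (by simp)
     map_smul' := fun c a => G.map_injective (by simp) },
    LinearMap.ext fun s => G.map_preimage (t s)⟩

variable {G} in
/-- A fully faithful functor preserves a tensor product if the tensor product of the images is in
its essential image. -/
lemma IsTensor.map_of_exists {u : R →ₐ[k] S} {Y : RObj D (k := k) R} {T Q : D}
    {t : S →ₗ[k] (Y.X ⟶ T)} (h : IsTensor u Y t) {T' : D'}
    {t' : S →ₗ[k] ((Y.map G).X ⟶ T')} (h' : IsTensor u (Y.map G) t') (τ : G.obj Q ≅ T') :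
    IsTensor u (Y.map G) ((G.mapLinearMap k) ∘ₗ t) := by
  -- Move the tensor product of the images onto `G.obj Q`. It is then reflected to a tensor product
  -- `Q` in `D`, which must be isomorphic to `T`.
  obtain ⟨t₁, ht₁⟩ := exists_mapLinearMap_comp_eq G (X := Y.X) (Q := Q)
    (Linear.rightComp k _ τ.inv ∘ₗ t')
  have h₁ : IsTensor u (Y.map G) ((G.mapLinearMap k) ∘ₗ t₁) :=
    (h'.of_iso (t' := Linear.rightComp k _ τ.inv ∘ₗ t') τ.symm fun s => rfl).congr
      (fun s => (DFunLike.congr_fun ht₁ s).symm)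
  obtain ⟨σ, hσ⟩ := h₁.of_map.exists_iso h
  exact h₁.of_iso (G.mapIso σ) fun s => (G.map_comp _ _).symm.trans (congrArg G.map (hσ s))

variable {G} in
/-- The structure of an `S`-object on a preimage of an `S`-object under a fully faithful
functor. -/
def RObj.lift (Z : RObj D' (k := k) S) {Q : D} (τ : G.obj Q ≅ Z.X) : RObj D (k := k) S where
  X := Q
  act := AlgHom.ofLinearMap
    { toFun := fun s => G.preimage (τ.hom ≫ Z.rmul s.unop ≫ τ.inv)
      map_add' := fun a b => G.map_injective (by
        rw [G.map_preimage, MulOpposite.unop_add, Z.rmul_add, Preadditive.add_comp,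
          Preadditive.comp_add]
        change _ = G.map (_ + _)
        rw [G.map_add, G.map_preimage, G.map_preimage])
      map_smul' := fun c a => G.map_injective (by
        rw [G.map_preimage, MulOpposite.unop_smul, Z.rmul_smul, Linear.smul_comp,
          Linear.comp_smul]
        change _ = G.map (c • _)
        rw [G.map_smul, G.map_preimage]) }
    (G.map_injective (by
      change G.map (G.preimage (τ.hom ≫ Z.rmul 1 ≫ τ.inv)) = G.map (𝟙 Q)
      rw [G.map_preimage, Z.rmul_one, G.map_id, Category.id_comp, Iso.hom_inv_id]))
    (fun a b => G.map_injective (by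
      change G.map (G.preimage (τ.hom ≫ Z.rmul (b.unop * a.unop) ≫ τ.inv)) =
        G.map (G.preimage (τ.hom ≫ Z.rmul b.unop ≫ τ.inv) ≫
          G.preimage (τ.hom ≫ Z.rmul a.unop ≫ τ.inv))
      rw [G.map_comp, G.map_preimage, G.map_preimage, G.map_preimage, Z.rmul_mul]
      simp))

variable {G} in
lemma RObj.lift_rmul (Z : RObj D' (k := k) S) {Q : D} (τ : G.obj Q ≅ Z.X) (s : S) :
    ((Z.lift τ).map G).rmul s ≫ τ.hom = τ.hom ≫ Z.rmul s := by
  change G.map (G.preimage (τ.hom ≫ Z.rmul s ≫ τ.inv)) ≫ τ.hom = _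
  rw [G.map_preimage]
  simp

end FullyFaithful

section Liftings

variable {k : Type u} [Field k] {p : ℕ} {C : Type u₁} [Category.{v₁} C] {A : Cᵒᵖ ⥤ AlgCat.{u} k}
  {D : Type u₂} [Category.{v₂} D] [Preadditive D] [Linear k D] (G : D ⥤ PreShMod A)
  [G.Additive] [G.Linear k] {F : Fin p → D} {R S : PtArt k p}

lemma IsMatricFree.of_iso {F : Fin p → PreShMod A} {Y Y' : RObj (PreShMod A) (k := k) R.carrier}
    (h : IsMatricFree (𝟭 (PreShMod A)) F R Y') (τ : Y.X ≅ Y'.X)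
    (hτ : ∀ r, Y.rmul r ≫ τ.hom = τ.hom ≫ Y'.rmul r) : IsMatricFree (𝟭 (PreShMod A)) F R Y := by
  intro c
  obtain ⟨e, he⟩ := h c
  refine ⟨((fiber A c).mapIso τ).toLinearEquiv.toAddEquiv.trans e, fun r y => ?_⟩
  have h1 : ((fiber A c).map τ.hom).hom (((fiber A c).map (Y.rmul r)).hom y) =
      ((fiber A c).map (Y'.rmul r)).hom (((fiber A c).map τ.hom).hom y) :=
    congrArg (fun g => (g.app (op c)).hom y) (hτ r)
  exact (congrArg e h1).trans (he r _)

/-- The image of a lifting under a fully faithful functor preserving its fibers. -/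
lemma Lifting.isLifting_map (L : Lifting G F R)
    (hG : ∀ i, IsTensor (R.point i) (L.Y.map G)
      ((G.mapLinearMap k) ∘ₗ LinearMap.toSpanSingleton k _ (L.q i))) :
    IsLifting (𝟭 (PreShMod A)) (fun i => G.obj (F i)) R (L.Y.map G) (fun i => G.map (L.q i)) where
  free := L.isLifting.free
  fiber i := (hG i).congr fun s => Functor.map_smul G (r := s) (f := L.q i)

variable [G.Full] [G.Faithful]

/-- A lifting of the images comes from a lifting if the underlying object does. -/
lemma Lifting.exists_lift (L : Lifting (𝟭 (PreShMod A)) (fun i => G.obj (F i)) R) {Q : D}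
    (τ : G.obj Q ≅ L.Y.X) : ∃ (L' : Lifting G F R) (σ : G.obj L'.Y.X ≅ L.Y.X),
      (∀ r, (L'.Y.map G).rmul r ≫ σ.hom = σ.hom ≫ L.Y.rmul r) ∧
        ∀ i, σ.hom ≫ L.q i = G.map (L'.q i) := by
  have hq : ∀ i, G.map (G.preimage (τ.hom ≫ L.q i)) = τ.hom ≫ L.q i := fun i => G.map_preimage _
  refine ⟨⟨L.Y.lift τ, fun i => G.preimage (τ.hom ≫ L.q i), ?_, fun i => ?_⟩, τ,
    L.Y.lift_rmul τ, fun i => (hq i).symm⟩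
  · exact IsMatricFree.of_iso (Y := (L.Y.lift τ).map G) L.isLifting.free τ (L.Y.lift_rmul τ)
  · refine IsTensor.of_map G ?_
    refine ((L.isLifting.fiber i).of_iso_left (Y := (L.Y.lift τ).map G) τ
      (L.Y.lift_rmul τ)).congr fun s => ?_
    change τ.hom ≫ (s • L.q i) = G.map (s • G.preimage (τ.hom ≫ L.q i))
    rw [G.map_smul, hq, Linear.comp_smul]

/-- Base change for liftings in a full subcategory of presheaves of modules. -/
lemma hasBaseChange_of_full_faithful
    (hmap : ∀ (R : PtArt k p) (L : Lifting G F R), IsLifting (𝟭 (PreShMod A))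
      (fun i => G.obj (F i)) R (L.Y.map G) (fun i => G.map (L.q i)))
    (hlift : ∀ (R : PtArt k p) (L : Lifting (𝟭 (PreShMod A)) (fun i => G.obj (F i)) R),
      ∃ (L' : Lifting G F R) (σ : G.obj L'.Y.X ≅ L.Y.X),
        (∀ r, (L'.Y.map G).rmul r ≫ σ.hom = σ.hom ≫ L.Y.rmul r) ∧
          ∀ i, σ.hom ≫ L.q i = G.map (L'.q i)) : HasBaseChange G F := by
  intro R S f L
  obtain ⟨L₁, b₁, h₁⟩ := hasBaseChange_presheaf (fun i => G.obj (F i)) f ⟨_, _, hmap R L⟩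
  obtain ⟨L', σ, hσ, hσq⟩ := hlift S L₁
  obtain ⟨b, hb⟩ : ∃ b : L.Y.X ⟶ L'.Y.X, G.map b = b₁ ≫ σ.inv := G.map_surjective _
  have hσ'' : ∀ s, G.map (L'.Y.rmul s) ≫ σ.hom = σ.hom ≫ L₁.Y.rmul s := hσ
  have hσ' : ∀ s, σ.inv ≫ G.map (L'.Y.rmul s) = L₁.Y.rmul s ≫ σ.inv := fun s => by
    rw [Iso.inv_comp_eq, ← Category.assoc, ← hσ'', Category.assoc, Iso.hom_inv_id,
      Category.comp_id]
  refine ⟨L', b, IsTensor.of_map G (h₁.tensor.of_iso σ.symm fun s => ?_),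
    fun i => G.map_injective ?_⟩
  · change (b₁ ≫ L₁.Y.rmul s) ≫ σ.inv = G.map (b ≫ L'.Y.rmul s)
    rw [G.map_comp, hb]
    exact (Category.assoc _ _ _).trans
      ((congrArg (b₁ ≫ ·) (hσ' s).symm).trans (Category.assoc _ _ _).symm)
  · rw [G.map_comp, hb, ← hσq]
    exact (Category.assoc _ _ _).trans
      ((congrArg (b₁ ≫ ·) (Iso.inv_hom_id_assoc _ _)).trans (h₁.comp_q i))

end Liftings

/-! ### Comparison of the two deformation functors. -/

section Comparison

variable {k : Type u} [Field k] {X : TopCat.{u}} {A : TopCat.Sheaf (AlgCat.{u} k) X}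
  {𝒰 : Set (Opens X)} {p : ℕ} {F : Fin p → QCoh A} {R S : PtArt k p}

variable (hcover : ∀ x : X, ∃ U ∈ 𝒰, x ∈ U) (hgood : IsGood 𝒰) (haffine : ∀ U ∈ 𝒰, IsAffineOpen A U)
include hcover hgood haffine

/-- The forgetful functor from quasi-coherent modules preserves tensor products. -/
lemma IsTensor.map_forgetQCoh {R S : Type u} [Ring R] [Algebra k R] [Ring S] [Algebra k S]
    [Module.Finite k R] [Module.Finite k S] {u : R →ₐ[k] S} {Y : RObj (QCoh A) (k := k) R}
    {T : QCoh A} {t : S →ₗ[k] (Y.X ⟶ T)} (h : IsTensor u Y t) :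
    IsTensor u (Y.map (forgetQCoh A 𝒰)) (((forgetQCoh A 𝒰).mapLinearMap k) ∘ₗ t) := by
  have := full_forgetQCoh hcover hgood haffine
  have := faithful_forgetQCoh hcover hgood haffine
  obtain ⟨T', t', h'⟩ := exists_isTensor u (Y.map (forgetQCoh A 𝒰))
  obtain ⟨Q, ⟨τ⟩⟩ := exists_forgetQCoh_iso hcover hgood haffine
    (h'.isExtPresheaf (isExtPresheaf_forgetQCoh haffine Y.X))
  exact h.map_of_exists h' τ

lemma isLiftingPSh (L : LiftingQC A 𝒰 F R) : IsLiftingPSh A 𝒰 L := by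
  have := full_forgetQCoh hcover hgood haffine
  have := faithful_forgetQCoh hcover hgood haffine
  exact L.isLifting_map (forgetQCoh A 𝒰) fun i =>
    (L.isLifting.fiber i).map_forgetQCoh hcover hgood haffine

/-- This gives surjectivity on classes: the extension property passes from the fibers to `L`, whose
underlying presheaf therefore comes from a quasi-coherent module. -/
lemma exists_liftingQC (L : Lifting (𝟭 (PreShMod (resAlg A 𝒰))) (resFamily A 𝒰 F) R) :
    ∃ (L' : LiftingQC A 𝒰 F R) (σ : (forgetQCoh A 𝒰).obj L'.Y.X ≅ L.Y.X),
      (∀ r, (L'.Y.map (forgetQCoh A 𝒰)).rmul r ≫ σ.hom = σ.hom ≫ L.Y.rmul r) ∧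
        ∀ i, σ.hom ≫ L.q i = (forgetQCoh A 𝒰).map (L'.q i) := by
  have := full_forgetQCoh hcover hgood haffine
  have := faithful_forgetQCoh hcover hgood haffine
  obtain ⟨Q, ⟨τ⟩⟩ := exists_forgetQCoh_iso hcover hgood haffine
    (L.isLifting.isExtPresheaf fun i => isExtPresheaf_forgetQCoh haffine (F i))
  exact L.exists_lift (forgetQCoh A 𝒰) τ

theorem hasBaseChangeQC (F : Fin p → QCoh A) : HasBaseChangeQC A 𝒰 F := by
  have := full_forgetQCoh hcover hgood haffine
  have := faithful_forgetQCoh hcover hgood haffine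
  exact hasBaseChange_of_full_faithful (forgetQCoh A 𝒰)
    (fun _ L => isLiftingPSh hcover hgood haffine L)
    (fun _ L => exists_liftingQC hcover hgood haffine L)

/-- The image of a lifting under the forgetful functor. -/
def mapLifting (L : LiftingQC A 𝒰 F R) :
    Lifting (𝟭 (PreShMod (resAlg A 𝒰))) (resFamily A 𝒰 F) R :=
  ⟨L.Y.map (forgetQCoh A 𝒰), fun i => (forgetQCoh A 𝒰).map (L.q i),
    isLiftingPSh hcover hgood haffine L⟩

lemma mapLifting_equiv_iff (L L' : LiftingQC A 𝒰 F R) :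
    (mapLifting hcover hgood haffine L).Equiv (mapLifting hcover hgood haffine L') ↔
      L.Equiv L' := by
  have := full_forgetQCoh hcover hgood haffine
  have := faithful_forgetQCoh hcover hgood haffine
  constructor
  · rintro ⟨τ, hτ, hq⟩
    have h1 : (forgetQCoh A 𝒰).map ((forgetQCoh A 𝒰).preimageIso τ).hom = τ.hom :=
      (forgetQCoh A 𝒰).map_preimage _
    refine ⟨(forgetQCoh A 𝒰).preimageIso τ, fun r => (forgetQCoh A 𝒰).map_injective ?_,
      fun i => (forgetQCoh A 𝒰).map_injective ?_⟩
    · rw [Functor.map_comp, Functor.map_comp, h1]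
      exact hτ r
    · rw [Functor.map_comp, h1]
      exact hq i
  · rintro ⟨τ, hτ, hq⟩
    refine ⟨(forgetQCoh A 𝒰).mapIso τ, fun r => ?_, fun i => ?_⟩
    · exact ((forgetQCoh A 𝒰).map_comp _ _).symm.trans
        ((congrArg (forgetQCoh A 𝒰).map (hτ r)).trans ((forgetQCoh A 𝒰).map_comp _ _))
    · exact ((forgetQCoh A 𝒰).map_comp _ _).symm.trans (congrArg (forgetQCoh A 𝒰).map (hq i))

lemma isBaseChangeHom_mapLifting {f : R ⟶ S} {L : LiftingQC A 𝒰 F R} {L' : LiftingQC A 𝒰 F S}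
    {b : L.Y.X ⟶ L'.Y.X} (h : IsBaseChangeHom f L L' b) :
    IsBaseChangeHom f (mapLifting hcover hgood haffine L) (mapLifting hcover hgood haffine L')
      ((forgetQCoh A 𝒰).map b) where
  tensor := (h.tensor.map_forgetQCoh hcover hgood haffine).congr fun s =>
    (forgetQCoh A 𝒰).map_comp b (L'.Y.rmul s)
  comp_q i := ((forgetQCoh A 𝒰).map_comp _ _).symm.trans
    (congrArg (forgetQCoh A 𝒰).map (h.comp_q i))

/-- The bijection between equivalence classes of liftings. -/
def liftingEquiv (F : Fin p → QCoh A) (R : PtArt k p) :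
    Quotient (Lifting.setoid (forgetQCoh A 𝒰) F R) ≃
      Quotient (Lifting.setoid (𝟭 (PreShMod (resAlg A 𝒰))) (resFamily A 𝒰 F) R) :=
  Equiv.ofBijective
    (Quotient.map (mapLifting hcover hgood haffine) fun L L' =>
      (mapLifting_equiv_iff hcover hgood haffine L L').mpr) <| by
    constructor
    · intro x y
      induction x, y using Quotient.inductionOn₂ with
      | h L L' =>
        intro e
        exact Quotient.sound ((mapLifting_equiv_iff hcover hgood haffine L L').mp
          (Quotient.exact e))
    · intro y
      induction y using Quotient.inductionOn with
      | h L =>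
        obtain ⟨L', σ, hσ, hσq⟩ := exists_liftingQC hcover hgood haffine L
        exact ⟨⟦L'⟧, Quotient.sound ⟨σ, hσ, hσq⟩⟩

/-- The comparison isomorphism of deformation functors. -/
def defIso (F : Fin p → QCoh A) (hqc : HasBaseChangeQC A 𝒰 F) (hpsh : HasBaseChangePSh A 𝒰 F) :
    DefQC A 𝒰 F hqc ≅ DefPSh A 𝒰 F hpsh :=
  NatIso.ofComponents (fun R => (liftingEquiv hcover hgood haffine F R).toIso) fun {R S} f => by
    ext x
    induction x using Quotient.inductionOn with
    | h L =>
      -- Base change is unique up to equivalence, so naturality follows once the image of one base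
      -- change of `L` is known to be a base change of the image.
      obtain ⟨L', b, hb⟩ := hqc f L
      have h1 := baseChange_mk hqc hb
      have h2 := baseChange_mk hpsh (isBaseChangeHom_mapLifting hcover hgood haffine hb)
      exact (congrArg (liftingEquiv hcover hgood haffine F S) h1).trans h2.symm

end Comparison

end NCDef

end

theorem mainTheorem3 {k : Type u} [Field k] [IsAlgClosed k] {X : TopCat.{u}}
    (A : TopCat.Sheaf (AlgCat.{u} k) X) (𝒰 : Set (Opens X))
    (hcover : ∀ x : X, ∃ U ∈ 𝒰, x ∈ U) (hgood : NCDef.IsGood 𝒰)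
    (haffine : ∀ U ∈ 𝒰, NCDef.IsAffineOpen A U)
    {p : ℕ} (F : Fin p → NCDef.QCoh A) :
    ∃ (hqc : NCDef.HasBaseChangeQC A 𝒰 F) (hpsh : NCDef.HasBaseChangePSh A 𝒰 F)
      (Φ : NCDef.DefQC A 𝒰 F hqc ≅ NCDef.DefPSh A 𝒰 F hpsh),
      ∀ (R : NCDef.PtArt k p) (L : NCDef.LiftingQC A 𝒰 F R),
        ∃ h : NCDef.IsLiftingPSh A 𝒰 L,
          Φ.hom.app R (NCDef.Def.mk L) =
            NCDef.Def.mk ⟨L.Y.map (NCDef.forgetQCoh A 𝒰),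
              fun i => (NCDef.forgetQCoh A 𝒰).map (L.q i), h⟩ := by
  have hqc := NCDef.hasBaseChangeQC hcover hgood haffine F
  have hpsh : NCDef.HasBaseChangePSh A 𝒰 F := NCDef.hasBaseChange_presheaf _
  exact ⟨hqc, hpsh, NCDef.defIso hcover hgood haffine F hqc hpsh, fun R L =>
    ⟨NCDef.isLiftingPSh hcover hgood haffine L, rfl⟩⟩
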